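/- For $x,b\in[0,1]^n$ write $x\le b$ if $x$ is at most $b$ in every coordinate. A finite set $B\subseteq[0,1]^n$ is a \emph{Pareto cover} of a probability measure $\mu$ on $[0,1]^n$ if $\mu(\{x : x\le b \text{ for some } b\in B\})=1$. For $c\in\mathbb{Q}^n_{\ge0}$ let $c_B(x)=\min\{c^{\top}b : b\in B,\ x\le b\}$ (with $\min\emptyset=\infty$). A \emph{discrete instance} $(a,p,c)$ consists of rational numbers $0=a_0<a_1<\dots<a_M<a_{M+1}=1$, rational numbers $p^i_j\in[0,1]$ ($1\le i\le n$, $0\le j\le M+1$) with $\sum_{j}p^i_j=1$ for all $i$, and $c\in\mathbb{Q}^n_{\ge0}$; $\mu_{a,p}$ is the product distribution on $\{a_0,\dots,a_{M+1}\}^n$ whose $i$-th coordinate equals $a_j$ with probability $p^i_j$. For $p\in([0,1]\cap\mathbb{Q})^n$, $\mu_p$ is the product distribution on $\{0,1\}^n$ whose $i$-th coordinate equals $1$ with probability $p_i$. Rational numbers are given, and returned, as fractions of integers written in binary. Let $k\ge1$ be a fixed integer. (i) There is an algorithm that, given a discrete instance $(a,p,c)$ and a Pareto cover $B\subseteq\{a_0,\dots,a_{M+1}\}^n$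 of $\mu=\mu_{a,p}$ with $|B|=k$, computes $\operatorname{E}_\mu[c_B]$ in time polynomial in the length of the binary encoding of the input. (ii) The following problem (the discrete Pareto cover problem for the fixed $k$) is in NP: given a discrete instance $(a,p,c)$ and $\gamma\in\mathbb{Q}$, decide whether there is a Pareto cover $B\subseteq[0,1]^n$ of $\mu_{a,p}$ with $|B|=k$ and $\operatorname{E}_{\mu_{a,p}}[c_B]\le\gamma$. (iii) The following problem (the binary Pareto cover problem for the fixed $k$) is in NP: given $p\in([0,1]\cap\mathbb{Q})^n$, $c\in\mathbb{Q}^n_{\ge0}$ and $\gamma\in\mathbb{Q}$, decide whether there is a Pareto cover $B\subseteq[0,1]^n$ of $\mu_p$ with $|B|=k$ and $\operatorname{E}_{\mu_p}[c_B]\le\gamma$. -/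

import Mathlib

open scoped ENNReal
open Computability Turing MeasureTheory

namespace ParetoCover

/-! ### Pareto covers and their costs

The cube `[0,1]^n` is `Set.Icc 0 1` in `Fin n → ℝ`, ordered coordinatewise; a probability measure
on the cube is a measure on `Fin n → ℝ` concentrated on it. -/

/-- `B` is a Pareto cover of `μ`: a random point is almost surely covered by a point of `B`. -/
def IsParetoCover {n : ℕ} (μ : Measure (Fin n → ℝ)) (B : Set (Fin n → ℝ)) : Prop :=
  μ {x | ∃ b ∈ B, x ≤ b} = 1

/-- The function `c_B(x) = min {c • b : x ≤ b, b ∈ B}`, with value `∞` where `x` is not covered.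
It is only used for a nonnegative vector `c` and finite `B ⊆ [0,1]^n`, so that `c • b ≥ 0`. -/
noncomputable def coverCost {n : ℕ} (c : Fin n → ℝ) (B : Set (Fin n → ℝ)) (x : Fin n → ℝ) :
    ℝ≥0∞ :=
  ⨅ b ∈ B, ⨅ _ : x ≤ b, ENNReal.ofReal (∑ i, c i * b i)

/-- The expectation of `c_B` under `μ`. -/
noncomputable def expectedCost {n : ℕ} (μ : Measure (Fin n → ℝ)) (c : Fin n → ℝ)
    (B : Set (Fin n → ℝ)) : ℝ≥0∞ :=
  ∫⁻ x, coverCost c B x ∂μ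

/-- The product distribution on `{a_0, …, a_{M+1}}^n` in which the `i`-th coordinate equals `a_j`
with probability `p i j`. -/
noncomputable def discreteMeasure {n M : ℕ} (a : Fin (M + 2) → ℝ) (p : Fin n → Fin (M + 2) → ℝ) :
    Measure (Fin n → ℝ) :=
  ∑ x : Fin n → Fin (M + 2),
    (∏ i, ENNReal.ofReal (p i (x i))) • Measure.dirac (fun i => a (x i))

/-- The product distribution on `{0,1}^n` in which the `i`-th coordinate equals `1` with
probability `p i`. -/
noncomputable def binaryMeasure {n : ℕ} (p : Fin n → ℝ) : Measure (Fin n → ℝ) :=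
  ∑ x : Fin n → Bool,
    (∏ i, ENNReal.ofReal (if x i then p i else 1 - p i)) •
      Measure.dirac (fun i => if x i then (1 : ℝ) else 0)

/-- There is a Pareto cover `B ⊆ [0,1]^n` of `μ` with exactly `k` points and expected cost at
most `γ`. The comparison takes place in `EReal`, so that negative `γ` are treated correctly. -/
def HasCheapCover {n : ℕ} (k : ℕ) (μ : Measure (Fin n → ℝ)) (c : Fin n → ℝ) (γ : ℝ) : Prop :=
  ∃ B : Finset (Fin n → ℝ), (∀ b ∈ B, b ∈ Set.Icc 0 1) ∧ B.card = k ∧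
    IsParetoCover μ B ∧ (expectedCost μ c B : EReal) ≤ (γ : EReal)

/-! ### Instances -/

/-- A fraction (not necessarily in lowest terms) representing a rational number. -/
structure Fraction where
  num : ℤ
  den : ℕ
  den_pos : 0 < den

/-- The rational number represented by a fraction, as a real number. -/
noncomputable def Fraction.val (q : Fraction) : ℝ := (q.num : ℝ) / (q.den : ℝ)

/-- The data `(a, p, c)` of an instance of the discrete Pareto cover problem. -/
structure DiscreteInstance where
  n : ℕ
  M : ℕ
  a : Fin (M + 2) → Fraction
  p : Fin n → Fin (M + 2) → Fraction
  c : Fin n → Fraction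
  a_zero : (a 0).val = 0
  a_last : (a (Fin.last (M + 1))).val = 1
  a_strictMono : StrictMono fun j => (a j).val
  p_mem : ∀ i j, (p i j).val ∈ Set.Icc (0 : ℝ) 1
  p_sum : ∀ i, ∑ j, (p i j).val = 1
  c_nonneg : ∀ i, 0 ≤ (c i).val

/-- The measure `μ_{a,p}` of an instance. -/
noncomputable def DiscreteInstance.measure (I : DiscreteInstance) : Measure (Fin I.n → ℝ) :=
  discreteMeasure (fun j => (I.a j).val) (fun i j => (I.p i j).val)

/-- The cost vector of an instance. -/
noncomputable def DiscreteInstance.cost (I : DiscreteInstance) : Fin I.n → ℝ :=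
  fun i => (I.c i).val

/-- The data `(p, c)` of an instance of the binary Pareto cover problem. -/
structure BinaryInstance where
  n : ℕ
  p : Fin n → Fraction
  c : Fin n → Fraction
  p_mem : ∀ i, (p i).val ∈ Set.Icc (0 : ℝ) 1
  c_nonneg : ∀ i, 0 ≤ (c i).val

/-- The measure `μ_p` of a binary instance. -/
noncomputable def BinaryInstance.measure (I : BinaryInstance) : Measure (Fin I.n → ℝ) :=
  binaryMeasure fun i => (I.p i).val

/-- The cost vector of a binary instance. -/
noncomputable def BinaryInstance.cost (I : BinaryInstance) : Fin I.n → ℝ :=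
  fun i => (I.c i).val

/-- Data `(a, p, c)` together with a Pareto cover `B = {b_1, …, b_k} ⊆ {a_0, …, a_{M+1}}^n` of
`μ_{a,p}` with `|B| = k`, given by a list of its points. -/
structure CoverInstance (k : ℕ) extends DiscreteInstance where
  b : Fin k → Fin n → Fraction
  b_injective : Function.Injective fun j i => (b j i).val
  b_grid : ∀ j i, ∃ l, (b j i).val = (a l).val
  b_cover : IsParetoCover toDiscreteInstance.measure (Set.range fun j i => (b j i).val)

/-- The cover `B` as a set of points. -/
noncomputable def CoverInstance.cover {k : ℕ} (I : CoverInstance k) : Set (Fin I.n → ℝ) :=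
  Set.range fun j i => (I.b j i).val

/-! ### Binary encodings

Words over the alphabet consisting of `bit 0`, `bit 1`, `bra`, `ket`, `comma` (and an unused
`blank`). Natural numbers are written in binary and terminated by `comma`, an integer is a sign bit
followed by its absolute value, a fraction is its numerator followed by its denominator, and a
list is the concatenation of the codes of its entries between `bra` and `ket`. -/

def encNat (m : ℕ) : List Γ' := (encodeNat m).map Γ'.bit ++ [Γ'.comma]

def encInt (z : ℤ) : List Γ' := Γ'.bit (decide (z < 0)) :: encNat z.natAbs

def encFraction (q : Fraction) : List Γ' := encInt q.num ++ encNat q.den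

def encFamily {α : Type} {m : ℕ} (e : α → List Γ') (v : Fin m → α) : List Γ' :=
  Γ'.bra :: ((List.ofFn v).flatMap e ++ [Γ'.ket])

def encDiscrete (I : DiscreteInstance) : List Γ' :=
  encFamily encFraction I.a ++ encFamily (encFamily encFraction) I.p ++ encFamily encFraction I.c

def encBinary (I : BinaryInstance) : List Γ' :=
  encFamily encFraction I.p ++ encFamily encFraction I.c

def encCover {k : ℕ} (I : CoverInstance k) : List Γ' :=
  encDiscrete I.toDiscreteInstance ++ encFamily (encFamily encFraction) I.b

/-! ### Polynomial time and NP -/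

/-- `f` is computable in polynomial time, with respect to the encodings `ea` and `eb`, by a
(multi-stack) Turing machine. -/
def PolyTime {α β A A₂ : Type} (ea : α → List A) (eb : β → List A₂) (f : α → β) : Prop :=
  Nonempty (TM2ComputableInPolyTime ea eb f)

/-- The complexity class NP: a word is in `L` if and only if it has a certificate of polynomially
bounded length that is accepted by a polynomial-time verifier. The verifier is defined on all
pairs of words, which are encoded as the concatenation over the disjoint union of the alphabets. -/
def InNP {A : Type} (L : Language A) : Prop :=
  ∃ (q : Polynomial ℕ) (V : List A × List Bool → Bool),
    PolyTime (encodingProd (encodingList A) (encodingList Bool)).encode encodeBool V ∧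
    ∀ w, w ∈ L ↔ ∃ u : List Bool, u.length ≤ q.eval w.length ∧ V (w, u) = true

/-- The discrete Pareto cover problem for covers of size `k`: the codes of its yes-instances. -/
def discreteParetoCoverProblem (k : ℕ) : Language Γ' :=
  {w | ∃ (I : DiscreteInstance) (γ : Fraction), w = encDiscrete I ++ encFraction γ ∧
    HasCheapCover k I.measure I.cost γ.val}

/-- The binary Pareto cover problem for covers of size `k`: the codes of its yes-instances. -/
def binaryParetoCoverProblem (k : ℕ) : Language Γ' :=
  {w | ∃ (I : BinaryInstance) (γ : Fraction), w = encBinary I ++ encFraction γ ∧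
    HasCheapCover k I.measure I.cost γ.val}

end ParetoCover

/-! ### Structured programs on stacks -/

/-! For fixed `k`, a point x enters c_B(x) only through the set of those b in B with x ≤ b. There
are 2^k such sets, a constant number, and the set of x is the intersection over all coordinates i of
the sets {b : x_i ≤ b_i}. Under a product measure the distribution of this random set can therefore
be updated one coordinate at a time (`dpStep`), although the measure has exponentially many atoms.
The expected cost is the sum over the sets of probability times cheapest selected cost, and B is a
Pareto cover exactly if the empty set has probability zero. The identity behind this is `total_dp`;
`isParetoCover_iff` and `expectedCost_eq` translate it into measure theory.

All arithmetic is done on natural numbers: the probabilities of each coordinate are brought to a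
common denominator, and so are the costs of the `k` points. At every stage the weights of the
dynamic program sum to at most a product of row sums, so their bit lengths are bounded by the input
size (`pTime_dp`).

For membership in NP the certificate is a cover by grid points. Rounding the points of a cover down
to the grid does not change which grid points lie below them and does not increase the cost
(`HasCheapCover.exists_grid`). Rounding may merge points, but adding points keeps a cover a cover
and never raises its cost, and in positive dimension the cube has enough points to restore the
cardinality `k` (`hasCheapCover_of_family`). Dimension zero forces `k = 1`. The certificate also
contains the instance itself; the verifier encodes it again and compares the result with the input
word (`inNP_of_certificate`), so malformed words are rejected. The binary problem is the discrete
one with grid {0, 1}.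

Polynomial time for Turing machines rests on a small programming language whose programs compile to
multi-stack machines (`Run.simulate`, `polyTime_of_pTime`). Data are binary trees in prefix code,
and a program replaces the tree on top of one stack. The resulting class `PTime` is closed under
composition, pairing, case distinction and folds whose intermediate values have polynomial size
(`PTime.foldl`), so running times of algorithms follow from closure properties and size bounds. -/

namespace StackProgram

/-- Structured programs over a family of stacks. -/
inductive Prog {K : Type} (Γ : K → Type) : Type
  | skip : Prog Γ
  | push (k : K) (a : Γ k) : Prog Γ
  | pop (k : K) (f : Option (Γ k) → Prog Γ) : Prog Γ
  | seq (P Q : Prog Γ) : Prog Γ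
  | loop (k : K) (c : Option (Γ k) → Bool) (P : Prog Γ) : Prog Γ

section
variable {K : Type} {Γ : K → Type}

/-- The labels needed to compile a program. -/
def Lab : Prog Γ → Type
  | .skip => Empty
  | .push _ _ => Unit
  | .pop _ f => Option (Σ o, Lab (f o))
  | .seq P Q => Lab P ⊕ Lab Q
  | .loop _ _ P => Option (Lab P)

/-- A `FinTM2` has finitely many labels. Finiteness of the alphabets enters through `pop`, which has
one branch for each symbol that may be read. -/
theorem finite_lab [∀ k, Finite (Γ k)] (P : Prog Γ) : Finite (Lab P) := by
  induction P with
  | skip => exact inferInstanceAs (Finite Empty)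
  | push => exact inferInstanceAs (Finite Unit)
  | pop k f ih =>
    have := ih
    exact inferInstanceAs (Finite (Option (Σ o, Lab (f o))))
  | seq P Q ih₁ ih₂ => exact inferInstanceAs (Finite (Lab P ⊕ Lab Q))
  | loop k c P ih => exact inferInstanceAs (Finite (Option (Lab P)))

variable [DecidableEq K]

/-- Big-step semantics: `Run P s s' t` says that `P` transforms the stacks `s` into `s'` within `t`
steps. -/
inductive Run : Prog Γ → (∀ k, List (Γ k)) → (∀ k, List (Γ k)) → ℕ → Prop
  | skip (s) : Run .skip s s 0
  | push (k a s) : Run (.push k a) s (Function.update s k (a :: s k)) 1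
  | pop {k f s s' t} : Run (f (s k).head?) (Function.update s k (s k).tail) s' t →
      Run (.pop k f) s s' (t + 1)
  | seq {P Q s₁ s₂ s₃ t₁ t₂} : Run P s₁ s₂ t₁ → Run Q s₂ s₃ t₂ → Run (.seq P Q) s₁ s₃ (t₁ + t₂)
  | loop_done {k c P s} : c (s k).head? = false → Run (.loop k c P) s s 1
  | loop_step {k c P s₁ s₂ s₃ t₁ t₂} : c (s₁ k).head? = true → Run P s₁ s₂ t₁ →
      Run (.loop k c P) s₂ s₃ t₂ → Run (.loop k c P) s₁ s₃ (t₁ + t₂ + 1)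

/-- A step changes the height of a stack by at most one. -/
theorem Run.length_le {P : Prog Γ} {s s' : ∀ k, List (Γ k)} {t : ℕ} (h : Run P s s' t) (j : K) :
    (s' j).length ≤ (s j).length + t := by
  induction h with
  | skip s => simp
  | push k a s =>
    by_cases hk : j = k
    · subst hk; simp
    · simp [hk]
  | @pop k f s s' t _ ih =>
    refine ih.trans ?_
    by_cases hk : j = k
    · subst hk; simp; omega
    · simp [hk]
  | seq _ _ ih₁ ih₂ => omega
  | loop_done _ => simp
  | loop_step _ _ _ ih₁ ih₂ => omega

/-- The label at which a compiled program starts; `emb` embeds the labels of the program, and `exit`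
is the label to which it jumps at the end. -/
def entry : (P : Prog Γ) → {L : Type} → (Lab P → L) → L → L
  | .skip, _, _, exit => exit
  | .push _ _, _, emb, _ => emb ()
  | .pop _ _, _, emb, _ => emb none
  | .seq P Q, _, emb, exit =>
      entry P (fun l => emb (.inl l)) (entry Q (fun l => emb (.inr l)) exit)
  | .loop _ _ _, _, emb, _ => emb none

/-- The statements of a compiled program. -/
def code : (P : Prog Γ) → {L : Type} → (Lab P → L) → L → Lab P →
    TM2.Stmt Γ L (∀ k, Option (Γ k))
  | .skip, _, _, _, l => l.elim
  | .push k a, _, _, exit, _ => .push k (fun _ => a) (.goto fun _ => exit)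
  | .pop k f, _, emb, exit, none =>
      .pop k (fun v o => Function.update v k o)
        (.goto fun v => entry (f (v k)) (fun l => emb (some ⟨_, l⟩)) exit)
  | .pop _ f, _, emb, exit, some ⟨o, l⟩ => code (f o) (fun l => emb (some ⟨o, l⟩)) exit l
  | .seq P Q, _, emb, exit, .inl l =>
      code P (fun l => emb (.inl l)) (entry Q (fun l => emb (.inr l)) exit) l
  | .seq _ Q, _, emb, exit, .inr l => code Q (fun l => emb (.inr l)) exit l
  | .loop k c P, _, emb, exit, none =>
      .peek k (fun v o => Function.update v k o)
        (.goto fun v => cond (c (v k)) (entry P (fun l => emb (some l)) (emb none)) exit)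
  | .loop _ _ P, _, emb, _, some l => code P (fun l => emb (some l)) (emb none) l

/-- Compiled programs simulate the big-step semantics. -/
theorem Run.simulate {P : Prog Γ} {s s' : ∀ k, List (Γ k)} {t : ℕ} (h : Run P s s' t) :
    -- Label type, embedding and exit are universally quantified because a subprogram is run inside
    -- the label type of the whole program. The final state is left open: it only stores the last
    -- symbol read from each stack, and every `pop` or loop test overwrites its entry before using
    -- it.
    ∀ {L : Type} (emb : Lab P → L) (exit : L) (m : L → TM2.Stmt Γ L (∀ k, Option (Γ k))),
      (∀ l, m (emb l) = code P emb exit l) → ∀ v, ∃ v',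
        (flip bind (TM2.step m))^[t] (some ⟨some (entry P emb exit), v, s⟩) =
          some ⟨some exit, v', s'⟩ := by
  induction h with
  | skip s => exact fun emb exit m hm v => ⟨v, rfl⟩
  | push k a s =>
    intro L emb exit m hm v
    refine ⟨v, ?_⟩
    have := hm ()
    simp [flip, entry, this, code]
  | @pop k f s s' t _ ih =>
    intro L emb exit m hm v
    obtain ⟨v', hv⟩ := ih (fun l => emb (some ⟨_, l⟩)) exit m
      (fun l => hm (some ⟨_, l⟩)) (Function.update v k (s k).head?)
    refine ⟨v', ?_⟩
    have := hm none
    -- The label embedding depends on the symbol read, so the symbol is generalised to a variable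
    -- before the equality is substituted.
    have key : ∀ o, o = (s k).head? →
        entry (f o) (fun l => emb (some ⟨_, l⟩)) exit =
          entry (f (s k).head?) (fun l => emb (some ⟨_, l⟩)) exit := by
      rintro _ rfl; rfl
    rw [Function.iterate_add_apply, ← hv]
    congr 1
    simp [flip, entry, this, code, key _ (Function.update_self k (s k).head? v)]
  | @seq P Q s₁ s₂ s₃ t₁ t₂ _ _ ih₁ ih₂ =>
    intro L emb exit m hm v
    obtain ⟨v₁, h₁⟩ := ih₁ (fun l => emb (.inl l)) (entry Q (fun l => emb (.inr l)) exit) m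
      (fun l => hm (.inl l)) v
    obtain ⟨v₂, h₂⟩ := ih₂ (fun l => emb (.inr l)) exit m (fun l => hm (.inr l)) v₁
    refine ⟨v₂, ?_⟩
    rw [add_comm, Function.iterate_add_apply]
    simp only [entry]
    rw [h₁, h₂]
  | @loop_done k c P s hc =>
    intro L emb exit m hm v
    refine ⟨Function.update v k (s k).head?, ?_⟩
    have := hm none
    simp [flip, entry, this, code, hc]
  | @loop_step k c P s₁ s₂ s₃ t₁ t₂ hc _ _ ih₁ ih₂ =>
    intro L emb exit m hm v
    obtain ⟨v₁, h₁⟩ := ih₁ (fun l => emb (some l)) (emb none) m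
      (fun l => hm (some l)) (Function.update v k (s₁ k).head?)
    obtain ⟨v₂, h₂⟩ := ih₂ emb exit m hm v₁
    refine ⟨v₂, ?_⟩
    have := hm none
    rw [Function.iterate_add_apply, add_comm t₁, Function.iterate_add_apply, ← h₂]
    congr 1
    simp only [entry] at h₁ ⊢
    rw [← h₁]
    simp [flip, this, code, hc]

/-- The Turing machine that runs a program and halts. -/
noncomputable def machine [Fintype K] [∀ k, Fintype (Γ k)] (P : Prog Γ) (k₀ k₁ : K) : FinTM2 where
  K := K
  k₀ := k₀
  k₁ := k₁
  Γ := Γ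
  Λ := Option (Lab P)
  main := entry P some none
  ΛFin := haveI := finite_lab P; Fintype.ofFinite _
  σ := ∀ k, Option (Γ k)
  initialState := fun _ => none
  σFin := inferInstance
  m
    -- The configuration `haltList` has the initial state, so the state is reset before halting.
    -- This accounts for the additional step in `machine_evals`.
    | none => .load (fun _ _ => none) .halt
    | some l => code P some none l

theorem machine_evals [Fintype K] [∀ k, Fintype (Γ k)] {P : Prog Γ} {k₀ k₁ : K}
    {s s' : ∀ k, List (Γ k)} {t : ℕ} (h : Run P s s' t) :
    (flip bind (machine P k₀ k₁).step)^[t + 1]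
        (some (⟨some (machine P k₀ k₁).main, (machine P k₀ k₁).initialState, s⟩ :
          (machine P k₀ k₁).Cfg)) =
      some (⟨none, (machine P k₀ k₁).initialState, s'⟩ : (machine P k₀ k₁).Cfg) := by
  obtain ⟨v, hv⟩ := h.simulate some none (machine P k₀ k₁).m (fun _ => rfl) fun _ => none
  rw [add_comm, Function.iterate_add_apply]
  refine (congrArg _ hv).trans ?_
  simp only [Function.iterate_one, flip, FinTM2.step]
  rfl

end

/-! ### Work stacks -/

/-- Names of the stacks: input, output and four work stacks. -/
inductive Stk
  | inp | out | main | aux₁ | aux₂ | cnt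
  deriving DecidableEq

instance : Fintype Stk :=
  ⟨{.inp, .out, .main, .aux₁, .aux₂, .cnt}, fun k => by cases k <;> simp⟩

/-- The alphabets of the stacks. -/
@[reducible] def Sym (A B : ℕ) : Stk → Type
  | .inp => Fin A
  | .out => Fin B
  | .main => Bool
  -- On the auxiliary stacks, the letter `none` marks the bottom of a stored tree.
  | .aux₁ => Option Bool
  | .aux₂ => Option Bool
  | .cnt => Bool

instance (A B : ℕ) : ∀ k, Fintype (Sym A B k)
  | .inp => inferInstanceAs (Fintype (Fin A))
  | .out => inferInstanceAs (Fintype (Fin B))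
  | .main => inferInstanceAs (Fintype Bool)
  | .aux₁ => inferInstanceAs (Fintype (Option Bool))
  | .aux₂ => inferInstanceAs (Fintype (Option Bool))
  | .cnt => inferInstanceAs (Fintype Bool)

variable {A B : ℕ}

/-- The contents of the stacks. -/
def mk (i : List (Fin A)) (o : List (Fin B)) (m : List Bool) (a b : List (Option Bool))
    (c : List Bool) : ∀ k, List (Sym A B k)
  | .inp => i
  | .out => o
  | .main => m
  | .aux₁ => a
  | .aux₂ => b
  | .cnt => c

section
variable (i i' : List (Fin A)) (o o' : List (Fin B)) (m m' : List Bool)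
  (a b a' : List (Option Bool)) (c : List Bool)

@[simp] theorem update_inp : Function.update (mk i o m a b c) .inp i' = mk i' o m a b c := by
  funext k; cases k <;> rfl
@[simp] theorem update_out : Function.update (mk i o m a b c) .out o' = mk i o' m a b c := by
  funext k; cases k <;> rfl
@[simp] theorem update_main : Function.update (mk i o m a b c) .main m' = mk i o m' a b c := by
  funext k; cases k <;> rfl
@[simp] theorem update_aux₁ : Function.update (mk i o m a b c) .aux₁ a' = mk i o m a' b c := by
  funext k; cases k <;> rfl
@[simp] theorem update_aux₂ : Function.update (mk i o m a b c) .aux₂ a' = mk i o m a a' c := by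
  funext k; cases k <;> rfl
@[simp] theorem update_cnt : Function.update (mk i o m a b c) .cnt m' = mk i o m a b m' := by
  funext k; cases k <;> rfl
end

end StackProgram

/-! ### Binary trees and operations on the top of the main stack -/

/-- Binary trees, the universal data type of the computations below. -/
inductive BTree
  | leaf
  | node (l r : BTree)

namespace BTree

/-- The prefix code of a tree. -/
def enc : BTree → List Bool
  | leaf => [false]
  | node l r => true :: (enc l ++ enc r)

/-- The length of the prefix code. -/
def size : BTree → ℕ
  | leaf => 1
  | node l r => 1 + size l + size r

@[simp] theorem length_enc (t : BTree) : t.enc.length = t.size := by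
  induction t with
  | leaf => rfl
  | node l r ihl ihr => simp [enc, size, ihl, ihr]; omega

theorem size_pos (t : BTree) : 0 < t.size := by
  cases t <;> simp [size]

/-- The tree of a unary number. -/
def chain : ℕ → BTree
  | 0 => leaf
  | n + 1 => node leaf (chain n)

@[simp] theorem size_chain (n : ℕ) : (chain n).size = 2 * n + 1 := by
  induction n with
  | zero => rfl
  | succ n ih => simp [chain, size, ih]; omega

end BTree

namespace StackProgram

variable {A B : ℕ}

section
variable {K : Type} [DecidableEq K] {Γ : K → Type}

/-- `Within P s s' t` says that `P` transforms the stacks `s` into `s'` within at most `t` steps. -/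
def Within (P : Prog Γ) (s s' : ∀ k, List (Γ k)) (t : ℕ) : Prop :=
  ∃ t' ≤ t, Run P s s' t'

theorem Within.mono {P : Prog Γ} {s s' : ∀ k, List (Γ k)} {t t' : ℕ} (h : Within P s s' t)
    (ht : t ≤ t') : Within P s s' t' :=
  let ⟨u, hu, hr⟩ := h
  ⟨u, hu.trans ht, hr⟩

theorem Within.seq {P Q : Prog Γ} {s₁ s₂ s₃ : ∀ k, List (Γ k)} {t₁ t₂ : ℕ}
    (h₁ : Within P s₁ s₂ t₁) (h₂ : Within Q s₂ s₃ t₂) : Within (.seq P Q) s₁ s₃ (t₁ + t₂) :=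
  let ⟨_, hu, hr⟩ := h₁
  let ⟨_, hu', hr'⟩ := h₂
  ⟨_, add_le_add hu hu', hr.seq hr'⟩

theorem Within.skip (s : ∀ k, List (Γ k)) : Within .skip s s 0 := ⟨0, le_rfl, .skip s⟩

theorem Within.push (k a) (s : ∀ k, List (Γ k)) :
    Within (.push k a) s (Function.update s k (a :: s k)) 1 := ⟨1, le_rfl, .push k a s⟩

theorem Within.pop {k} {f : Option (Γ k) → Prog Γ} {s s' : ∀ k, List (Γ k)} {t : ℕ}
    (h : Within (f (s k).head?) (Function.update s k (s k).tail) s' t) :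
    Within (.pop k f) s s' (t + 1) :=
  let ⟨u, hu, hr⟩ := h
  ⟨u + 1, by omega, hr.pop⟩

theorem Within.loop_done {k c} {P : Prog Γ} {s : ∀ k, List (Γ k)} (h : c (s k).head? = false) :
    Within (.loop k c P) s s 1 := ⟨1, le_rfl, .loop_done h⟩

theorem Within.loop_step {k c} {P : Prog Γ} {s₁ s₂ s₃ : ∀ k, List (Γ k)} {t₁ t₂ : ℕ}
    (h : c (s₁ k).head? = true) (h₁ : Within P s₁ s₂ t₁) (h₂ : Within (.loop k c P) s₂ s₃ t₂) :
    Within (.loop k c P) s₁ s₃ (t₁ + t₂ + 1) :=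
  let ⟨_, hu, hr⟩ := h₁
  let ⟨_, hu', hr'⟩ := h₂
  ⟨_, by omega, .loop_step h hr hr'⟩

end

section
variable (i : List (Fin A)) (o : List (Fin B)) (m : List Bool) (a b : List (Option Bool))
  (c : List Bool)

theorem within_push_main (x : Bool) :
    Within (.push .main x) (mk i o m a b c) (mk i o (x :: m) a b c) 1 := by
  simpa [mk] using Within.push (Γ := Sym A B) .main x (mk i o m a b c)

theorem within_push_out (x : Fin B) :
    Within (.push .out x) (mk i o m a b c) (mk i (x :: o) m a b c) 1 := by
  simpa [mk] using Within.push (Γ := Sym A B) .out x (mk i o m a b c)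

theorem within_push_aux₁ (x : Option Bool) :
    Within (.push .aux₁ x) (mk i o m a b c) (mk i o m (x :: a) b c) 1 := by
  simpa [mk] using Within.push (Γ := Sym A B) .aux₁ x (mk i o m a b c)

theorem within_push_aux₂ (x : Option Bool) :
    Within (.push .aux₂ x) (mk i o m a b c) (mk i o m a (x :: b) c) 1 := by
  simpa [mk] using Within.push (Γ := Sym A B) .aux₂ x (mk i o m a b c)

theorem within_push_cnt (x : Bool) :
    Within (.push .cnt x) (mk i o m a b c) (mk i o m a b (x :: c)) 1 := by
  simpa [mk] using Within.push (Γ := Sym A B) .cnt x (mk i o m a b c)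

variable {i o m a b c}

theorem within_pop_main {f : Option Bool → Prog (Sym A B)} {x : Bool} {s t}
    (h : Within (f (some x)) (mk i o m a b c) s t) :
    Within (.pop .main f) (mk i o (x :: m) a b c) s (t + 1) :=
  Within.pop (by simpa [mk] using h)

theorem within_pop_inp {f : Option (Fin A) → Prog (Sym A B)} {x : Fin A} {s t}
    (h : Within (f (some x)) (mk i o m a b c) s t) :
    Within (.pop .inp f) (mk (x :: i) o m a b c) s (t + 1) :=
  Within.pop (by simpa [mk] using h)

theorem within_pop_cnt {f : Option Bool → Prog (Sym A B)} {x : Bool} {s t}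
    (h : Within (f (some x)) (mk i o m a b c) s t) :
    Within (.pop .cnt f) (mk i o m a b (x :: c)) s (t + 1) :=
  Within.pop (by simpa [mk] using h)

theorem within_pop_aux₁ {f : Option (Option Bool) → Prog (Sym A B)} {x : Option Bool} {s t}
    (h : Within (f (some x)) (mk i o m a b c) s t) :
    Within (.pop .aux₁ f) (mk i o m (x :: a) b c) s (t + 1) :=
  Within.pop (by simpa [mk] using h)

theorem within_pop_aux₂ {f : Option (Option Bool) → Prog (Sym A B)} {x : Option Bool} {s t}
    (h : Within (f (some x)) (mk i o m a b c) s t) :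
    Within (.pop .aux₂ f) (mk i o m a (x :: b) c) s (t + 1) :=
  Within.pop (by simpa [mk] using h)

end

/-- Push a word, so that its first letter comes to lie on top. -/
def pushWord : List Bool → Prog (Sym A B)
  | [] => .skip
  | x :: l => .seq (pushWord l) (.push .main x)

theorem within_pushWord (i : List (Fin A)) (o : List (Fin B)) (m a b c) (l : List Bool) :
    Within (pushWord l) (mk i o m a b c) (mk i o (l ++ m) a b c) l.length := by
  induction l with
  | nil => exact .skip _
  | cons x l ih => exact ih.seq (within_push_main ..)

/-- The body of the loop of `scan`. -/
def scanBody : Prog (Sym A B) :=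
  .pop .cnt fun _ => .pop .main fun x =>
    .seq (.push .aux₁ x) <| .seq (.push .aux₂ x) <|
      if x = some true then .seq (.push .cnt true) (.push .cnt true) else .skip

/-- Move a tree from the main stack to both auxiliary stacks. -/
def scan : Prog (Sym A B) :=
  .seq (.push .aux₁ none) <| .seq (.push .aux₂ none) <| .seq (.push .cnt false) <|
    .seq (.push .cnt true) <| .seq (.loop .cnt (fun x => x == some true) scanBody) <|
      .pop .cnt fun _ => .skip

theorem within_scanBody (i : List (Fin A)) (o : List (Fin B)) (m a b c) (x : Bool) :
    Within scanBody (mk i o (x :: m) a b (true :: c))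
      (mk i o m (some x :: a) (some x :: b) (if x then true :: true :: c else c)) 6 := by
  refine Within.mono (within_pop_cnt <| within_pop_main <| (within_push_aux₁ ..).seq <|
    (within_push_aux₂ ..).seq ?_) (t := 1 + (1 + 2) + 1 + 1) (by norm_num)
  cases x
  · exact (Within.skip _).mono (by norm_num)
  · exact (within_push_cnt ..).seq (within_push_cnt ..)

/-- The counter holds one `true` for each subtree still to be read: every letter removes one, and
the letter of a node adds two. The remaining run of the loop is a hypothesis, so that the runs for
the two subtrees of a node can be chained inside a single loop. Each letter costs at most six steps
of the body and one loop test. -/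
theorem within_scanLoop (i : List (Fin A)) (o : List (Fin B)) (t : BTree) :
    ∀ (m a b c s u),
      Within (.loop .cnt (fun x => x == some true) scanBody)
        (mk i o m ((t.enc.map some).reverse ++ a) ((t.enc.map some).reverse ++ b) c) s u →
      Within (.loop .cnt (fun x => x == some true) scanBody)
        (mk i o (t.enc ++ m) a b (true :: c)) s (u + 7 * t.size) := by
  induction t with
  | leaf =>
    intro m a b c s u h
    exact (Within.loop_step (by rfl) (within_scanBody ..) h).mono (by simp [BTree.size]; omega)
  | node l r ihl ihr =>
    intro m a b c s u h
    refine (Within.loop_step (by rfl) (within_scanBody ..) (t₂ := u + 7 * r.size + 7 * l.size)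
      ?_).mono (by simp [BTree.size]; omega)
    change Within _ (mk i o ((l.enc ++ r.enc) ++ m) _ _ (true :: true :: c)) _ _
    rw [List.append_assoc]
    refine ihl _ _ _ _ _ _ (ihr _ _ _ _ _ _ ?_)
    simpa [BTree.enc] using h

/-- The letter `false` below the counter stops the loop, so nothing is required of the previous
contents of `cnt`. -/
theorem within_scan (i : List (Fin A)) (o : List (Fin B)) (m a b c) (t : BTree) :
    Within scan (mk i o (t.enc ++ m) a b c)
      (mk i o m ((t.enc.map some).reverse ++ none :: a) ((t.enc.map some).reverse ++ none :: b) c)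
      (7 * t.size + 6) := by
  refine ((within_push_aux₁ ..).seq <| (within_push_aux₂ ..).seq <| (within_push_cnt ..).seq <|
    (within_push_cnt ..).seq <| Within.seq (within_scanLoop _ _ _ _ _ _ _ _ 1
      (.loop_done (by rfl))) <| within_pop_cnt <| .skip _).mono ?_
  omega

/-- Move a tree back from the first auxiliary stack, or drop it there. -/
def drain₁ (keep : Bool) : Prog (Sym A B) :=
  .seq (.loop .aux₁ (fun x : Option (Option Bool) => x.join.isSome)
    (.pop .aux₁ fun x : Option (Option Bool) =>
      if keep then .push .main (x.join.getD false) else .skip)) (.pop .aux₁ fun _ => .skip)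

/-- Move a tree back from the second auxiliary stack, or drop it there. -/
def drain₂ (keep : Bool) : Prog (Sym A B) :=
  .seq (.loop .aux₂ (fun x : Option (Option Bool) => x.join.isSome)
    (.pop .aux₂ fun x : Option (Option Bool) =>
      if keep then .push .main (x.join.getD false) else .skip)) (.pop .aux₂ fun _ => .skip)

theorem within_drain₁ (i : List (Fin A)) (o : List (Fin B)) (m a b c) (keep : Bool)
    (l : List Bool) :
    Within (drain₁ keep) (mk i o m ((l.map some).reverse ++ none :: a) b c)
      (mk i o (if keep then l ++ m else m) a b c) (3 * l.length + 2) := by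
  refine Within.mono (Within.seq ?_ (within_pop_aux₁ (x := none) (.skip _))) (t := 3 * l.length + 1 + (0 + 1))
    (by omega)
  -- The auxiliary stack holds the word reversed, so its last letter is on top.
  induction l using List.reverseRecOn generalizing m with
  | nil => cases keep <;> exact Within.loop_done (by rfl)
  | append_singleton l x ih =>
    rw [List.map_append, List.reverse_append]
    cases keep
    · refine (Within.loop_step (by rfl) (within_pop_aux₁ (.skip _)) (ih _)).mono ?_
      simp; omega
    · have h := ih (x :: m)
      simp only [if_true, List.append_assoc] at h ⊢
      refine (Within.loop_step (by rfl) (within_pop_aux₁ (within_push_main ..)) h).mono ?_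
      simp; omega

theorem within_drain₂ (i : List (Fin A)) (o : List (Fin B)) (m a b c) (keep : Bool)
    (l : List Bool) :
    Within (drain₂ keep) (mk i o m a ((l.map some).reverse ++ none :: b) c)
      (mk i o (if keep then l ++ m else m) a b c) (3 * l.length + 2) := by
  refine Within.mono (Within.seq ?_ (within_pop_aux₂ (x := none) (.skip _))) (t := 3 * l.length + 1 + (0 + 1))
    (by omega)
  induction l using List.reverseRecOn generalizing m with
  | nil => cases keep <;> exact Within.loop_done (by rfl)
  | append_singleton l x ih =>
    rw [List.map_append, List.reverse_append]
    cases keep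
    · refine (Within.loop_step (by rfl) (within_pop_aux₂ (.skip _)) (ih _)).mono ?_
      simp; omega
    · have h := ih (x :: m)
      simp only [if_true, List.append_assoc] at h ⊢
      refine (Within.loop_step (by rfl) (within_pop_aux₂ (within_push_main ..)) h).mono ?_
      simp; omega

section
variable (i : List (Fin A)) (o : List (Fin B)) (m : List Bool) (a b : List (Option Bool))
  (c : List Bool) (t : BTree)

/-- Duplicate the tree on top of the main stack. -/
def dup : Prog (Sym A B) := .seq scan (.seq (drain₁ true) (drain₂ true))

theorem within_dup : Within dup (mk i o (t.enc ++ m) a b c) (mk i o (t.enc ++ (t.enc ++ m)) a b c)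
    (13 * t.size + 10) := by
  refine ((within_scan ..).seq <| (within_drain₁ _ _ _ _ _ _ true _).seq <|
    (within_drain₂ _ _ _ _ _ _ true _)).mono ?_
  simp; omega

/-- Delete the tree on top of the main stack. -/
def drop : Prog (Sym A B) := .seq scan (.seq (drain₁ false) (drain₂ false))

theorem within_drop : Within drop (mk i o (t.enc ++ m) a b c) (mk i o m a b c)
    (13 * t.size + 10) := by
  refine ((within_scan ..).seq <| (within_drain₁ _ _ _ _ _ _ false _).seq <|
    (within_drain₂ _ _ _ _ _ _ false _)).mono ?_
  simp; omega

/-- Move the tree on top of the main stack to the first auxiliary stack. -/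
def stash : Prog (Sym A B) := .seq scan (drain₂ false)

theorem within_stash : Within stash (mk i o (t.enc ++ m) a b c)
    (mk i o m ((t.enc.map some).reverse ++ none :: a) b c) (10 * t.size + 8) := by
  refine ((within_scan ..).seq <| (within_drain₂ _ _ _ _ _ _ false _)).mono ?_
  simp; omega

theorem within_unstash : Within (drain₁ true)
    (mk i o m ((t.enc.map some).reverse ++ none :: a) b c)
    (mk i o (t.enc ++ m) a b c) (3 * t.size + 2) := by
  simpa using within_drain₁ i o m a b c true t.enc

end

/-- Read a unary number below `N` and branch. -/
def finCases : (N : ℕ) → (Fin N → Prog (Sym A B)) → Prog (Sym A B)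
  | 0, _ => .skip
  | N + 1, f => .pop .main fun x =>
      if x = some true then .pop .main fun _ => finCases N fun j => f j.succ else f 0

/-- The code of `chain (j + 1)` is `true`, `false` and the code of `chain j`, so each unit costs two
pops. -/
theorem within_finCases (i : List (Fin A)) (o : List (Fin B)) (m a b c) :
    ∀ {N : ℕ} (f : Fin N → Prog (Sym A B)) (j : Fin N) {s t},
      Within (f j) (mk i o m a b c) s t →
      Within (finCases N f) (mk i o ((BTree.chain j).enc ++ m) a b c) s (t + (2 * N + 1))
  | N + 1, f, ⟨0, hj⟩, s, t, h =>
    (within_pop_main (f := fun x => if x = some true then .pop .main fun _ =>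
      finCases N fun j => f j.succ else f 0) (x := false) h).mono (by omega)
  | N + 1, f, ⟨j + 1, hj⟩, s, t, h => by
    have := within_finCases i o m a b c (fun j => f j.succ) ⟨j, by omega⟩ h
    exact (within_pop_main (f := fun x => if x = some true then .pop .main fun _ =>
      finCases N fun j => f j.succ else f 0) (x := true) (within_pop_main (x := false) this)).mono
      (by omega)

end StackProgram

/-! ### Functions computable in polynomial time -/

theorem Polynomial.eval_nat_mono (p : Polynomial ℕ) {m n : ℕ} (h : m ≤ n) :
    p.eval m ≤ p.eval n := by
  rw [Polynomial.eval_eq_sum, Polynomial.eval_eq_sum]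
  exact Finset.sum_le_sum fun i _ => Nat.mul_le_mul_left _ (Nat.pow_le_pow_left h i)

/-- Types whose elements are represented by binary trees. -/
class Code (α : Type) where
  toTree : α → BTree

namespace StackProgram

/-- The size of the representation of an element. -/
def sz {α : Type} [Code α] (a : α) : ℕ := (Code.toTree a).size

theorem sz_pos {α : Type} [Code α] (a : α) : 0 < sz a := BTree.size_pos _

/-- Functions computable in polynomial time by a program that works on top of the main stack. -/
@[fun_prop]
def PTime {α β : Type} [Code α] [Code β] (f : α → β) : Prop :=
  -- Everything below the argument and on the other stacks is preserved, which makes programs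
  -- composable. The input and output alphabets stay arbitrary until a machine is built.
  ∀ A B : ℕ, ∃ (P : Prog (Sym A B)) (p : Polynomial ℕ), ∀ x i o m a b c,
    Within P (mk i o ((Code.toTree x).enc ++ m) a b c) (mk i o ((Code.toTree (f x)).enc ++ m) a b c)
      (p.eval (sz x))

variable {α β γ δ : Type} [Code α] [Code β] [Code γ] [Code δ]

instance : Code BTree := ⟨id⟩
instance : Code Unit := ⟨fun _ => .leaf⟩
-- Both truth values have size five, so the size of a list of bits depends only on its length. The
-- first component is a leaf exactly for `false`.
instance : Code Bool := ⟨fun b => cond b (.node (.node .leaf .leaf) .leaf)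
  (.node .leaf (.node .leaf .leaf))⟩
instance : Code (α × β) := ⟨fun p => .node (Code.toTree p.1) (Code.toTree p.2)⟩

/-- Lists are represented by right combs. -/
def listToTree : List α → BTree
  | [] => .leaf
  | a :: l => .node (Code.toTree a) (listToTree l)

instance : Code (List α) := ⟨listToTree⟩
instance : Code ℕ := ⟨fun n => Code.toTree (encodeNat n)⟩
-- Unary notation is harmless since `N` is the size of a fixed alphabet wherever this is used.
instance (N : ℕ) : Code (Fin N) := ⟨fun i => .chain i⟩

theorem toTree_prod (p : α × β) :
    Code.toTree p = .node (Code.toTree p.1) (Code.toTree p.2) := rfl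
theorem toTree_nil : Code.toTree ([] : List α) = .leaf := rfl
theorem toTree_cons (a : α) (l : List α) :
    Code.toTree (a :: l) = .node (Code.toTree a) (Code.toTree l) := rfl

@[simp] theorem sz_prod (p : α × β) : sz p = 1 + sz p.1 + sz p.2 := rfl
@[simp] theorem sz_nil : sz ([] : List α) = 1 := rfl
@[simp] theorem sz_cons (a : α) (l : List α) : sz (a :: l) = 1 + sz a + sz l := rfl
@[simp] theorem sz_bool (b : Bool) : sz b = 5 := by cases b <;> rfl
@[simp] theorem sz_fin {N : ℕ} (i : Fin N) : sz i = 2 * i + 1 := BTree.size_chain _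

theorem sz_append (l l' : List α) : sz (l ++ l') + 1 = sz l + sz l' := by
  induction l with
  | nil => simp; omega
  | cons a l ih => simp; omega

theorem length_lt_sz (l : List α) : l.length < sz l := by
  induction l with
  | nil => simp
  | cons a l ih => simp; omega

theorem sz_le_of_mem {a : α} {l : List α} (h : a ∈ l) : sz a < sz l := by
  induction l with
  | nil => simp at h
  | cons b l ih =>
    rcases List.mem_cons.1 h with rfl | h
    · simp; omega
    · have := ih h; simp; omega

/-- The size of a list is bounded by its length and the sizes of its elements. -/
theorem sz_le_length_mul {l : List α} {n : ℕ} (h : ∀ a ∈ l, sz a ≤ n) :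
    sz l ≤ l.length * (n + 1) + 1 := by
  induction l with
  | nil => simp
  | cons b l ih =>
    have h₁ := h b (by simp)
    have h₂ := ih fun a ha => h a (by simp [ha])
    simp [add_mul]; omega

namespace PTime

/-- A program raises the main stack by at most its running time, so a time bound is also a bound for
the size of the result. Compositions stay polynomial for this reason. -/
theorem size_le {f : α → β} (hf : PTime f) : ∃ p : Polynomial ℕ, ∀ x, sz (f x) ≤ p.eval (sz x) := by
  obtain ⟨P, p, h⟩ := hf 0 0
  refine ⟨p + .X, fun x => ?_⟩
  obtain ⟨t, ht, hr⟩ := h x [] [] [] [] [] []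
  have := hr.length_le .main
  simp [mk] at this
  simp [sz] at *
  omega

theorem of_toTree {f : α → β} (h : ∀ x, Code.toTree (f x) = Code.toTree x) : PTime f := fun A B =>
  ⟨.skip, 0, fun x i o m a b c => by rw [h]; exact (Within.skip _).mono (by simp)⟩

/-- A program sees only trees, so changing the type of a result costs nothing as long as the tree
stays the same. -/
theorem congr {f : α → β} (hf : PTime f) {g : α → γ}
    (h : ∀ x, Code.toTree (g x) = Code.toTree (f x)) : PTime g := fun A B => by
  obtain ⟨P, p, hP⟩ := hf A B
  exact ⟨P, p, fun x i o m a b c => by rw [h]; exact hP x i o m a b c⟩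

@[fun_prop]
theorem id : PTime fun x : α => x := of_toTree fun _ => rfl

@[fun_prop]
theorem const (y : β) : PTime fun _ : α => y := fun A B =>
  ⟨.seq drop (pushWord (Code.toTree y).enc), 13 * .X + (10 + (sz y : Polynomial ℕ)),
    fun x i o m a b c => ((within_drop ..).seq (within_pushWord ..)).mono (by simp [sz]; omega)⟩

@[fun_prop]
theorem comp {f : β → γ} {g : α → β} (hf : PTime f) (hg : PTime g) : PTime fun x => f (g x) := by
  intro A B
  obtain ⟨q, hq⟩ := hg.size_le
  obtain ⟨P, p, hP⟩ := hf A B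
  obtain ⟨P', p', hP'⟩ := hg A B
  refine ⟨.seq P' P, p' + p.comp q, fun x i o m a b c =>
    ((hP' x i o m a b c).seq (hP (g x) i o m a b c)).mono ?_⟩
  simpa using p.eval_nat_mono (hq x)

-- The argument is duplicated, `f` is applied to the upper copy, and its result waits on an
-- auxiliary stack while `g` is applied to the lower copy. Both results then lie in the order of the
-- prefix code, which lacks only the letter of the node.
@[fun_prop]
theorem pair {f : α → β} {g : α → γ} (hf : PTime f) (hg : PTime g) :
    PTime fun x => (f x, g x) := by
  intro A B
  obtain ⟨q, hq⟩ := hf.size_le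
  obtain ⟨P, p, hP⟩ := hf A B
  obtain ⟨P', p', hP'⟩ := hg A B
  refine ⟨.seq dup (.seq P (.seq stash (.seq P' (.seq (drain₁ true) (.push .main true))))),
    p + p' + 13 * q + 13 * .X + 21, fun x i o m a b c => ?_⟩
  have hpush : Within (.push .main true)
      (mk i o ((Code.toTree (f x)).enc ++ ((Code.toTree (g x)).enc ++ m)) a b c)
      (mk i o ((Code.toTree (f x, g x)).enc ++ m) a b c) 1 := by
    rw [toTree_prod]
    simp only [BTree.enc, List.cons_append, List.append_assoc]
    exact within_push_main ..
  refine ((within_dup ..).seq <| (hP x ..).seq <| (within_stash ..).seq <| (hP' x ..).seq <|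
    (within_unstash ..).seq hpush).mono ?_
  have := hq x
  simp [sz] at *
  omega

@[fun_prop]
theorem fst : PTime fun p : α × β => p.1 := fun A B => by
  refine ⟨.pop .main fun _ => .seq stash (.seq drop (drain₁ true)), 13 * .X + 21,
    fun x i o m a b c => ?_⟩
  rw [toTree_prod]
  simp only [BTree.enc, List.cons_append, List.append_assoc]
  refine (within_pop_main <| (within_stash ..).seq <| (within_drop ..).seq <|
    (within_unstash ..)).mono ?_
  have := sz_prod x
  simp [sz] at *; omega

@[fun_prop]
theorem snd : PTime fun p : α × β => p.2 := fun A B => by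
  refine ⟨.pop .main fun _ => drop, 13 * .X + 21, fun x i o m a b c => ?_⟩
  rw [toTree_prod]
  simp only [BTree.enc, List.cons_append, List.append_assoc]
  refine (within_pop_main <| within_drop ..).mono ?_
  have := sz_prod x
  simp [sz] at *; omega

theorem fst' {f : α → β × γ} (hf : PTime f) : PTime fun x => (f x).1 := fst.comp hf
theorem snd' {f : α → β × γ} (hf : PTime f) : PTime fun x => (f x).2 := snd.comp hf

@[fun_prop]
theorem cons {f : α → β} {g : α → List β} (hf : PTime f) (hg : PTime g) :
    PTime fun x => f x :: g x := (hf.pair hg).congr fun _ => rfl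

@[fun_prop]
theorem ite {d : α → Bool} {f g : α → β} (hd : PTime d) (hf : PTime f) (hg : PTime g) :
    PTime fun x => if d x = true then f x else g x := by
  intro A B
  obtain ⟨R, r, hR⟩ := (hd.pair PTime.id) A B
  obtain ⟨P, p, hP⟩ := hf A B
  obtain ⟨P', p', hP'⟩ := hg A B
  -- The code of `(d x, x)` begins with the letter of the pair and the five letters of the truth
  -- value. The third letter overall distinguishes `true` from `false`, and six pops leave `x` on
  -- top.
  refine ⟨.seq R (.pop .main fun _ => .pop .main fun _ => .pop .main fun y =>
    .pop .main fun _ => .pop .main fun _ => .pop .main fun _ =>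
      if y = some true then P else P'), r + p + p' + 6, fun x i o m a b c => ?_⟩
  refine ((hR x i o m a b c).seq (t₂ := p.eval (sz x) + p'.eval (sz x) + 1 + 1 + 1 + 1 + 1 + 1) ?_).mono
    (by simp; omega)
  simp only []
  cases h : d x
  · change Within _ (mk i o
      (true :: true :: false :: true :: false :: false :: ((Code.toTree x).enc ++ m)) a b c) _ _
    refine within_pop_main <| within_pop_main <| within_pop_main (x := false) <| within_pop_main <|
      within_pop_main <| within_pop_main ?_
    simpa [h] using (hP' x i o m a b c).mono (by omega)
  · change Within _ (mk i o
      (true :: true :: true :: false :: false :: false :: ((Code.toTree x).enc ++ m)) a b c) _ _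
    refine within_pop_main <| within_pop_main <| within_pop_main (x := true) <| within_pop_main <|
      within_pop_main <| within_pop_main ?_
    simpa [h] using (hP x i o m a b c).mono (by omega)

end PTime

/-- Case distinction on a list. -/
def lcase (l : List β) (y : γ) (g : β → List β → γ) : γ :=
  match l with
  | [] => y
  | b :: t => g b t

omit [Code β] [Code γ] in
@[simp] theorem lcase_nil (y : γ) (g : β → List β → γ) : lcase [] y g = y := rfl
omit [Code β] [Code γ] in
@[simp] theorem lcase_cons (b : β) (t : List β) (y : γ) (g : β → List β → γ) :
    lcase (b :: t) y g = g b t := rfl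

namespace PTime

/-- A nonempty list `b :: t` and the pair `(b, t)` have the same tree. Hence, after two pops have
revealed which case holds, pushing the two letters back yields an argument for `g`; in the empty
case `x` already lies on top. -/
theorem lcase {l : α → List β} {f : α → γ} {g : α → β → List β → γ} (hl : PTime l) (hf : PTime f)
    (hg : PTime fun p : (β × List β) × α => g p.2 p.1.1 p.1.2) :
    PTime fun x => lcase (l x) (f x) (g x) := by
  intro A B
  obtain ⟨R, r, hR⟩ := (hl.pair PTime.id) A B
  obtain ⟨q, hq⟩ := hl.size_le
  obtain ⟨P, p, hP⟩ := hf A B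
  obtain ⟨P', p', hP'⟩ := hg A B
  refine ⟨.seq R (.pop .main fun _ => .pop .main fun y =>
      if y = some true then .seq (.push .main true) (.seq (.push .main true) P') else P),
      r + p + p'.comp (q + .X + 1) + 4, fun x i o m a b c => ?_⟩
  refine ((hR x i o m a b c).seq
    (t₂ := p.eval (sz x) + (1 + (1 + p'.eval (q.eval (sz x) + sz x + 1))) + 1 + 1) ?_).mono
    (by simp; omega)
  have hq := hq x
  cases h : l x with
  | nil =>
    rw [toTree_prod]
    simp only [h, toTree_nil]
    refine within_pop_main <| within_pop_main (x := false) ?_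
    simpa using (hP x i o m a b c).mono (by omega)
  | cons y t =>
    rw [toTree_prod]
    simp only [h, toTree_cons, BTree.enc, List.cons_append, List.append_assoc]
    refine within_pop_main <| within_pop_main (x := true) ?_
    have := hP' ((y, t), x) i o m a b c
    simp only [toTree_prod, BTree.enc, List.cons_append, List.append_assoc] at this
    simp only [if_true]
    refine ((within_push_main ..).seq <| (within_push_main ..).seq this).mono ?_
    have : p'.eval (sz ((y, t), x)) ≤ p'.eval (q.eval (sz x) + sz x + 1) :=
      p'.eval_nat_mono (by simp [h] at *; omega)
    omega

/-- Folding over a list takes polynomial time if a step does and the intermediate values have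
polynomially bounded size. -/
theorem foldl {L : α → List β} {s : α → γ} {g : α → γ → β → γ} (hL : PTime L) (hs : PTime s)
    (hg : PTime fun p : (α × γ) × β => g p.1.1 p.1.2 p.2) (q : Polynomial ℕ)
    (hq : ∀ x l₁ l₂, L x = l₁ ++ l₂ → sz (l₁.foldl (g x) (s x)) ≤ q.eval (sz x)) :
    PTime fun x => (L x).foldl (g x) (s x) := by
  intro A B
  have hG : PTime fun p : (β × List β) × (α × γ) => (p.1.2, (p.2.1, g p.2.1 p.2.2 p.1.1)) := by
    have : PTime fun p : (β × List β) × (α × γ) => g p.2.1 p.2.2 p.1.1 :=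
      hg.comp (g := fun p : (β × List β) × (α × γ) => (p.2, p.1.1)) (by fun_prop)
    exact (by fun_prop : PTime fun p : (β × List β) × (α × γ) => p.1.2).pair
      ((by fun_prop : PTime fun p : (β × List β) × (α × γ) => p.2.1).pair this)
  have hI : PTime fun x => (L x, (x, s x)) := by fun_prop
  obtain ⟨r, hr⟩ := hL.size_le
  obtain ⟨G, pG, hG⟩ := hG A B
  obtain ⟨I, pI, hI⟩ := hI A B
  obtain ⟨S, pS, hS⟩ := (PTime.snd (α := α) (β := γ)) A B
  -- Between rounds the main stack holds the code of `(rest, (x, acc))` without its first letter, so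
  -- the top letter tells whether the rest is empty. If it is not, pushing `true` completes an
  -- argument of `G`, because `b :: t` and `(b, t)` have the same tree.
  let body : Prog (Sym A B) := .seq (.push .main true) (.seq G (.pop .main fun _ => .skip))
  let lp : Prog (Sym A B) := .loop .main (fun y => y == some true) body
  -- The consumed prefix `l₁` is recorded because the size bound `hq` concerns only accumulators
  -- that arise from prefixes of `L x`.
  have key : ∀ x l₂ l₁, L x = l₁ ++ l₂ → ∀ i o m a b c,
      Within lp (mk i o ((Code.toTree l₂).enc ++
          ((Code.toTree (x, l₁.foldl (g x) (s x))).enc ++ m)) a b c)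
        (mk i o (false :: ((Code.toTree (x, (L x).foldl (g x) (s x))).enc ++ m)) a b c)
        (l₂.length * (pG.eval (r.eval (sz x) + sz x + q.eval (sz x) + 2) + 3) + 1) := by
    intro x l₂
    induction l₂ with
    | nil =>
      intro l₁ h i o m a b c
      rw [List.append_nil] at h
      rw [h]
      exact (Within.loop_done (by rfl)).mono (by omega)
    | cons y t ih =>
      intro l₁ h i o m a b c
      have h' : L x = (l₁ ++ [y]) ++ t := by simp [h]
      have ih := ih (l₁ ++ [y]) h' i o m a b c
      have hGy := hG ((y, t), (x, l₁.foldl (g x) (s x))) i o m a b c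
      rw [toTree_prod, toTree_prod] at hGy
      simp only [BTree.enc, List.cons_append, List.append_assoc] at hGy
      simp only [toTree_cons, BTree.enc, List.cons_append, List.append_assoc]
      refine (Within.loop_step (by rfl) ((within_push_main ..).seq (hGy.seq (within_pop_main
        (.skip _)))) (by simpa using ih)).mono ?_
      have e : pG.eval (sz ((y, t), (x, l₁.foldl (g x) (s x)))) ≤
          pG.eval (r.eval (sz x) + sz x + q.eval (sz x) + 2) := by
        refine pG.eval_nat_mono ?_
        have h₁ := hq x l₁ _ h
        have h₂ := hr x
        have h₃ := sz_append l₁ (y :: t)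
        have h₄ := sz_pos l₁
        rw [← h] at h₃
        simp at *
        omega
      simp only [List.length_cons, add_mul, one_mul]
      omega
  refine ⟨.seq I (.seq (.pop .main fun _ => .skip) (.seq lp (.seq (.pop .main fun _ => .skip) S))),
    pI + r * (pG.comp (r + .X + q + 2) + 3) + pS.comp (1 + .X + q) + 3, fun x i o m a b c => ?_⟩
  have hIx := hI x i o m a b c
  rw [toTree_prod] at hIx
  simp only [BTree.enc, List.cons_append, List.append_assoc] at hIx
  refine (hIx.seq <| (within_pop_main (x := true) (.skip _)).seq <| (key x (L x) [] rfl i o m a b c).seq <|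
    (within_pop_main (f := fun _ => .skip) (x := false) (.skip _)).seq
      (hS (x, (L x).foldl (g x) (s x)) i o m a b c)).mono ?_
  have h₁ := (length_lt_sz (L x)).le.trans (hr x)
  have h₂ : pS.eval (sz (x, (L x).foldl (g x) (s x))) ≤ pS.eval (1 + sz x + q.eval (sz x)) :=
    pS.eval_nat_mono (by simpa using hq x (L x) [] (by simp))
  have h₃ := Nat.mul_le_mul_right
    (pG.eval (r.eval (sz x) + sz x + q.eval (sz x) + 2) + 3) h₁
  simp only [sz_prod] at h₂
  simp
  omega

/-- A fold in which every step adds a bounded amount to the size, under an invariant. -/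
theorem foldl_inv {L : α → List β} {s : α → γ} {g : α → γ → β → γ} (hL : PTime L) (hs : PTime s)
    (hg : PTime fun p : (α × γ) × β => g p.1.1 p.1.2 p.2) (I : α → γ → Prop)
    (hI₀ : ∀ x, I x (s x)) (hI : ∀ x y b, b ∈ L x → I x y → I x (g x y b)) (q : Polynomial ℕ)
    (hq : ∀ x y b, b ∈ L x → I x y → sz (g x y b) ≤ sz y + q.eval (sz x + sz b)) :
    PTime fun x => (L x).foldl (g x) (s x) := by
  obtain ⟨r, hr⟩ := hL.size_le
  obtain ⟨u, hu⟩ := hs.size_le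
  -- `u` bounds the initial value, and `r` bounds both the number of steps and the size of a list
  -- element.
  refine foldl hL hs hg (u + r * q.comp (.X + r)) fun x l₁ l₂ h => ?_
  have key : I x (l₁.foldl (g x) (s x)) ∧ sz (l₁.foldl (g x) (s x)) ≤
      sz (s x) + l₁.length * q.eval (sz x + r.eval (sz x)) := by
    have hmem : ∀ b ∈ l₁, b ∈ L x := fun b hb => by simp [h, hb]
    clear h
    induction l₁ using List.reverseRecOn with
    | nil => simpa using hI₀ x
    | append_singleton l b ih =>
      obtain ⟨h₀, h₁⟩ := ih fun b hb => hmem b (by simp [hb])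
      have h₂ := hq x (l.foldl (g x) (s x)) b (hmem b (by simp)) h₀
      have h₃ : q.eval (sz x + sz b) ≤ q.eval (sz x + r.eval (sz x)) :=
        q.eval_nat_mono (by have := sz_le_of_mem (hmem b (by simp)); have := hr x; omega)
      refine ⟨by simpa using hI x _ b (hmem b (by simp)) h₀, ?_⟩
      simp [add_mul] at *
      omega
  have h₁ : l₁.length ≤ r.eval (sz x) := by
    have := length_lt_sz (L x)
    have := hr x
    rw [h, List.length_append] at *
    omega
  have h₂ := Nat.mul_le_mul_right (q.eval (sz x + r.eval (sz x))) h₁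
  have h₃ := hu x
  have h₄ := key.2
  simp
  omega

/-- A fold in which every step adds a bounded amount to the size. -/
theorem foldl_add {L : α → List β} {s : α → γ} {g : α → γ → β → γ} (hL : PTime L) (hs : PTime s)
    (hg : PTime fun p : (α × γ) × β => g p.1.1 p.1.2 p.2) (q : Polynomial ℕ)
    (hq : ∀ x y b, b ∈ L x → sz (g x y b) ≤ sz y + q.eval (sz x + sz b)) :
    PTime fun x => (L x).foldl (g x) (s x) :=
  foldl_inv hL hs hg (fun _ _ => True) (fun _ => trivial) (fun _ _ _ _ _ => trivial) q
    fun x y b hb _ => hq x y b hb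

/-- Case distinction over a finite type. -/
theorem finCases {N : ℕ} {h : Fin N → α → β} (hh : ∀ j, PTime (h j)) :
    PTime fun p : Fin N × α => h p.1 p.2 := by
  intro A B
  choose P p hP using fun j => hh j A B
  refine ⟨.pop .main fun _ => StackProgram.finCases N P, (∑ j, p j) + (2 * N + 2 : ℕ),
    fun x i o m a b c => ?_⟩
  obtain ⟨j, x⟩ := x
  rw [toTree_prod]
  simp only [BTree.enc, List.cons_append, List.append_assoc]
  refine (within_pop_main <| within_finCases i o _ a b c P j (hP j x i o m a b c)).mono ?_
  have h₁ : (p j).eval (sz x) ≤ ∑ j', (p j').eval (sz (j, x)) :=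
    ((p j).eval_nat_mono (by simp)).trans
      (Finset.single_le_sum (f := fun j' => (p j').eval (sz (j, x))) (by simp) (Finset.mem_univ j))
  simp [Polynomial.eval_finsetSum] at *
  omega

end PTime

end StackProgram

/-! ### Polynomial-time operations on lists and truth values, and the size of binary numbers -/

namespace StackProgram

variable {α β γ δ : Type} [Code α] [Code β] [Code γ] [Code δ]

namespace PTime

theorem of_eq {f g : α → β} (hf : PTime f) (h : ∀ x, f x = g x) : PTime g :=
  hf.congr fun x => by rw [h]

@[fun_prop]
theorem reverse {f : α → List β} (hf : PTime f) : PTime fun x => (f x).reverse := by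
  refine (foldl_add (g := fun _ acc b => b :: acc) hf (const []) (by fun_prop) (1 + .X)
    fun x y b _ => ?_).of_eq fun x => by simp
  simp; omega

/-- A right fold is a left fold over the reversed list. -/
theorem foldr_add {L : α → List β} {s : α → γ} {g : α → β → γ → γ} (hL : PTime L) (hs : PTime s)
    (hg : PTime fun p : (α × γ) × β => g p.1.1 p.2 p.1.2) (q : Polynomial ℕ)
    (hq : ∀ x y b, b ∈ L x → sz (g x b y) ≤ sz y + q.eval (sz x + sz b)) :
    PTime fun x => (L x).foldr (g x) (s x) :=
  (foldl_add (g := fun x y b => g x b y) hL.reverse hs hg q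
    fun x y b hb => hq x y b (by simpa using hb)).of_eq fun x => by simp

@[fun_prop]
theorem append {f g : α → List β} (hf : PTime f) (hg : PTime g) : PTime fun x => f x ++ g x := by
  refine (foldr_add (g := fun _ b acc => b :: acc) hf hg (by fun_prop) (1 + .X)
    fun x y b _ => ?_).of_eq fun x => by simp
  simp; omega

@[fun_prop]
theorem flatMap {L : α → List β} {f : α → β → List γ} (hL : PTime L)
    (hf : PTime fun p : α × β => f p.1 p.2) : PTime fun x => (L x).flatMap (f x) := by
  obtain ⟨q, hq⟩ := hf.size_le
  refine (foldr_add (g := fun x b acc => f x b ++ acc) hL (const [])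
    (append (hf.comp (g := fun p : (α × List γ) × β => (p.1.1, p.2)) (by fun_prop)) (by fun_prop))
    (q.comp (1 + .X)) fun x y b _ => ?_).of_eq fun x => ?_
  · have h₁ := sz_append (f x b) y
    have h₂ := hq (x, b)
    simp [add_assoc] at *
    omega
  · induction L x with
    | nil => rfl
    | cons b l ih => simp [ih]

@[fun_prop]
theorem map {L : α → List β} {f : α → β → γ} (hL : PTime L)
    (hf : PTime fun p : α × β => f p.1 p.2) : PTime fun x => (L x).map (f x) :=
  (flatMap (f := fun x b => [f x b]) hL (hf.cons (const []))).of_eq fun x => by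
    induction L x with
    | nil => rfl
    | cons b l ih => simpa using ih

@[fun_prop]
theorem headD {f : α → List β} {d : α → β} (hf : PTime f) (hd : PTime d) :
    PTime fun x => (f x).headD (d x) :=
  (lcase (g := fun _ b _ => b) hf hd (by fun_prop)).of_eq fun x => by cases f x <;> rfl

@[fun_prop]
theorem tail {f : α → List β} (hf : PTime f) : PTime fun x => (f x).tail :=
  (lcase (g := fun _ _ t => t) hf (const []) (by fun_prop)).of_eq fun x => by cases f x <;> rfl

@[fun_prop]
theorem isEmpty {f : α → List β} (hf : PTime f) : PTime fun x => (f x).isEmpty :=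
  (lcase (g := fun _ _ _ => false) hf (const true) (by fun_prop)).of_eq fun x => by
    cases f x <;> rfl

@[fun_prop]
theorem and {f g : α → Bool} (hf : PTime f) (hg : PTime g) : PTime fun x => f x && g x :=
  (ite hf hg (const false)).of_eq fun x => by cases f x <;> rfl

@[fun_prop]
theorem or {f g : α → Bool} (hf : PTime f) (hg : PTime g) : PTime fun x => f x || g x :=
  (ite hf (const true) hg).of_eq fun x => by cases f x <;> rfl

@[fun_prop]
theorem not {f : α → Bool} (hf : PTime f) : PTime fun x => !f x :=
  (ite hf (const false) (const true)).of_eq fun x => by cases f x <;> rfl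

@[fun_prop]
theorem all {L : α → List β} {p : α → β → Bool} (hL : PTime L)
    (hp : PTime fun y : α × β => p y.1 y.2) : PTime fun x => (L x).all (p x) := by
  refine (foldr_add (g := fun x b acc => p x b && acc) hL (const true)
    (and (hp.comp (g := fun y : (α × Bool) × β => (y.1.1, y.2)) (by fun_prop)) (by fun_prop)) 0
    fun x y b _ => by simp).of_eq fun x => ?_
  induction L x with
  | nil => rfl
  | cons b l ih => simp [ih]

/-- A function on a finite type. -/
theorem ofFin {N : ℕ} (h : Fin N → β) : PTime h :=
  (finCases (h := fun j (_ : Unit) => h j) fun j => const (h j)).comp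
    (g := fun j => (j, ())) (by fun_prop)

theorem finCases' {N : ℕ} {a : α → Fin N} {h : Fin N → α → β} (ha : PTime a)
    (hh : ∀ j, PTime (h j)) : PTime fun x => h (a x) x :=
  (finCases hh).comp (g := fun x => (a x, x)) (by fun_prop)

end PTime

/-- Zip of two lists, computed by a fold. -/
theorem zip_eq_foldl {β γ : Type} (l : List β) (m : List γ) :
    l.zip m = (l.foldl (fun (s : List γ × List (β × γ)) b =>
      lcase s.1 s fun c t => (t, (b, c) :: s.2)) (m, [])).2.reverse := by
  suffices ∀ (acc : List (β × γ)), (l.foldl (fun (s : List γ × List (β × γ)) b =>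
      lcase s.1 s fun c t => (t, (b, c) :: s.2)) (m, acc)).2.reverse = acc.reverse ++ l.zip m by
    simpa using (this []).symm
  induction l generalizing m with
  | nil => simp
  | cons b l ih =>
    intro acc
    cases m with
    | nil => simp only [List.foldl_cons, lcase_nil, ih, List.zip_nil_right]
    | cons c m => simp [ih]

@[fun_prop]
theorem PTime.zip {f : α → List β} {g : α → List γ} (hf : PTime f) (hg : PTime g) :
    PTime fun x => (f x).zip (g x) := by
  have h : PTime fun x => (f x).foldl (fun (s : List γ × List (β × γ)) b =>
      StackProgram.lcase s.1 s fun c t => (t, (b, c) :: s.2)) (g x, []) := by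
    refine foldl_add (g := fun _ s b => StackProgram.lcase s.1 s fun c t => (t, (b, c) :: s.2)) hf
      (by fun_prop) (lcase (by fun_prop) (by fun_prop) (by fun_prop)) (1 + .X) ?_
    rintro x ⟨_ | ⟨c, t⟩, out⟩ b -
    · simp
    · simp; omega
  exact h.snd'.reverse.of_eq fun x => (zip_eq_foldl _ _).symm

/-! ### Binary arithmetic -/

/-- The hypothesis excludes `Nat.bit false 0`, which is zero and has the empty code. -/
theorem encodeNat_bit (b : Bool) (n : ℕ) (h : n = 0 → b = true) :
    encodeNat (Nat.bit b n) = b :: encodeNat n := by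
  unfold encodeNat
  rw [← Num.ofNat'_eq, ← Num.ofNat'_eq, Num.ofNat'_bit]
  rcases hn : Num.ofNat' n with _ | p
  · have : n = 0 := by rw [← Num.to_of_nat n, ← Num.ofNat'_eq, hn]; rfl
    rw [h this]
    rfl
  · cases b <;> rfl

/-- The value of a little-endian list of bits. -/
def bitVal (l : List Bool) : ℕ := l.foldr Nat.bit 0

@[simp] theorem bitVal_nil : bitVal [] = 0 := rfl
@[simp] theorem bitVal_cons (b : Bool) (l : List Bool) : bitVal (b :: l) = Nat.bit b (bitVal l) :=
  rfl

theorem encodeNat_zero : encodeNat 0 = [] := rfl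

/-- Remove leading zeros. -/
def trim (l : List Bool) : List Bool :=
  l.foldr (fun b t => if t.isEmpty && !b then [] else b :: t) []

/-- This allows arithmetic to produce bit lists with leading zeros, which are trimmed at the end. -/
theorem encodeNat_bitVal (l : List Bool) : encodeNat (bitVal l) = trim l := by
  induction l with
  | nil => rfl
  | cons b l ih =>
    simp only [trim, List.foldr_cons, bitVal_cons] at *
    by_cases h : bitVal l = 0
    · rw [h, encodeNat_zero] at ih
      rw [← ih, h]
      cases b
      · rfl
      · rfl
    · rw [encodeNat_bit _ _ (fun h' => absurd h' h), ih, if_neg]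
      have : encodeNat (bitVal l) ≠ [] := fun e => h (by
        rw [← decode_encodeNat (bitVal l), e]; rfl)
      rw [ih] at this
      intro hc
      rw [Bool.and_eq_true] at hc
      exact this (List.isEmpty_iff.1 hc.1)

@[simp] theorem bitVal_encodeNat (n : ℕ) : bitVal (encodeNat n) = n := by
  induction n using Nat.binaryRec' with
  | zero => rfl
  | bit b n h ih => rw [encodeNat_bit _ _ h, bitVal_cons, ih]

theorem length_encodeNat (n : ℕ) : (encodeNat n).length = n.size := by
  induction n using Nat.binaryRec' with
  | zero => rfl
  | bit b n h ih =>
    rw [encodeNat_bit _ _ h, List.length_cons, ih, Nat.size_bit]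
    intro e
    rcases Nat.bit_eq_zero_iff.1 e with ⟨rfl, rfl⟩
    simpa using h rfl

theorem sz_bits (l : List Bool) : sz l = 6 * l.length + 1 := by
  induction l with
  | nil => rfl
  | cons b l ih => simp [ih]; omega

theorem sz_nat (n : ℕ) : sz n = 6 * n.size + 1 := by
  rw [← length_encodeNat, ← sz_bits]
  rfl

theorem sz_nat_mono {m n : ℕ} (h : m ≤ n) : sz m ≤ sz n := by
  rw [sz_nat, sz_nat]
  have := Nat.size_le_size h
  omega

/-- A product has at most as many bits as its factors together. Consequently a product of many
numbers is no larger, up to a constant, than the list of its factors. -/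
theorem sz_nat_mul_le (m n : ℕ) : sz (m * n) + 1 ≤ sz m + sz n := by
  simp only [sz_nat]
  have : (m * n).size ≤ m.size + n.size := by
    rw [Nat.size_le, pow_add]
    exact Nat.mul_lt_mul'' (Nat.lt_size_self m) (Nat.lt_size_self n)
  omega

theorem sz_nat_add_le (m n : ℕ) : sz (m + n) + 1 ≤ sz m + sz n := by
  simp only [sz_nat]
  have : (m + n).size ≤ m.size + n.size := by
    rw [Nat.size_le, pow_add]
    have h₁ := Nat.lt_size_self m
    have h₂ := Nat.lt_size_self n
    nlinarith
  omega

namespace PTime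

theorem encodeNat : PTime (encodeNat : ℕ → List Bool) := of_toTree fun _ => rfl

theorem bitVal : PTime bitVal := by
  have : PTime trim := by
    refine foldr_add (g := fun _ b t => if t.isEmpty && !b then [] else b :: t) PTime.id
      (const []) (by fun_prop) (1 + .X) ?_
    intro x y b _
    by_cases h : (y.isEmpty && !b) = true
    · rw [if_pos h]; have := sz_pos y; simp; omega
    · rw [if_neg h]; simp; omega
  exact this.congr fun l => by rw [← encodeNat_bitVal]; rfl

end PTime

end StackProgram

/-! ### Addition, comparison and multiplication of binary numbers -/

namespace StackProgram

variable {α β γ δ : Type} [Code α] [Code β] [Code γ] [Code δ]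

/-- Zip two lists of bits, where the shorter one is padded by zeros. -/
def padZip : List Bool → List Bool → List (Bool × Bool)
  | [], m => m.map fun c => (false, c)
  | b :: l, m => (b, m.headD false) :: padZip l m.tail

theorem padZip_eq_foldl (l m : List Bool) :
    padZip l m = (l.foldl (fun (s : List Bool × List (Bool × Bool)) b =>
      (s.1.tail, (b, s.1.headD false) :: s.2)) (m, [])).2.reverse ++
      ((l.foldl (fun (s : List Bool × List (Bool × Bool)) b =>
      (s.1.tail, (b, s.1.headD false) :: s.2)) (m, [])).1.map fun c => (false, c)) := by
  suffices ∀ acc, acc.reverse ++ padZip l m =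
      (l.foldl (fun (s : List Bool × List (Bool × Bool)) b =>
      (s.1.tail, (b, s.1.headD false) :: s.2)) (m, acc)).2.reverse ++
      ((l.foldl (fun (s : List Bool × List (Bool × Bool)) b =>
      (s.1.tail, (b, s.1.headD false) :: s.2)) (m, acc)).1.map fun c => (false, c)) by
    simpa using this []
  induction l generalizing m with
  | nil => simp [padZip]
  | cons b l ih => intro acc; simpa [padZip] using ih m.tail ((b, m.headD false) :: acc)

@[simp] theorem bitVal_padZip_fst (l m : List Bool) :
    bitVal ((padZip l m).map Prod.fst) = bitVal l := by
  induction l generalizing m with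
  | nil =>
    simp only [padZip, List.map_map]
    induction m with
    | nil => rfl
    | cons c m ih => simp at *; exact ih
  | cons b l ih => simp [padZip, ih]

@[simp] theorem bitVal_padZip_snd (l m : List Bool) :
    bitVal ((padZip l m).map Prod.snd) = bitVal m := by
  induction l generalizing m with
  | nil => simp [padZip, Function.comp_def]
  | cons b l ih => cases m <;> simp [padZip, ih]

/-- Ripple-carry addition. -/
def addBits : List (Bool × Bool) → Bool → List Bool
  | [], c => [c]
  | (a, b) :: l, c => ((a ^^ b) ^^ c) :: addBits l ((a && b) || (c && (a ^^ b)))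

theorem bitVal_addBits (l : List (Bool × Bool)) (c : Bool) :
    bitVal (addBits l c) = bitVal (l.map Prod.fst) + bitVal (l.map Prod.snd) + c.toNat := by
  induction l generalizing c with
  | nil => cases c <;> rfl
  | cons p l ih =>
    obtain ⟨a, b⟩ := p
    simp only [addBits, bitVal_cons, ih, List.map_cons, Nat.bit_val]
    cases a <;> cases b <;> cases c <;> simp <;> omega

theorem addBits_eq_foldl (l : List (Bool × Bool)) (c : Bool) :
    addBits l c = (l.foldl (fun (s : Bool × List Bool) (p : Bool × Bool) =>
      ((p.1 && p.2) || (s.1 && (p.1 ^^ p.2)), ((p.1 ^^ p.2) ^^ s.1) :: s.2)) (c, [])).2.reverse ++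
      [(l.foldl (fun (s : Bool × List Bool) (p : Bool × Bool) =>
      ((p.1 && p.2) || (s.1 && (p.1 ^^ p.2)), ((p.1 ^^ p.2) ^^ s.1) :: s.2)) (c, [])).1] := by
  suffices ∀ acc, acc.reverse ++ addBits l c =
      (l.foldl (fun (s : Bool × List Bool) (p : Bool × Bool) =>
      ((p.1 && p.2) || (s.1 && (p.1 ^^ p.2)), ((p.1 ^^ p.2) ^^ s.1) :: s.2)) (c, acc)).2.reverse ++
      [(l.foldl (fun (s : Bool × List Bool) (p : Bool × Bool) =>
      ((p.1 && p.2) || (s.1 && (p.1 ^^ p.2)), ((p.1 ^^ p.2) ^^ s.1) :: s.2)) (c, acc)).1] by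
    simpa using this []
  induction l generalizing c with
  | nil => simp [addBits]
  | cons p l ih =>
    intro acc
    simpa [addBits] using ih ((p.1 && p.2) || (c && (p.1 ^^ p.2))) (((p.1 ^^ p.2) ^^ c) :: acc)

/-- Comparison of binary numbers, starting from the least significant bits. -/
def leBits (l : List (Bool × Bool)) (c : Bool) : Bool :=
  l.foldl (fun c p => if (p.1 ^^ p.2) = true then p.2 else c) c

/-- The most significant position where the digits differ decides. Reading upwards, each difference
overwrites the verdict; the initial value `c` is the verdict for equal numbers, so `true` gives `≤`.
-/
theorem leBits_iff (l : List (Bool × Bool)) (c : Bool) :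
    leBits l c = true ↔ bitVal (l.map Prod.fst) < bitVal (l.map Prod.snd) + c.toNat := by
  induction l generalizing c with
  | nil => cases c <;> simp [leBits]
  | cons p l ih =>
    obtain ⟨a, b⟩ := p
    simp only [leBits, List.foldl_cons] at *
    rw [ih]
    simp only [List.map_cons, bitVal_cons, Nat.bit_val]
    cases a <;> cases b <;> cases c <;> simp <;> omega

namespace PTime

@[fun_prop]
theorem xor {f g : α → Bool} (hf : PTime f) (hg : PTime g) : PTime fun x => (f x ^^ g x) :=
  (ite hf hg.not hg).of_eq fun x => by cases f x <;> cases g x <;> rfl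

theorem padZip : PTime fun p : List Bool × List Bool => padZip p.1 p.2 := by
  have h : PTime fun p : List Bool × List Bool =>
      p.1.foldl (fun (s : List Bool × List (Bool × Bool)) b =>
        (s.1.tail, (b, s.1.headD false) :: s.2)) (p.2, []) := by
    refine foldl_add (g := fun _ (s : List Bool × List (Bool × Bool)) b => (s.1.tail, (b, s.1.headD false) :: s.2)) (by fun_prop)
      (by fun_prop) (by fun_prop) 12 ?_
    rintro x ⟨_ | ⟨c, t⟩, out⟩ b -
    · simp; omega
    · simp; omega
  exact (h.snd'.reverse.append (map (f := fun _ c => (false, c)) h.fst' (by fun_prop))).of_eq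
    fun p => (padZip_eq_foldl _ _).symm

@[fun_prop]
theorem add {f g : α → ℕ} (hf : PTime f) (hg : PTime g) : PTime fun x => f x + g x := by
  suffices PTime fun p : ℕ × ℕ => p.1 + p.2 by
    have h := this.comp (hf.pair hg)
    exact h
  have h₀ : PTime fun p : ℕ × ℕ =>
      StackProgram.padZip (Computability.encodeNat p.1) (Computability.encodeNat p.2) :=
    padZip.comp ((encodeNat.comp fst).pair (encodeNat.comp snd))
  have h : PTime fun q : ℕ × ℕ =>
      (StackProgram.padZip (Computability.encodeNat q.1) (Computability.encodeNat q.2)).foldl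
        (fun (s : Bool × List Bool) (p : Bool × Bool) =>
        ((p.1 && p.2) || (s.1 && (p.1 ^^ p.2)), ((p.1 ^^ p.2) ^^ s.1) :: s.2)) (false, []) := by
    refine foldl_add (g := fun _ (s : Bool × List Bool) (p : Bool × Bool) => ((p.1 && p.2) || (s.1 && (p.1 ^^ p.2)),
      ((p.1 ^^ p.2) ^^ s.1) :: s.2)) h₀ (by fun_prop) (by fun_prop) 6 ?_
    intro x y b _
    simp; omega
  refine (bitVal.comp (h.snd'.reverse.append (h.fst'.cons (const [])))).of_eq fun x => ?_
  rw [← addBits_eq_foldl, bitVal_addBits]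
  simp

@[fun_prop]
theorem le {f g : α → ℕ} (hf : PTime f) (hg : PTime g) : PTime fun x => decide (f x ≤ g x) := by
  suffices PTime fun p : ℕ × ℕ => decide (p.1 ≤ p.2) by
    have h := this.comp (hf.pair hg)
    exact h
  have h₀ : PTime fun p : ℕ × ℕ =>
      StackProgram.padZip (Computability.encodeNat p.1) (Computability.encodeNat p.2) :=
    padZip.comp ((encodeNat.comp fst).pair (encodeNat.comp snd))
  have h : PTime fun q : ℕ × ℕ => leBits
      (StackProgram.padZip (Computability.encodeNat q.1) (Computability.encodeNat q.2)) true := by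
    refine foldl_add (g := fun _ (c : Bool) (p : Bool × Bool) => if (p.1 ^^ p.2) = true then p.2 else c) h₀ (const true)
      (by fun_prop) 0 ?_
    intro x y b _
    simp
  refine h.of_eq fun x => ?_
  rw [Bool.eq_iff_iff, leBits_iff]
  simp

@[fun_prop]
theorem natEq {f g : α → ℕ} (hf : PTime f) (hg : PTime g) : PTime fun x => decide (f x = g x) :=
  ((le hf hg).and (le hg hf)).of_eq fun x => by
    rw [Bool.eq_iff_iff]; simp [Nat.le_antisymm_iff]

/-- Horner's scheme in base two; the right fold begins with the most significant bit. -/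
theorem foldr_bit_eq_mul (l : List Bool) (m : ℕ) :
    l.foldr (fun b a => a + a + if b = true then m else 0) 0 = StackProgram.bitVal l * m := by
  induction l with
  | nil => simp
  | cons b l ih =>
    simp only [List.foldr_cons, ih, bitVal_cons, Nat.bit_val]
    cases b <;> simp <;> ring

@[fun_prop]
theorem mul {f g : α → ℕ} (hf : PTime f) (hg : PTime g) : PTime fun x => f x * g x := by
  suffices PTime fun p : ℕ × ℕ => p.1 * p.2 by
    have h := this.comp (hf.pair hg)
    exact h
  have : PTime fun p : ℕ × ℕ => (Computability.encodeNat p.1).foldr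
      (fun b a => a + a + if b = true then p.2 else 0) 0 := by
    refine foldr_add (g := fun p b a => a + a + if b = true then p.2 else 0) (encodeNat.comp fst)
      (const 0) (by fun_prop) (12 + .X) fun x y b _ => ?_
    -- Doubling adds only one bit. The general estimate `sz_nat_add_le` would nearly double the size
    -- in each step, which is not an additive bound.
    have h₁ : sz (y + y) ≤ sz y + 6 := by
      have : (y + y).size ≤ y.size + 1 := by
        rw [Nat.size_le, pow_succ]
        have := Nat.lt_size_self y
        omega
      simp only [sz_nat]
      omega
    have h₂ := sz_nat_add_le (y + y) (if b = true then x.2 else 0)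
    have h₃ : sz (if b = true then x.2 else 0) ≤ sz x.2 := sz_nat_mono (by split <;> omega)
    simp
    omega
  refine this.of_eq fun x => ?_
  rw [foldr_bit_eq_mul, bitVal_encodeNat]

@[fun_prop]
theorem length {f : α → List β} (hf : PTime f) : PTime fun x => (f x).length := by
  refine (foldr_add (g := fun _ _ n => n + 1) hf (const 0) (by fun_prop) 7
    fun x y b _ => ?_).of_eq fun x => ?_
  · have h₁ := sz_nat_add_le y 1
    have h₂ : sz 1 = 7 := by rw [sz_nat]; rfl
    simp; omega
  · induction f x with
    | nil => rfl
    | cons b l ih => simp [ih]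

@[fun_prop]
theorem sum {f : α → List ℕ} (hf : PTime f) : PTime fun x => (f x).sum :=
  foldr_add (g := fun _ b n => b + n) hf (const 0) (by fun_prop) .X fun x y b _ => by
    have h₁ := sz_nat_add_le b y
    simp; omega

end PTime

omit [Code β] in
theorem foldl_eq_decide [DecidableEq β] (l m : List β) (c : Bool) :
    (let s := l.foldl (fun (s : Bool × List β) b =>
      lcase s.2 (false, []) fun d t => (s.1 && decide (b = d), t)) (c, m);
      s.1 && s.2.isEmpty) = (c && decide (l = m)) := by
  induction l generalizing m c with
  | nil => cases m <;> simp
  | cons b l ih =>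
    cases m with
    | nil =>
      have := ih [] false
      simpa using this
    | cons d m =>
      have := ih m (c && decide (b = d))
      simp only [List.foldl_cons, lcase_cons] at *
      rw [this, Bool.eq_iff_iff]
      simp [and_assoc]

@[fun_prop]
theorem PTime.boolEq {f g : α → Bool} (hf : PTime f) (hg : PTime g) :
    PTime fun x => decide (f x = g x) :=
  (hf.xor hg).not.of_eq fun x => by cases f x <;> cases g x <;> rfl

theorem PTime.listEq [DecidableEq β] (hb : PTime fun p : β × β => decide (p.1 = p.2))
    {f g : α → List β} (hf : PTime f) (hg : PTime g) : PTime fun x => decide (f x = g x) := by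
  have h : PTime fun x => (f x).foldl (fun (s : Bool × List β) b =>
      StackProgram.lcase s.2 (false, []) fun d t => (s.1 && decide (b = d), t)) (true, g x) := by
    refine foldl_add (g := fun _ (s : Bool × List β) b =>
      StackProgram.lcase s.2 (false, []) fun d t => (s.1 && decide (b = d), t)) hf
      (by fun_prop) (lcase (by fun_prop) (by fun_prop) (pair (and (by fun_prop) (hb.comp
        (g := fun p : (β × List β) × (α × (Bool × List β)) × β => (p.2.2, p.1.1)) (by fun_prop)))
        (by fun_prop))) 0 ?_
    rintro x ⟨c, _ | ⟨d, t⟩⟩ b -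
    · simp
    · simp
  exact (h.fst'.and h.snd'.isEmpty).of_eq fun x => by simpa using foldl_eq_decide (f x) (g x) true

@[fun_prop]
theorem PTime.bitsEq {f g : α → List Bool} (hf : PTime f) (hg : PTime g) :
    PTime fun x => decide (f x = g x) := listEq (by fun_prop) hf hg

/-! ### Turing machines from polynomial-time functions -/

/-- Read the input stack into a list on the main stack. -/
def readInput {M N : ℕ} : Prog (Sym M N) :=
  .seq (.push .main false) <| .loop .inp (fun x : Option (Fin M) => x.isSome) <|
    .pop .inp fun x : Option (Fin M) => match x with
      | some j => .seq (pushWord (BTree.chain j).enc) (.push .main true)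
      | none => .skip

/-- Move a list from the main stack to the output stack. -/
def writeOutput {M N : ℕ} : Prog (Sym M N) :=
  .seq (.loop .main (fun x => x == some true) <| .pop .main fun _ =>
    finCases N fun j => .push .out j) <| .pop .main fun _ => .skip

theorem within_readInput {M N : ℕ} (l : List (Fin M)) :
    Within (readInput : Prog (Sym M N)) (mk l [] [] [] [] [])
      (mk [] [] (Code.toTree l.reverse).enc [] [] []) (l.length * (2 * M + 4) + 2) := by
  have key : ∀ l acc : List (Fin M), Within (.loop .inp (fun x : Option (Fin M) => x.isSome) <|
      .pop .inp fun x : Option (Fin M) => match x with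
        | some j => .seq (pushWord (BTree.chain j).enc) (.push .main true)
        | none => .skip) (mk l ([] : List (Fin N)) (Code.toTree acc).enc [] [] [])
      (mk [] [] (Code.toTree (l.reverse ++ acc)).enc [] [] []) (l.length * (2 * M + 4) + 1) := by
    intro l
    induction l with
    | nil => intro acc; exact (Within.loop_done (by rfl)).mono (by simp)
    | cons j l ih =>
      intro acc
      have ih := ih (j :: acc)
      rw [List.reverse_cons, List.append_assoc, List.singleton_append]
      refine (Within.loop_step (by rfl) (within_pop_inp
        ((within_pushWord ..).seq (within_push_main ..))) ih).mono ?_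
      have := j.2
      simp [add_mul]
      omega
  have := key l []
  rw [List.append_nil] at this
  exact ((within_push_main ..).seq this).mono (by omega)

theorem within_writeOutput {M N : ℕ} (l : List (Fin N)) :
    Within (writeOutput : Prog (Sym M N)) (mk [] [] (Code.toTree l).enc [] [] [])
      (mk [] l.reverse [] [] [] []) (l.length * (2 * N + 4) + 2) := by
  have key : ∀ l acc : List (Fin N), Within (.loop .main (fun x => x == some true) <|
      .pop .main fun _ => finCases N fun j => .push .out j)
      (mk ([] : List (Fin M)) acc (Code.toTree l).enc [] [] [])
      (mk [] (l.reverse ++ acc) [false] [] [] []) (l.length * (2 * N + 4) + 1) := by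
    intro l
    induction l with
    | nil => intro acc; exact (Within.loop_done (by rfl)).mono (by simp)
    | cons j l ih =>
      intro acc
      have ih := ih (j :: acc)
      rw [List.reverse_cons, List.append_assoc, List.singleton_append, toTree_cons]
      refine (Within.loop_step (by rfl) (within_pop_main
        (within_finCases _ _ _ _ _ _ _ j (within_push_out ..))) ih).mono ?_
      simp [add_mul]
      omega
  have := key l []
  rw [List.append_nil] at this
  exact (this.seq (within_pop_main (.skip _))).mono (by omega)

/-- Functions computable by programs are computable by Turing machines. -/
theorem polyTime_of_pTime {α β A₀ A₁ : Type} {ea : α → List A₀} {eb : β → List A₁} {M N : ℕ}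
    (eA : A₀ ≃ Fin M) (eB : A₁ ≃ Fin N) {f : α → β} {F : List (Fin M) → List (Fin N)}
    (hF : PTime F) (h : ∀ x, F ((ea x).map eA) = (eb (f x)).map eB) :
    ParetoCover.PolyTime ea eb f := by
  -- Moving a word from the input stack to the main stack reverses it, and writing the output
  -- reverses once more.
  have hG : PTime fun l : List (Fin M) => (F l.reverse).reverse := (hF.comp (PTime.id.reverse)).reverse
  obtain ⟨q, hq⟩ := hG.size_le
  obtain ⟨P, p, hP⟩ := hG M N
  let Q : Prog (Sym M N) := .seq readInput (.seq P writeOutput)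
  -- A letter has size at most `2 * M + 1`, each cons adds one, and so does the empty list.
  let r : Polynomial ℕ := .X * (2 * M + 2 : ℕ) + 1
  have key : ∀ l : List (Fin M), Within Q (mk l [] [] [] [] []) (mk [] (F l) [] [] [] [])
      ((.X * (2 * M + 4 : ℕ) + 2 + p.comp r + (q.comp r * (2 * N + 4 : ℕ) + 2) :
        Polynomial ℕ).eval l.length) := by
    intro l
    have h₁ := hP l.reverse [] [] [] [] [] []
    have h₂ := within_writeOutput (M := M) (F l).reverse
    simp only [List.append_nil, List.reverse_reverse] at h₁ h₂
    refine ((within_readInput l).seq (h₁.seq h₂)).mono ?_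
    have h₃ : sz l.reverse ≤ r.eval l.length := by
      have := sz_le_length_mul (l := l.reverse) (n := 2 * M + 1) fun a _ => by
        simp
      simpa [r, add_assoc] using this
    have h₄ := p.eval_nat_mono h₃
    have h₅ : (F l).length ≤ q.eval (r.eval l.length) := by
      have h₁ := hq l.reverse
      have h₂ := length_lt_sz (F l.reverse.reverse).reverse
      have h₃ := q.eval_nat_mono h₃
      simp at h₁ h₂
      omega
    have h₆ := Nat.mul_le_mul_right (2 * N + 4) h₅
    simp
    omega
  refine ⟨{
    tm := machine Q .inp .out
    inputAlphabet := eA.symm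
    outputAlphabet := eB.symm
    time := .X * (2 * M + 4 : ℕ) + 2 + p.comp r + (q.comp r * (2 * N + 4 : ℕ) + 2) + 1
    outputsFun := fun x => Classical.choice ?_ }⟩
  obtain ⟨t, ht, hr⟩ := key ((ea x).map eA)
  refine ⟨⟨⟨t + 1, ?_⟩, ?_⟩⟩
  · have := machine_evals hr (k₀ := .inp) (k₁ := .out)
    rw [h] at this
    have hi : initList (machine Q .inp .out) ((ea x).map eA.symm.invFun) =
        ⟨some (machine Q .inp .out).main, (machine Q .inp .out).initialState,
          mk ((ea x).map eA) [] [] [] [] []⟩ := by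
      unfold initList
      congr 1
      funext k
      cases k <;> rfl
    have ho : haltList (machine Q .inp .out) ((eb (f x)).map eB.symm.invFun) =
        ⟨none, (machine Q .inp .out).initialState, mk [] ((eb (f x)).map eB) [] [] [] []⟩ := by
      unfold haltList
      congr 1
      funext k
      cases k <;> rfl
    rw [Option.map_some, hi, ho]
    exact this
  · simp at *
    omega

end StackProgram

/-! ### Evaluation of a cover -/

namespace CoverEval

/-- The real number represented by a numerator and a denominator. -/
noncomputable def fv (q : ℕ × ℕ) : ℝ := (q.1 : ℝ) / (q.2 : ℝ)

theorem fv_nonneg (q : ℕ × ℕ) : 0 ≤ fv q := by unfold fv; positivity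

/-- Comparison of fractions. -/
def fle (x y : ℕ × ℕ) : Bool := decide (x.1 * y.2 ≤ y.1 * x.2)

theorem fle_iff {x y : ℕ × ℕ} (hx : 0 < x.2) (hy : 0 < y.2) : fle x y = true ↔ fv x ≤ fv y := by
  unfold fle fv
  rw [div_le_div_iff₀ (by exact_mod_cast hx) (by exact_mod_cast hy), decide_eq_true_iff]
  exact_mod_cast Iff.rfl

/-- Numerators of a list of fractions with respect to a common denominator. -/
def clearDen (l : List (ℕ × ℕ)) : List ℕ × ℕ :=
  l.foldr (fun q s => (q.1 * s.2 :: s.1.map fun w => q.2 * w, q.2 * s.2)) ([], 1)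

theorem clearDen_pos {l : List (ℕ × ℕ)} (h : ∀ q ∈ l, 0 < q.2) : 0 < (clearDen l).2 := by
  induction l with
  | nil => exact one_pos
  | cons q l ih =>
    exact Nat.mul_pos (h q (by simp)) (ih fun r hr => h r (by simp [hr]))

@[simp] theorem length_clearDen (l : List (ℕ × ℕ)) : (clearDen l).1.length = l.length := by
  induction l with
  | nil => rfl
  | cons q l ih => simpa [clearDen] using ih

theorem clearDen_map {l : List (ℕ × ℕ)} (h : ∀ q ∈ l, 0 < q.2) :
    (clearDen l).1.map (fun w => fv (w, (clearDen l).2)) = l.map fv := by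
  induction l with
  | nil => rfl
  | cons q l ih =>
    have hl : ∀ r ∈ l, 0 < r.2 := fun r hr => h r (by simp [hr])
    have h₁ : ((clearDen l).2 : ℝ) ≠ 0 := by exact_mod_cast (clearDen_pos hl).ne'
    have h₂ : (q.2 : ℝ) ≠ 0 := by exact_mod_cast (h q (by simp)).ne'
    rw [List.map_cons, ← ih hl]
    change fv (q.1 * (clearDen l).2, q.2 * (clearDen l).2) ::
      ((clearDen l).1.map fun w => q.2 * w).map _ = _
    congr 1
    · simp only [fv]; push_cast; field_simp
    · rw [List.map_map]
      refine List.map_congr_left fun w _ => ?_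
      change fv (q.2 * w, q.2 * (clearDen l).2) = _
      simp only [fv]; push_cast; field_simp

/-- The sum of a list of fractions. -/
def fsum (l : List (ℕ × ℕ)) : ℕ × ℕ := ((clearDen l).1.sum, (clearDen l).2)

theorem fv_fsum {l : List (ℕ × ℕ)} (h : ∀ q ∈ l, 0 < q.2) : fv (fsum l) = (l.map fv).sum := by
  rw [← clearDen_map h]
  have (m : List ℕ) (d : ℕ) : fv (m.sum, d) = (m.map fun w => fv (w, d)).sum := by
    induction m with
    | nil => simp [fv]
    | cons w m ih =>
      rw [List.map_cons, List.sum_cons, List.sum_cons, ← ih]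
      simp [fv, add_div]
  exact this _ _

/-- The scalar product of two vectors of fractions. -/
def dot (x y : List (ℕ × ℕ)) : ℕ × ℕ :=
  fsum ((x.zip y).map fun q => (q.1.1 * q.2.1, q.1.2 * q.2.2))

/-- The columns of a matrix that is given by its rows; the number of columns is the length of the
first argument. -/
def columns {τ : Type} : List τ → List (List (ℕ × ℕ)) → List (List (ℕ × ℕ))
  | [], _ => []
  | _ :: t, b => (b.map fun r => r.headD (0, 1)) :: columns t (b.map List.tail)

/-- For each coordinate, the list of the possible values; a value is represented by the set of
points of the cover that are at least as large in this coordinate, and its weight. -/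
def rows (a : List (ℕ × ℕ)) (p b : List (List (ℕ × ℕ))) : List (List (List Bool × ℕ)) :=
  (p.zip (columns p b)).map fun q =>
    (a.zip (clearDen q.1).1).map fun r => (q.2.map fun y => fle r.1 y, r.2)

/-- Intersection of sets that are given by bit lists. -/
def mand (m m' : List Bool) : List Bool := (m.zip m').map fun q => q.1 && q.2

theorem mand_ofFn {k : ℕ} (f g : Fin k → Bool) :
    mand (List.ofFn f) (List.ofFn g) = List.ofFn fun l => f l && g l := by
  apply List.ext_getElem <;> simp [mand]

theorem length_mand (m m' : List Bool) : (mand m m').length = min m.length m'.length := by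
  simp [mand]

/-- All bit lists of length `k`. -/
noncomputable def masks (k : ℕ) : List (List Bool) :=
  (List.finite_length_eq Bool k).toFinset.toList

/-- One step of the dynamic program: take another coordinate into account. -/
noncomputable def dpStep (k : ℕ) (L row : List (List Bool × ℕ)) : List (List Bool × ℕ) :=
  (masks k).map fun m => (m, ((L.flatMap fun s => row.map fun r => (mand s.1 r.1, s.2 * r.2)).map
    fun c => if decide (c.1 = m) = true then c.2 else 0).sum)

/-- The distribution of the set of points of the cover that lie above a random point. -/
noncomputable def dp (k : ℕ) (R : List (List (List Bool × ℕ))) : List (List Bool × ℕ) :=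
  R.foldl (dpStep k) [(List.replicate k true, 1)]

/-- The sum of a function with respect to a weighted list. -/
def total (L : List (List Bool × ℕ)) (g : List Bool → ℕ) : ℕ := (L.map fun s => s.2 * g s.1).sum

theorem total_append (L L' : List (List Bool × ℕ)) (g : List Bool → ℕ) :
    total (L ++ L') g = total L g + total L' g := by simp [total]

/-- Merging entries with equal masks does not change weighted sums. A mask of length `k` occurs
exactly once in `masks k`, so no entry is lost or counted twice. -/
theorem total_collect {k : ℕ} {C : List (List Bool × ℕ)} (hC : ∀ c ∈ C, c.1.length = k)
    (g : List Bool → ℕ) :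
    total ((masks k).map fun m =>
      (m, (C.map fun c => if decide (c.1 = m) = true then c.2 else 0).sum)) g = total C g := by
  simp only [total, List.map_map, masks, Finset.sum_map_toList, Function.comp_def]
  induction C with
  | nil => simp
  | cons c C ih =>
    have ih := ih fun d hd => hC d (by simp [hd])
    simp only [List.map_cons, List.sum_cons, add_mul, Finset.sum_add_distrib, ih]
    simp [hC c (by simp)]

theorem length_of_mem_dpStep {k : ℕ} {L row : List (List Bool × ℕ)} :
    ∀ s ∈ dpStep k L row, s.1.length = k := by
  intro s hs
  simp only [dpStep, List.mem_map, masks, Finset.mem_toList, Set.Finite.mem_toFinset] at hs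
  obtain ⟨m, hm, rfl⟩ := hs
  exact hm

theorem total_dpStep {k : ℕ} {L row : List (List Bool × ℕ)} (hL : ∀ s ∈ L, s.1.length = k)
    (hrow : ∀ r ∈ row, r.1.length = k) (g : List Bool → ℕ) :
    total (dpStep k L row) g =
      total L fun m => (row.map fun r => r.2 * g (mand m r.1)).sum := by
  rw [dpStep, total_collect]
  · clear hL
    induction L with
    | nil => simp [total]
    | cons s L ih =>
      rw [List.flatMap_cons, total_append, ih]
      simp [total, Function.comp_def, ← List.sum_map_mul_left, mul_assoc]
  · intro c hc
    simp only [List.mem_flatMap, List.mem_map] at hc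
    obtain ⟨s, hs, r, hr, rfl⟩ := hc
    simp [length_mand, hL s hs, hrow r hr]

/-- The sum of a function over all choices of one value from each row. -/
def wsum : List (List (List Bool × ℕ)) → (List Bool → ℕ) → List Bool → ℕ
  | [], g, m => g m
  | row :: R, g, m => (row.map fun r => r.2 * wsum R g (mand m r.1)).sum

/-- Pushing the distribution forward through a row and pulling `g` back through it give the same
sum. The left side keeps a state of bounded length, whereas `wsum` runs over exponentially many
choices. -/
theorem total_foldl {k : ℕ} {R : List (List (List Bool × ℕ))}
    (hR : ∀ row ∈ R, ∀ r ∈ row, r.1.length = k) {L : List (List Bool × ℕ)}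
    (hL : ∀ s ∈ L, s.1.length = k) (g : List Bool → ℕ) :
    total (R.foldl (dpStep k) L) g = total L (wsum R g) := by
  induction R generalizing L with
  | nil => rfl
  | cons row R ih =>
    rw [List.foldl_cons, ih (fun r hr => hR r (by simp [hr])) length_of_mem_dpStep,
      total_dpStep hL (hR row (by simp))]
    rfl

/-- Induction on the number of coordinates; the initial mask is arbitrary because it accumulates the
intersections with the coordinates already treated. -/
theorem wsum_ofFn {k N : ℕ} (g : List Bool → ℕ) {n : ℕ} (B : Fin n → Fin N → Fin k → Bool)
    (w : Fin n → Fin N → ℕ) (μ : Fin k → Bool) :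
    wsum (List.ofFn fun i => List.ofFn fun j => (List.ofFn (B i j), w i j)) g (List.ofFn μ) =
      ∑ x : Fin n → Fin N, (∏ i, w i (x i)) *
        g (List.ofFn fun l => μ l && decide (∀ i, B i (x i) l = true)) := by
  induction n generalizing μ with
  | zero => simp [wsum]
  | succ n ih =>
    rw [List.ofFn_succ]
    simp only [wsum, List.map_ofFn, List.sum_ofFn, Function.comp_apply, mand_ofFn]
    rw [← (Fin.consEquiv fun _ => Fin N).sum_comp, Fintype.sum_prod_type]
    refine Finset.sum_congr rfl fun j _ => ?_
    rw [ih (fun i => B i.succ) (fun i => w i.succ), Finset.mul_sum]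
    refine Finset.sum_congr rfl fun x _ => ?_
    rw [Fin.prod_univ_succ, ← mul_assoc]
    congr 2
    congr 1
    funext l
    rw [Bool.eq_iff_iff]
    simp [Fin.forall_fin_succ, Fin.consEquiv, and_assoc]

/-- The smallest entry of a list among those selected by a bit list. -/
def minSel (K : List ℕ) (m : List Bool) : ℕ :=
  (m.zip K).foldr (fun q t => if (q.1 && decide (q.2 ≤ t)) = true then q.2 else t) K.sum

theorem minSel_ofFn_le {k : ℕ} (K : Fin k → ℕ) (μ : Fin k → Bool) (l : Fin k) (hl : μ l = true) :
    minSel (List.ofFn K) (List.ofFn μ) ≤ K l := by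
  have key : ∀ (Z : List (Bool × ℕ)) (s : ℕ) (q : Bool × ℕ), q ∈ Z → q.1 = true →
      Z.foldr (fun q t => if (q.1 && decide (q.2 ≤ t)) = true then q.2 else t) s ≤ q.2 := by
    intro Z s q hq h
    induction Z with
    | nil => simp at hq
    | cons r Z ih =>
      rw [List.foldr_cons]
      rcases List.mem_cons.1 hq with rfl | hq
      · simp only [h, Bool.true_and, decide_eq_true_eq]; split <;> omega
      · have := ih hq
        split
        · next hc => exact (of_decide_eq_true (Bool.and_eq_true _ _ ▸ hc).2).trans this
        · exact this
  refine key _ _ (true, K l) ?_ rfl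
  rw [List.mem_iff_getElem]
  exact ⟨l, by simp, by simp [hl]⟩

/-- The initial value `K.sum` is at least every entry. As the fold compares with `≤`, it survives
only if all selected entries exceed it strictly, which is impossible once something is selected. -/
theorem exists_minSel_ofFn_eq {k : ℕ} (K : Fin k → ℕ) (μ : Fin k → Bool) (h : ∃ l, μ l = true) :
    ∃ l, μ l = true ∧ K l = minSel (List.ofFn K) (List.ofFn μ) := by
  have key : ∀ (Z : List (Bool × ℕ)) (s : ℕ),
      let r := Z.foldr (fun q t => if (q.1 && decide (q.2 ≤ t)) = true then q.2 else t) s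
      (r = s ∧ ∀ q ∈ Z, q.1 = true → s < q.2) ∨ ∃ q ∈ Z, q.1 = true ∧ r = q.2 := by
    intro Z s
    induction Z with
    | nil => simp
    | cons q Z ih =>
      simp only [List.foldr_cons] at *
      by_cases hc : (q.1 && decide (q.2 ≤ Z.foldr (fun q t =>
          if (q.1 && decide (q.2 ≤ t)) = true then q.2 else t) s)) = true
      · rw [if_pos hc]
        simp only [Bool.and_eq_true] at hc
        exact .inr ⟨q, by simp, hc.1, rfl⟩
      · rw [if_neg hc]
        rcases ih with ⟨h₁, h₂⟩ | ⟨r, hr, h₁, h₂⟩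
        · refine .inl ⟨h₁, fun r hr h => ?_⟩
          rcases List.mem_cons.1 hr with rfl | hr
          · rw [h₁] at hc
            simpa [h] using hc
          · exact h₂ r hr h
        · exact .inr ⟨r, by simp [hr], h₁, h₂⟩
  rcases key ((List.ofFn μ).zip (List.ofFn K)) (List.ofFn K).sum with ⟨_, h₂⟩ | ⟨q, hq, h₁, h₂⟩
  · obtain ⟨l, hl⟩ := h
    have := h₂ (true, K l) (by
      rw [List.mem_iff_getElem]
      exact ⟨l, by simp, by simp [hl]⟩) rfl
    rw [List.sum_ofFn] at this
    exact absurd this (not_lt.2 (Finset.single_le_sum (by simp) (Finset.mem_univ l)))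
  · obtain ⟨l, hl, rfl⟩ := List.mem_iff_getElem.1 hq
    simp only [List.length_zip, List.length_ofFn, min_self] at hl
    exact ⟨⟨l, hl⟩, by simpa using h₁, by simpa [minSel] using h₂.symm⟩

/-- The weight of the uncovered points, and the numerator and the denominator of the expected
cost. -/
noncomputable def solve (k : ℕ) (a : List (ℕ × ℕ)) (p : List (List (ℕ × ℕ))) (c : List (ℕ × ℕ))
    (b : List (List (ℕ × ℕ))) : ℕ × (ℕ × ℕ) :=
  (total (dp k (rows a p b)) (fun m => if m.all (fun x => !x) = true then 1 else 0),
    total (dp k (rows a p b)) (minSel (clearDen (b.map fun y => dot c y)).1),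
    total (dp k (rows a p b)) (fun _ => 1) * (clearDen (b.map fun y => dot c y)).2)

end CoverEval

/-! ### The dynamic program as a sum over all grid points -/

namespace CoverEval

theorem ofFn_getD {τ : Type} {N : ℕ} {l : List τ} (d : τ) (h : l.length = N) :
    List.ofFn (fun j : Fin N => l.getD j d) = l := by
  subst h
  apply List.ext_getElem <;> simp

/-- The `j`-th numerator of a family of fractions with respect to the common denominator. -/
def numer {N : ℕ} (q : Fin N → ℕ × ℕ) (j : Fin N) : ℕ := (clearDen (List.ofFn q)).1.getD j 0

theorem ofFn_numer {N : ℕ} (q : Fin N → ℕ × ℕ) :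
    List.ofFn (numer q) = (clearDen (List.ofFn q)).1 := ofFn_getD 0 (by simp)

theorem clearDen_ofFn_pos {N : ℕ} {q : Fin N → ℕ × ℕ} (h : ∀ j, 0 < (q j).2) :
    0 < (clearDen (List.ofFn q)).2 :=
  clearDen_pos fun r hr => by
    obtain ⟨j, rfl⟩ := (List.mem_ofFn' _ _).1 hr
    exact h j

theorem fv_eq_numer {N : ℕ} {q : Fin N → ℕ × ℕ} (h : ∀ j, 0 < (q j).2) (j : Fin N) :
    fv (q j) = numer q j / (clearDen (List.ofFn q)).2 := by
  have := clearDen_map (l := List.ofFn q) fun r hr => by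
    obtain ⟨j, rfl⟩ := (List.mem_ofFn' _ _).1 hr
    exact h j
  rw [← ofFn_numer, List.map_ofFn, List.map_ofFn] at this
  exact (congrFun (List.ofFn_injective this) j).symm

theorem fv_dot {n : ℕ} {x y : Fin n → ℕ × ℕ} (hx : ∀ i, 0 < (x i).2) (hy : ∀ i, 0 < (y i).2) :
    fv (dot (List.ofFn x) (List.ofFn y)) = ∑ i, fv (x i) * fv (y i) := by
  have e : ((List.ofFn x).zip (List.ofFn y)).map (fun q => (q.1.1 * q.2.1, q.1.2 * q.2.2)) =
      List.ofFn fun i => ((x i).1 * (y i).1, (x i).2 * (y i).2) := by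
    apply List.ext_getElem <;> simp
  rw [dot, e, fv_fsum, List.map_ofFn, List.sum_ofFn]
  · refine Finset.sum_congr rfl fun i _ => ?_
    simp [fv, div_mul_div_comm]
  · intro q hq
    obtain ⟨i, rfl⟩ := (List.mem_ofFn' _ _).1 hq
    exact Nat.mul_pos (hx i) (hy i)

theorem dot_den_pos {n : ℕ} {x y : Fin n → ℕ × ℕ} (hx : ∀ i, 0 < (x i).2)
    (hy : ∀ i, 0 < (y i).2) : 0 < (dot (List.ofFn x) (List.ofFn y)).2 := by
  refine clearDen_pos fun q hq => ?_
  obtain ⟨r, hr, rfl⟩ := List.mem_map.1 hq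
  obtain ⟨i, hi, rfl⟩ := List.mem_iff_getElem.1 hr
  simp only [List.getElem_zip, List.getElem_ofFn]
  exact Nat.mul_pos (hx _) (hy _)

theorem columns_ofFn {τ : Type} {n k : ℕ} (t : Fin n → τ) (b : Fin k → Fin n → ℕ × ℕ) :
    columns (List.ofFn t) (List.ofFn fun l => List.ofFn (b l)) =
      List.ofFn fun i => List.ofFn fun l => b l i := by
  induction n with
  | zero => simp [columns]
  | succ n ih =>
    simp only [List.ofFn_succ (n := n), columns, List.map_ofFn]
    congr 1
    exact ih (fun i => t i.succ) fun l i => b l i.succ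

section
variable {k n N : ℕ} (a : Fin N → ℕ × ℕ) (p : Fin n → Fin N → ℕ × ℕ) (c : Fin n → ℕ × ℕ)
  (b : Fin k → Fin n → ℕ × ℕ)

theorem rows_ofFn :
    rows (List.ofFn a) (List.ofFn fun i => List.ofFn (p i)) (List.ofFn fun l => List.ofFn (b l)) =
      List.ofFn fun i => List.ofFn fun j =>
        (List.ofFn fun l => fle (a j) (b l i), numer (p i) j) := by
  rw [rows, columns_ofFn]
  apply List.ext_getElem
  · simp
  · intro i h₁ h₂
    simp only [List.getElem_map, List.getElem_zip, List.getElem_ofFn, ← ofFn_numer]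
    apply List.ext_getElem <;> simp [Function.comp_def, List.map_ofFn]

/-- The bit list of the points of the cover that lie above the point with index `x`. -/
def mask (x : Fin n → Fin N) : List Bool :=
  List.ofFn fun l => decide (∀ i, fle (a (x i)) (b l i) = true)

/-- The central identity of the algorithm: starting from the full mask, the program accounts for all
`N ^ n` points, since a summand depends on its point only through the weight, which is a product,
and the mask, which is an intersection. -/
theorem total_dp (g : List Bool → ℕ) :
    total (dp k (rows (List.ofFn a) (List.ofFn fun i => List.ofFn (p i))
      (List.ofFn fun l => List.ofFn (b l)))) g =
      ∑ x : Fin n → Fin N, (∏ i, numer (p i) (x i)) * g (mask a b x) := by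
  rw [rows_ofFn, dp, total_foldl]
  · have : List.replicate k true = List.ofFn fun _ : Fin k => true := by simp [List.ofFn_const]
    simp only [total, List.map_cons, List.map_nil, List.sum_cons, List.sum_nil, one_mul, add_zero]
    rw [this, wsum_ofFn g (fun i j l => fle (a j) (b l i)) (fun i => numer (p i))]
    simp [mask]
  · intro row hrow r hr
    obtain ⟨i, rfl⟩ := (List.mem_ofFn' _ _).1 hrow
    obtain ⟨j, rfl⟩ := (List.mem_ofFn' _ _).1 hr
    simp
  · simp

theorem mask_all_not_iff (x : Fin n → Fin N) :
    (mask a b x).all (fun y => !y) = true ↔ ¬ ∃ l, ∀ i, fle (a (x i)) (b l i) = true := by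
  simp [mask, List.all_eq_true, List.mem_ofFn]

variable {a p c b} (ha : ∀ j, 0 < (a j).2) (hp : ∀ i j, 0 < (p i j).2)
  (hsum : ∀ i, ∑ j, fv (p i j) = 1) (hc : ∀ i, 0 < (c i).2) (hb : ∀ l i, 0 < (b l i).2)

include hp hsum in
theorem sum_numer (i : Fin n) : ∑ j, numer (p i) j = (clearDen (List.ofFn (p i))).2 := by
  have h := hsum i
  simp only [fv_eq_numer (hp i), ← Finset.sum_div] at h
  have h₀ : ((clearDen (List.ofFn (p i))).2 : ℝ) ≠ 0 := by
    exact_mod_cast (clearDen_ofFn_pos (hp i)).ne'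
  rw [div_eq_one_iff_eq h₀] at h
  exact_mod_cast h

include hp hsum in
theorem sum_weights_pos : 0 < ∑ x : Fin n → Fin N, ∏ i, numer (p i) (x i) := by
  rw [← Fintype.piFinset_univ, ← Finset.prod_univ_sum]
  exact Finset.prod_pos fun i _ => by
    rw [sum_numer hp hsum]; exact clearDen_ofFn_pos (hp i)

-- Expanding the product of the row sums shows that the total weight of all points is the product of
-- the common denominators. Dividing by the total weight therefore recovers the probabilities.
include hp hsum in
theorem prod_fv (x : Fin n → Fin N) :
    ∏ i, fv (p i (x i)) = (∏ i, numer (p i) (x i) : ℕ) /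
      (∑ x : Fin n → Fin N, ∏ i, numer (p i) (x i) : ℕ) := by
  rw [← Fintype.piFinset_univ, ← Finset.prod_univ_sum]
  simp only [fv_eq_numer (hp _), Finset.prod_div_distrib, sum_numer hp hsum]
  push_cast
  rfl

end

end CoverEval

/-! ### Covering condition and expected cost in terms of the dynamic program -/

namespace CoverEval

open ParetoCover

/-- Integration with respect to a discrete product distribution. -/
theorem lintegral_discreteMeasure {n M : ℕ} (a : Fin (M + 2) → ℝ) (p : Fin n → Fin (M + 2) → ℝ)
    (f : (Fin n → ℝ) → ℝ≥0∞) :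
    ∫⁻ x, f x ∂(discreteMeasure a p) =
      ∑ x : Fin n → Fin (M + 2), (∏ i, ENNReal.ofReal (p i (x i))) * f fun i => a (x i) := by
  simp [discreteMeasure, lintegral_finsetSum_measure, lintegral_smul_measure, lintegral_dirac]

theorem discreteMeasure_apply {n M : ℕ} (a : Fin (M + 2) → ℝ) (p : Fin n → Fin (M + 2) → ℝ)
    (S : Set (Fin n → ℝ)) :
    discreteMeasure a p S = ∑ x : Fin n → Fin (M + 2),
      (∏ i, ENNReal.ofReal (p i (x i))) * S.indicator 1 fun i => a (x i) := by
  simp [discreteMeasure]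

theorem coverCost_range {n k : ℕ} (c : Fin n → ℝ) (b : Fin k → Fin n → ℝ) (x : Fin n → ℝ) :
    coverCost c (Set.range b) x =
      ⨅ l, ⨅ _ : x ≤ b l, ENNReal.ofReal (∑ i, c i * b l i) := by
  rw [coverCost, iInf_range]

section
variable {k n M : ℕ} {a : Fin (M + 2) → ℕ × ℕ} {p : Fin n → Fin (M + 2) → ℕ × ℕ}
  {c : Fin n → ℕ × ℕ} {b : Fin k → Fin n → ℕ × ℕ}
  (ha : ∀ j, 0 < (a j).2) (hp : ∀ i j, 0 < (p i j).2)
  (hsum : ∀ i, ∑ j, fv (p i j) = 1) (hc : ∀ i, 0 < (c i).2) (hb : ∀ l i, 0 < (b l i).2)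

variable (a p c b) in
/-- The output of the evaluation algorithm on matrices. -/
noncomputable def solveFn : ℕ × (ℕ × ℕ) :=
  solve k (List.ofFn a) (List.ofFn fun i => List.ofFn (p i)) (List.ofFn c)
    (List.ofFn fun l => List.ofFn (b l))

include ha hb in
theorem le_iff_fle (x : Fin n → Fin (M + 2)) (l : Fin k) :
    ((fun i => fv (a (x i))) ≤ fun i => fv (b l i)) ↔ ∀ i, fle (a (x i)) (b l i) = true :=
  forall_congr' fun i => (fle_iff (ha _) (hb l i)).symm

include hp hsum in
theorem prod_ofReal (x : Fin n → Fin (M + 2)) :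
    ∏ i, ENNReal.ofReal (fv (p i (x i))) =
      ENNReal.ofReal ((∏ i, numer (p i) (x i) : ℕ) /
        (∑ x : Fin n → Fin (M + 2), ∏ i, numer (p i) (x i) : ℕ)) := by
  rw [← ENNReal.ofReal_prod_of_nonneg fun i _ => fv_nonneg _, prod_fv hp hsum]

include hp hsum in
theorem prod_ofReal_eq_zero (x : Fin n → Fin (M + 2)) :
    ∏ i, ENNReal.ofReal (fv (p i (x i))) = 0 ↔ ∏ i, numer (p i) (x i) = 0 := by
  have h : (0 : ℝ) < (∑ x : Fin n → Fin (M + 2), ∏ i, numer (p i) (x i) : ℕ) := by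
    exact_mod_cast sum_weights_pos hp hsum
  rw [prod_ofReal hp hsum, ENNReal.ofReal_eq_zero]
  constructor
  · intro h'
    have h₁ : ((∏ i, numer (p i) (x i) : ℕ) : ℝ) ≤ 0 := by
      have := (div_le_iff₀ h).1 h'
      simpa using this
    exact_mod_cast h₁.antisymm (Nat.cast_nonneg _)
  · intro h'
    simp [h']

include hp hsum in
theorem sum_prod_ofReal :
    ∑ x : Fin n → Fin (M + 2), ∏ i, ENNReal.ofReal (fv (p i (x i))) = 1 := by
  simp only [prod_ofReal hp hsum]
  rw [← ENNReal.ofReal_sum_of_nonneg fun x _ => by positivity, ← Finset.sum_div, ← Nat.cast_sum,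
    div_self, ENNReal.ofReal_one]
  exact_mod_cast (sum_weights_pos hp hsum).ne'

-- The total mass is one, so the covered points have mass one if and only if the uncovered ones have
-- mass zero. All summands being nonnegative, this says that the integer weight of each uncovered
-- point vanishes.
include ha hp hsum hb in
theorem isParetoCover_iff :
    IsParetoCover (discreteMeasure (fun j => fv (a j)) fun i j => fv (p i j))
      (Set.range fun l i => fv (b l i)) ↔ (solveFn a p c b).1 = 0 := by
  classical
  let S : Finset (Fin n → Fin (M + 2)) :=
    Finset.univ.filter fun x => ∃ l, ∀ i, fle (a (x i)) (b l i) = true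
  have h₁ : discreteMeasure (fun j => fv (a j)) (fun i j => fv (p i j))
      {x | ∃ y ∈ Set.range fun l i => fv (b l i), x ≤ y} =
      ∑ x ∈ S, ∏ i, ENNReal.ofReal (fv (p i (x i))) := by
    rw [discreteMeasure_apply, Finset.sum_filter]
    refine Finset.sum_congr rfl fun x _ => ?_
    simp only [Set.indicator_apply, Set.mem_ofPred_eq, Set.exists_range_iff, le_iff_fle ha hb,
      Pi.one_apply, mul_ite, mul_one, mul_zero]
  have h₂ := Finset.sum_add_sum_compl S fun x => ∏ i, ENNReal.ofReal (fv (p i (x i)))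
  rw [sum_prod_ofReal hp hsum] at h₂
  have h₃ : (∑ x ∈ S, ∏ i, ENNReal.ofReal (fv (p i (x i)))) = 1 ↔
      (∑ x ∈ Sᶜ, ∏ i, ENNReal.ofReal (fv (p i (x i)))) = 0 := by
    constructor
    · intro h
      rw [h] at h₂
      exact (ENNReal.add_right_inj ENNReal.one_ne_top).1 (h₂.trans (add_zero 1).symm)
    · intro h
      rwa [h, add_zero] at h₂
  rw [IsParetoCover, h₁, h₃, Finset.sum_eq_zero_iff]
  simp only [solveFn, solve, total_dp, Finset.sum_eq_zero_iff, mask_all_not_iff, Nat.mul_eq_zero,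
    prod_ofReal_eq_zero hp hsum]
  simp only [S, Finset.mem_compl, Finset.mem_filter, Finset.mem_univ, true_and, forall_const]
  refine forall_congr' fun x => ?_
  split <;> simp_all

-- With one denominator for the costs of all `k` points, the cheapest point is found by a minimum of
-- natural numbers.
include hc hb in
theorem cost_eq (l : Fin k) : ∑ i, fv (c i) * fv (b l i) =
    numer (fun l => dot (List.ofFn c) (List.ofFn (b l))) l /
      (clearDen (List.ofFn fun l => dot (List.ofFn c) (List.ofFn (b l)))).2 := by
  rw [← fv_dot hc (hb l), fv_eq_numer (q := fun l => dot (List.ofFn c) (List.ofFn (b l)))]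
  exact fun l => dot_den_pos hc (hb l)

include ha hc hb in
theorem coverCost_eq (x : Fin n → Fin (M + 2))
    (hx : ∃ l, ∀ i, fle (a (x i)) (b l i) = true) :
    coverCost (fun i => fv (c i)) (Set.range fun l i => fv (b l i)) (fun i => fv (a (x i))) =
      ENNReal.ofReal (minSel
        (List.ofFn (numer fun l => dot (List.ofFn c) (List.ofFn (b l)))) (mask a b x) /
        (clearDen (List.ofFn fun l => dot (List.ofFn c) (List.ofFn (b l)))).2) := by
  rw [coverCost_range]
  simp only [le_iff_fle ha hb, cost_eq hc hb]
  apply le_antisymm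
  · obtain ⟨l, hl, e⟩ := exists_minSel_ofFn_eq
      (numer fun l => dot (List.ofFn c) (List.ofFn (b l)))
      (fun l => decide (∀ i, fle (a (x i)) (b l i) = true)) (by simpa using hx)
    rw [mask, ← e]
    exact iInf₂_le l (of_decide_eq_true hl)
  · refine le_iInf₂ fun l hl => ENNReal.ofReal_le_ofReal ?_
    gcongr
    exact minSel_ofFn_le _ _ l (decide_eq_true hl)

include ha hp hsum hc hb in
theorem expectedCost_eq (h : (solveFn a p c b).1 = 0) :
    0 < (solveFn a p c b).2.2 ∧
    expectedCost (discreteMeasure (fun j => fv (a j)) fun i j => fv (p i j)) (fun i => fv (c i))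
      (Set.range fun l i => fv (b l i)) = ENNReal.ofReal (fv (solveFn a p c b).2) := by
  have hD : 0 < (clearDen (List.ofFn fun l => dot (List.ofFn c) (List.ofFn (b l)))).2 :=
    clearDen_ofFn_pos fun l => dot_den_pos hc (hb l)
  have hW := sum_weights_pos hp hsum
  have hmap : (List.ofFn fun l => List.ofFn (b l)).map (fun y => dot (List.ofFn c) y) =
      List.ofFn fun l => dot (List.ofFn c) (List.ofFn (b l)) := by
    rw [List.map_ofFn]; rfl
  simp only [solveFn, solve, total_dp, mul_one, hmap] at h ⊢
  refine ⟨Nat.mul_pos hW hD, ?_⟩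
  rw [expectedCost, lintegral_discreteMeasure, ← ofFn_numer]
  simp only [fv]
  rw [Nat.cast_mul, Nat.cast_sum, mul_comm, ← div_div, div_right_comm, Finset.sum_div,
    Finset.sum_div, ENNReal.ofReal_sum_of_nonneg fun x _ => by positivity]
  refine Finset.sum_congr rfl fun x _ => ?_
  by_cases hx : ∃ l, ∀ i, fle (a (x i)) (b l i) = true
  · have := coverCost_eq ha hc hb x hx
    simp only [fv] at this
    rw [this]
    have := prod_ofReal hp hsum x
    simp only [fv] at this
    rw [this, ← ENNReal.ofReal_mul (by positivity)]
    congr 1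
    push_cast
    field_simp
  -- An uncovered point has infinite cost, but `h` makes its probability zero, and the product of
  -- zero and infinity is zero. The meaningless value of `minSel` is multiplied by zero as well.
  · have h₀ := (Finset.sum_eq_zero_iff.1 h) x (Finset.mem_univ x)
    rw [if_pos ((mask_all_not_iff a b x).2 hx), mul_one] at h₀
    have := (prod_ofReal_eq_zero hp hsum x).2 h₀
    simp only [fv] at this
    rw [this, h₀]
    simp

end

end CoverEval

/-! ### The evaluation takes polynomial time -/

namespace CoverEval

open StackProgram

variable {α β : Type} [Code α] [Code β]

@[fun_prop]
theorem pTime_fle {f g : α → ℕ × ℕ} (hf : PTime f) (hg : PTime g) :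
    PTime fun x => fle (f x) (g x) := by
  unfold fle
  fun_prop

/-- All numbers involved are products with at most one factor from each fraction, so sizes add up.
The constant is `sz 1 - sz []`, from the empty list with denominator one. -/
theorem sz_clearDen (l : List (ℕ × ℕ)) :
    sz (clearDen l).2 ≤ sz l + 6 ∧ ∀ w ∈ (clearDen l).1, sz w ≤ sz l + 6 := by
  induction l with
  | nil => simp [clearDen, sz_nat]
  | cons q l ih =>
    obtain ⟨ih₁, ih₂⟩ := ih
    have h₁ := sz_nat_mul_le q.2 (clearDen l).2
    refine ⟨?_, fun w hw => ?_⟩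
    · change sz (q.2 * (clearDen l).2) ≤ _
      simp
      omega
    · change w ∈ q.1 * (clearDen l).2 :: (clearDen l).1.map fun w => q.2 * w at hw
      rcases List.mem_cons.1 hw with rfl | hw
      · have h₂ := sz_nat_mul_le q.1 (clearDen l).2
        simp
        omega
      · obtain ⟨v, hv, rfl⟩ := List.mem_map.1 hw
        have h₂ := sz_nat_mul_le q.2 v
        have h₃ := ih₂ v hv
        simp
        omega

@[fun_prop]
theorem pTime_clearDen {f : α → List (ℕ × ℕ)} (hf : PTime f) : PTime fun x => clearDen (f x) := by
  suffices PTime clearDen from this.comp hf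
  have h : PTime fun l : List (ℕ × ℕ) => l.reverse.foldl
      (fun s q => (q.1 * s.2 :: s.1.map fun w => q.2 * w, q.2 * s.2)) (([] : List ℕ), 1) := by
    -- Each step multiplies all earlier numerators, so the growth is not estimated step by step.
    -- Instead, every intermediate value is `clearDen` of a part of `l`: at most `sz l` numerators,
    -- each of size at most `sz l + 6`.
    refine PTime.foldl (g := fun _ (s : List ℕ × ℕ) (q : ℕ × ℕ) =>
      (q.1 * s.2 :: s.1.map fun w => q.2 * w, q.2 * s.2)) (by fun_prop) (by fun_prop)
      (by fun_prop) (.X * (.X + 7) + 1 + .X + 7) ?_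
    intro l l₁ l₂ h
    have e : l₁.foldl (fun (s : List ℕ × ℕ) (q : ℕ × ℕ) =>
        (q.1 * s.2 :: s.1.map fun w => q.2 * w, q.2 * s.2)) ([], 1) = clearDen l₁.reverse := by
      rw [clearDen, List.foldr_reverse]
    have hl : l = l₂.reverse ++ l₁.reverse := by
      rw [← List.reverse_append, ← h, List.reverse_reverse]
    have h₀ := sz_append l₂.reverse l₁.reverse
    rw [← hl] at h₀
    have h₀' := sz_pos l₂.reverse
    obtain ⟨h₁, h₂⟩ := sz_clearDen l₁.reverse
    have h₃ := sz_le_length_mul (n := sz l + 6) fun w hw => (h₂ w hw).trans (by omega)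
    have h₄ := length_lt_sz l₁.reverse
    rw [length_clearDen] at h₃
    have h₅ : l₁.reverse.length * (sz l + 6 + 1) ≤ sz l * (sz l + 7) :=
      Nat.mul_le_mul (by omega) (by omega)
    rw [e]
    simp
    omega
  exact h.of_eq fun l => by rw [clearDen, List.foldl_reverse]

@[fun_prop]
theorem pTime_fsum {f : α → List (ℕ × ℕ)} (hf : PTime f) : PTime fun x => fsum (f x) := by
  unfold fsum
  fun_prop

@[fun_prop]
theorem pTime_dot {f g : α → List (ℕ × ℕ)} (hf : PTime f) (hg : PTime g) :
    PTime fun x => dot (f x) (g x) := by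
  unfold dot
  fun_prop

theorem columns_eq_foldl {τ : Type} (t : List τ) (b : List (List (ℕ × ℕ))) :
    columns t b = (t.foldl (fun (s : List (List (ℕ × ℕ)) × List (List (ℕ × ℕ))) _ =>
      (s.1.map List.tail, (s.1.map fun r => r.headD (0, 1)) :: s.2)) (b, [])).2.reverse := by
  suffices ∀ acc, acc.reverse ++ columns t b =
      (t.foldl (fun (s : List (List (ℕ × ℕ)) × List (List (ℕ × ℕ))) _ =>
      (s.1.map List.tail, (s.1.map fun r => r.headD (0, 1)) :: s.2)) (b, acc)).2.reverse by
    simpa using this []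
  induction t generalizing b with
  | nil => simp [columns]
  | cons a t ih =>
    intro acc
    simpa [columns] using ih (b.map List.tail) ((b.map fun r => r.headD (0, 1)) :: acc)

@[fun_prop]
theorem pTime_columns {f : α → List β} {g : α → List (List (ℕ × ℕ))} (hf : PTime f)
    (hg : PTime g) : PTime fun x => columns (f x) (g x) := by
  obtain ⟨q, hq⟩ := hg.size_le
  have ht (y : List (List (ℕ × ℕ))) : sz (y.map List.tail) ≤ sz y := by
    induction y with
    | nil => simp
    | cons r y ih => cases r <;> simp <;> omega
  -- An empty row, of size one, contributes the default `(0, 1)` of size nine; hence a constant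
  -- factor is needed.
  have hh (y : List (List (ℕ × ℕ))) : sz (y.map fun r => r.headD (0, 1)) ≤ 11 * sz y := by
    have h₀ : sz 0 = 1 := by rw [sz_nat]; rfl
    have h₁ : sz 1 = 7 := by rw [sz_nat]; rfl
    induction y with
    | nil => simp
    | cons r y ih => cases r <;> simp [h₀, h₁, -List.headD_eq_head?_getD] <;> omega
  have h : PTime fun x => (f x).foldl (fun (s : List (List (ℕ × ℕ)) × List (List (ℕ × ℕ))) _ =>
      (s.1.map List.tail, (s.1.map fun r => r.headD (0, 1)) :: s.2)) (g x, []) := by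
    -- Removing the first column never enlarges the matrix. This invariant bounds each extracted
    -- column by the size of the original matrix.
    refine PTime.foldl_inv (g := fun _ (s : List (List (ℕ × ℕ)) × List (List (ℕ × ℕ))) (_ : β) =>
      (s.1.map List.tail, (s.1.map fun r => r.headD (0, 1)) :: s.2)) hf (by fun_prop)
      (by fun_prop) (fun x s => sz s.1 ≤ sz (g x)) (fun x => le_rfl)
      (fun x y b _ h => (ht _).trans h) (11 * q + 1) fun x y b _ h => ?_
    have h₁ := ht y.1
    have h₂ := hh y.1
    have h₃ := (hq x).trans (q.eval_nat_mono (Nat.le_add_right _ (sz b)))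
    simp [-List.headD_eq_head?_getD]
    omega
  exact h.snd'.reverse.of_eq fun x => (columns_eq_foldl _ _).symm

@[fun_prop]
theorem pTime_rows {f : α → List (ℕ × ℕ)} {g h : α → List (List (ℕ × ℕ))} (hf : PTime f)
    (hg : PTime g) (hh : PTime h) : PTime fun x => rows (f x) (g x) (h x) := by
  unfold rows
  fun_prop

@[fun_prop]
theorem pTime_mand {f g : α → List Bool} (hf : PTime f) (hg : PTime g) :
    PTime fun x => mand (f x) (g x) := by
  unfold mand
  fun_prop

/-- For fixed `k` the list of masks is a constant built into the program. -/
theorem pTime_dpStep (k : ℕ) {f g : α → List (List Bool × ℕ)} (hf : PTime f) (hg : PTime g) :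
    PTime fun x => dpStep k (f x) (g x) := by
  unfold dpStep
  fun_prop

/-- The running time must be bounded on all inputs, including rows with masks of the wrong length.
Their entries disappear when masks are merged, so only an inequality holds. -/
theorem total_dpStep_le (k : ℕ) (L row : List (List Bool × ℕ)) :
    total (dpStep k L row) (fun _ => 1) ≤ total L (fun _ => 1) * (row.map Prod.snd).sum := by
  have key : ∀ C : List (List Bool × ℕ), total ((masks k).map fun m =>
      (m, (C.map fun c => if decide (c.1 = m) = true then c.2 else 0).sum)) (fun _ => 1) ≤
      total C fun _ => 1 := by
    intro C
    simp only [total, List.map_map, masks, Finset.sum_map_toList, Function.comp_def]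
    induction C with
    | nil => simp
    | cons c C ih =>
      simp only [List.map_cons, List.sum_cons, mul_one, Finset.sum_add_distrib,
        decide_eq_true_eq, Finset.sum_ite_eq] at ih ⊢
      split <;> omega
  refine (key _).trans ?_
  induction L with
  | nil => simp [total]
  | cons s L ih =>
    rw [List.flatMap_cons, total_append]
    simp only [total, List.map_cons, List.sum_cons, add_mul, List.map_map, Function.comp_def,
      mul_one, List.sum_map_mul_left] at ih ⊢
    omega

theorem sz_sum_le (l : List ℕ) : sz l.sum ≤ sz l := by
  induction l with
  | nil => simp [sz_nat]
  | cons w l ih => have := sz_nat_add_le w l.sum; simp; omega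

theorem sz_prod_le (l : List ℕ) : sz l.prod ≤ sz l + 6 := by
  induction l with
  | nil => simp [sz_nat]
  | cons w l ih => have := sz_nat_mul_le w l.prod; simp; omega

theorem sz_rowSums_le (R : List (List (List Bool × ℕ))) :
    sz (R.map fun row => (row.map Prod.snd).sum) ≤ sz R := by
  induction R with
  | nil => simp
  | cons row R ih =>
    have h₁ := sz_sum_le (row.map Prod.snd)
    have h₂ : sz (row.map Prod.snd) ≤ sz row := by
      clear h₁
      induction row with
      | nil => simp
      | cons r row ih => simp; omega
    simp
    omega

-- The state has a bounded number of entries. Each weight is at most the total weight, which is at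
-- most the product of the row sums seen so far, and the bit length of that product is bounded by
-- the size of the input.
@[fun_prop]
theorem pTime_dp (k : ℕ) {f : α → List (List (List Bool × ℕ))} (hf : PTime f) :
    PTime fun x => dp k (f x) := by
  suffices PTime (dp k) from this.comp hf
  refine PTime.foldl (g := fun _ => dpStep k) PTime.id (PTime.const _)
    (pTime_dpStep k (by fun_prop) (by fun_prop))
    (((masks k).length + 1 : ℕ) * (.X + (6 * k + 10 : ℕ)) + 1) fun R l₁ l₂ h => ?_
  have hR : sz l₁ ≤ sz R := by
    have h₀ := sz_append l₁ l₂
    have h₁ := sz_pos l₂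
    rw [← h] at h₀
    omega
  -- The initial state has one entry, and every later state has one entry per mask.
  have h₁ : (l₁.foldl (dpStep k) [(List.replicate k true, 1)]).length ≤ (masks k).length + 1 := by
    rcases List.eq_nil_or_concat l₁ with rfl | ⟨l, row, rfl⟩
    · simp
    · simp [dpStep]
  have h₂ : ∀ s ∈ l₁.foldl (dpStep k) [(List.replicate k true, 1)], s.1.length = k := by
    rcases List.eq_nil_or_concat l₁ with rfl | ⟨l, row, rfl⟩
    · simp
    · rw [List.concat_eq_append, List.foldl_append]
      exact length_of_mem_dpStep
  have h₃ : total (l₁.foldl (dpStep k) [(List.replicate k true, 1)]) (fun _ => 1) ≤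
      (l₁.map fun row => (row.map Prod.snd).sum).prod := by
    clear h hR h₁ h₂
    induction l₁ using List.reverseRecOn with
    | nil => simp [total]
    | append_singleton l row ih =>
      rw [List.foldl_append, List.map_append, List.prod_append]
      exact (total_dpStep_le _ _ _).trans (by simpa using Nat.mul_le_mul_right _ ih)
  have h₄ : ∀ s ∈ l₁.foldl (dpStep k) [(List.replicate k true, 1)],
      sz s ≤ sz R + 6 * k + 9 := by
    intro s hs
    have h₅ : s.2 ≤ total (l₁.foldl (dpStep k) [(List.replicate k true, 1)]) (fun _ => 1) :=
      List.single_le_sum (by simp) _ (List.mem_map.2 ⟨s, hs, mul_one _⟩)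
    have h₆ := (sz_nat_mono (h₅.trans h₃)).trans (sz_prod_le _)
    have h₇ := sz_rowSums_le l₁
    have h₈ := sz_bits s.1
    rw [h₂ s hs] at h₈
    simp
    omega
  refine (sz_le_length_mul h₄).trans ?_
  have := Nat.mul_le_mul_right (sz R + 6 * k + 9 + 1) h₁
  simp [add_assoc] at *
  omega

@[fun_prop]
theorem pTime_minSel {f : α → List ℕ} {g : α → List Bool} (hf : PTime f) (hg : PTime g) :
    PTime fun x => minSel (f x) (g x) := by
  unfold minSel
  refine PTime.foldr_add (g := fun _ (q : Bool × ℕ) (t : ℕ) =>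
    if (q.1 && decide (q.2 ≤ t)) = true then q.2 else t) (by fun_prop) (by fun_prop)
    (by fun_prop) .X fun x y b _ => ?_
  split
  · simp; omega
  · simp

/-- The evaluation of a cover takes polynomial time. -/
@[fun_prop]
theorem pTime_solve (k : ℕ) {a c : α → List (ℕ × ℕ)} {p b : α → List (List (ℕ × ℕ))}
    (ha : PTime a) (hp : PTime p) (hc : PTime c) (hb : PTime b) :
    PTime fun x => solve k (a x) (p x) (c x) (b x) := by
  unfold solve total
  fun_prop

end CoverEval

/-! ### Reading trees as structured data -/

namespace BTree

/-- The list represented by a tree. -/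
def asList : BTree → List BTree
  | leaf => []
  | node l r => l :: asList r

/-- The first component of a pair. -/
def asFst (t : BTree) : BTree := t.asList.headD leaf

/-- The truth value represented by a tree. -/
def asBool (t : BTree) : Bool := !t.asFst.asList.isEmpty

end BTree

namespace StackProgram

variable {α β γ : Type} [Code α] [Code β] [Code γ]

/-- Every tree is a right comb over its left subtrees, so viewing it as a list costs no computation.
-/
theorem toTree_asList (t : BTree) : Code.toTree t.asList = t := by
  induction t with
  | leaf => rfl
  | node l r _ ih => exact congrArg (BTree.node l) ih

theorem asList_toTree (l : List α) : (Code.toTree l).asList = l.map Code.toTree := by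
  induction l with
  | nil => rfl
  | cons a l ih => exact congrArg _ ih

@[simp] theorem sz_toTree (a : α) : sz (Code.toTree a) = sz a := rfl

@[simp] theorem sz_asList (t : BTree) : sz t.asList = sz t := by
  unfold sz
  rw [toTree_asList]
  rfl

/-- The second component of a pair. -/
def asSnd (t : BTree) : BTree := Code.toTree t.asList.tail

@[simp] theorem asFst_toTree (p : α × β) : (Code.toTree p).asFst = Code.toTree p.1 := rfl
@[simp] theorem asSnd_toTree (p : α × β) : asSnd (Code.toTree p) = Code.toTree p.2 :=
  toTree_asList _
@[simp] theorem asBool_toTree (b : Bool) : (Code.toTree b).asBool = b := by cases b <;> rfl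

/-- The list of bits represented by a tree. -/
def asBits (t : BTree) : List Bool := t.asList.map BTree.asBool

/-- The number represented by a tree. -/
def asNat (t : BTree) : ℕ := bitVal (asBits t)

@[simp] theorem asBits_toTree (l : List Bool) : asBits (Code.toTree l) = l := by
  simp [asBits, asList_toTree, Function.comp_def]

@[simp] theorem asNat_toTree (n : ℕ) : asNat (Code.toTree n) = n :=
  (congrArg bitVal (asBits_toTree (encodeNat n))).trans (bitVal_encodeNat n)

/-- The fraction represented by a tree. -/
def asFrac (t : BTree) : ℕ × ℕ := (asNat t.asFst, asNat (asSnd t))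

/-- The list of fractions represented by a tree. -/
def asFracs (t : BTree) : List (ℕ × ℕ) := t.asList.map asFrac

/-- The matrix of fractions represented by a tree. -/
def asMatrix (t : BTree) : List (List (ℕ × ℕ)) := t.asList.map asFracs

@[simp] theorem asFrac_toTree (q : ℕ × ℕ) : asFrac (Code.toTree q) = q := by simp [asFrac]

@[simp] theorem asFracs_toTree (l : List (ℕ × ℕ)) : asFracs (Code.toTree l) = l := by
  simp [asFracs, asList_toTree, Function.comp_def]

@[simp] theorem asMatrix_toTree (l : List (List (ℕ × ℕ))) : asMatrix (Code.toTree l) = l := by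
  simp [asMatrix, asList_toTree, Function.comp_def]

/-- Decode the prefix code of a tree. -/
def decodeTree (u : List Bool) : BTree :=
  (u.foldr (fun b st => if b = true then
    .node (st.headD .leaf) (st.tail.headD .leaf) :: st.tail.tail else .leaf :: st) []).headD .leaf

/-- Read from right to left, a prefix code is evaluated with a stack: a leaf is pushed, and a node
combines the two topmost trees. -/
theorem decodeTree_enc (t : BTree) : decodeTree t.enc = t := by
  suffices ∀ st, t.enc.foldr (fun b st => if b = true then
      BTree.node (st.headD .leaf) (st.tail.headD .leaf) :: st.tail.tail else .leaf :: st) st =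
      t :: st by
    rw [decodeTree, this]; rfl
  induction t with
  | leaf => intro st; rfl
  | node l r ihl ihr =>
    intro st
    rw [BTree.enc, List.foldr_cons, List.foldr_append, ihr, ihl]
    rfl

namespace PTime

@[fun_prop]
theorem toTree {f : α → β} (hf : PTime f) : PTime fun x => Code.toTree (f x) :=
  hf.congr fun _ => rfl

@[fun_prop]
theorem asList {f : α → BTree} (hf : PTime f) : PTime fun x => (f x).asList :=
  hf.congr fun _ => toTree_asList _

@[fun_prop]
theorem node {f g : α → BTree} (hf : PTime f) (hg : PTime g) :
    PTime fun x => BTree.node (f x) (g x) := (hf.pair hg).congr fun _ => rfl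

@[fun_prop]
theorem asFst {f : α → BTree} (hf : PTime f) : PTime fun x => (f x).asFst := by
  unfold BTree.asFst; fun_prop

@[fun_prop]
theorem asSnd {f : α → BTree} (hf : PTime f) : PTime fun x => asSnd (f x) := by
  unfold StackProgram.asSnd; fun_prop

@[fun_prop]
theorem asBool {f : α → BTree} (hf : PTime f) : PTime fun x => (f x).asBool := by
  unfold BTree.asBool; fun_prop

@[fun_prop]
theorem bitVal' {f : α → List Bool} (hf : PTime f) : PTime fun x => StackProgram.bitVal (f x) :=
  bitVal.comp hf

@[fun_prop]
theorem encodeNat' {f : α → ℕ} (hf : PTime f) : PTime fun x => Computability.encodeNat (f x) :=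
  encodeNat.comp hf

@[fun_prop]
theorem asNat {f : α → BTree} (hf : PTime f) : PTime fun x => asNat (f x) := by
  unfold StackProgram.asNat asBits; fun_prop

@[fun_prop]
theorem asFrac {f : α → BTree} (hf : PTime f) : PTime fun x => asFrac (f x) := by
  unfold StackProgram.asFrac; fun_prop

@[fun_prop]
theorem asFracs {f : α → BTree} (hf : PTime f) : PTime fun x => asFracs (f x) := by
  unfold StackProgram.asFracs; fun_prop

@[fun_prop]
theorem asMatrix {f : α → BTree} (hf : PTime f) : PTime fun x => asMatrix (f x) := by
  unfold StackProgram.asMatrix; fun_prop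

@[fun_prop]
theorem decodeTree {f : α → List Bool} (hf : PTime f) : PTime fun x => decodeTree (f x) := by
  unfold StackProgram.decodeTree
  refine headD (foldr_add (g := fun _ (b : Bool) (st : List BTree) => if b = true then
    .node (st.headD .leaf) (st.tail.headD .leaf) :: st.tail.tail else .leaf :: st) hf
    (by fun_prop) (by fun_prop) 10 fun x y b _ => ?_) (by fun_prop)
  have h (l r : BTree) : sz (BTree.node l r) = 1 + sz l + sz r := rfl
  have h₀ : sz BTree.leaf = 1 := rfl
  cases b
  · simp [h₀]; omega
  · rcases y with _ | ⟨a, _ | ⟨b, y⟩⟩ <;> simp [h, h₀] <;> omega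

end PTime

/-! ### Words over the alphabet of the encodings -/

/-- A numbering of the alphabet. -/
noncomputable def symEquiv : Γ' ≃ Fin 6 := Fintype.equivFinOfCardEq rfl

noncomputable instance : Code Γ' := ⟨fun g => Code.toTree (symEquiv g)⟩

namespace PTime

@[fun_prop]
theorem symEquiv {f : α → Γ'} (hf : PTime f) : PTime fun x => symEquiv (f x) :=
  hf.congr fun _ => rfl

theorem symCases {a : α → Γ'} {h : Γ' → α → β} (ha : PTime a) (hh : ∀ g, PTime (h g)) :
    PTime fun x => h (a x) x :=
  (finCases' (h := fun j => h (StackProgram.symEquiv.symm j)) ha.symEquiv fun j => hh _).of_eq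
    fun x => by simp

@[fun_prop]
theorem wordEq {f g : α → List Γ'} (hf : PTime f) (hg : PTime g) :
    PTime fun x => decide (f x = g x) := by
  refine listEq ?_ hf hg
  have : PTime fun p : Fin 6 × Fin 6 => decide (p.1 = p.2) :=
    finCases (h := fun i j => decide (i = j)) fun i => ofFin _
  exact (this.comp (g := fun p : Γ' × Γ' => (StackProgram.symEquiv p.1, StackProgram.symEquiv p.2))
    (by fun_prop)).of_eq fun p => by simp

@[fun_prop]
theorem bit {f : α → Bool} (hf : PTime f) : PTime fun x => Γ'.bit (f x) :=
  (ite hf (const (Γ'.bit true)) (const (Γ'.bit false))).of_eq fun x => by cases f x <;> rfl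

@[fun_prop]
theorem encNat {f : α → ℕ} (hf : PTime f) : PTime fun x => ParetoCover.encNat (f x) := by
  unfold ParetoCover.encNat; fun_prop

end PTime

/-- The code of a nonnegative fraction. -/
def encFrac (q : ℕ × ℕ) : List Γ' :=
  Γ'.bit false :: (ParetoCover.encNat q.1 ++ ParetoCover.encNat q.2)

/-- The code of a list. -/
def encList {τ : Type} (e : τ → List Γ') (l : List τ) : List Γ' :=
  Γ'.bra :: (l.flatMap e ++ [Γ'.ket])

@[fun_prop]
theorem PTime.encFrac {f : α → ℕ × ℕ} (hf : PTime f) : PTime fun x => encFrac (f x) := by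
  unfold StackProgram.encFrac; fun_prop

@[fun_prop]
theorem PTime.encList {f : α → List β} {e : β → List Γ'} (hf : PTime f) (he : PTime e) :
    PTime fun x => encList e (f x) := by
  unfold StackProgram.encList; fun_prop

/-- A bit is one letter of the word and has size six in the tree; sign and delimiters pay for the
rest. Such estimates bound certificates by the length of the word. -/
theorem sz_frac_lt (q : ℕ × ℕ) : sz q < 6 * (encFrac q).length := by
  have h (n : ℕ) : sz n = 6 * (encodeNat n).length + 1 := sz_bits _
  simp [encFrac, ParetoCover.encNat, h]
  omega

theorem sz_list_lt {e : β → List Γ'} (h : ∀ x, sz x < 6 * (e x).length) (l : List β) :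
    sz l < 6 * (encList e l).length := by
  induction l with
  | nil => simp [encList]
  | cons x l ih =>
    have := h x
    simp [encList] at *
    omega

/-! ### Parsing -/

/-- One step of the parser, which reads words from right to left. The stack holds the lists that
have not been completed yet, and a number is the list of its bits. -/
def parseStep : Γ' → List (List BTree) → List (List BTree)
  | .blank, _ => []
  | .bit b, st => (Code.toTree (Code.toTree b :: ((st.headD []).headD .leaf).asList) ::
      (st.headD []).tail) :: st.tail
  | .bra, st => (Code.toTree (st.headD []) :: st.tail.headD []) :: st.tail.tail
  | .ket, st => [] :: st
  | .comma, st => (.leaf :: st.headD []) :: st.tail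

/-- The list of the items of a word. -/
def parse (w : List Γ') : List BTree := (w.foldr parseStep [[]]).headD []

@[fun_prop]
theorem PTime.parse {f : α → List Γ'} (hf : PTime f) : PTime fun x => parse (f x) := by
  unfold StackProgram.parse
  refine headD (foldr_add (g := fun _ => parseStep) hf (by fun_prop) ?_ 20
    fun x y b _ => ?_) (by fun_prop)
  · refine symCases (h := fun g (p : (α × List (List BTree)) × Γ') => parseStep g p.1.2)
      (by fun_prop) fun g => ?_
    cases g <;> unfold parseStep <;> fun_prop
  · have h₀ : sz BTree.leaf = 1 := rfl
    cases b
    · simp [parseStep]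
    · rcases y with _ | ⟨_ | ⟨t, y⟩, z⟩ <;> simp [parseStep, BTree.asList] <;> omega
    · rcases y with _ | ⟨y, _ | ⟨y', z⟩⟩ <;> simp [parseStep] <;> omega
    · simp [parseStep]; omega
    · rcases y with _ | ⟨y, z⟩
      · simp [parseStep, h₀]
      · simp [parseStep, h₀]; omega

theorem foldr_parseStep_bits (l : List Bool) (s : List Bool) (cur : List BTree)
    (rest : List (List BTree)) :
    (l.map Γ'.bit).foldr parseStep ((Code.toTree s :: cur) :: rest) =
      (Code.toTree (l ++ s) :: cur) :: rest := by
  induction l with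
  | nil => rfl
  | cons b l ih =>
    rw [List.map_cons, List.foldr_cons, ih]
    simp only [parseStep, List.headD_cons, List.tail_cons, toTree_asList, List.cons_append,
      toTree_cons]
    rfl

theorem foldr_parseStep_encNat (n : ℕ) (cur : List BTree) (rest : List (List BTree)) :
    (ParetoCover.encNat n).foldr parseStep (cur :: rest) = (Code.toTree n :: cur) :: rest := by
  rw [ParetoCover.encNat, List.foldr_append]
  refine (foldr_parseStep_bits _ [] cur rest).trans ?_
  rw [List.append_nil]
  rfl

/-- The items of the code of a fraction. -/
def fracItems (q : ℕ × ℕ) : List BTree :=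
  [Code.toTree (false :: encodeNat q.1), Code.toTree q.2]

/-- No delimiter separates the sign bit from the numerator, so it becomes the first bit of that
item. `joinItems` removes it with `tail`. -/
theorem foldr_parseStep_encFrac (q : ℕ × ℕ) (cur : List BTree) (rest : List (List BTree)) :
    (encFrac q).foldr parseStep (cur :: rest) = (fracItems q ++ cur) :: rest := by
  rw [encFrac, List.foldr_cons, List.foldr_append, foldr_parseStep_encNat, foldr_parseStep_encNat]
  exact foldr_parseStep_bits [false] (encodeNat q.1) _ rest

/-- From right to left, `ket` opens a list and `bra` closes it. The conclusion has the form of the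
hypothesis `h`, with a single item, so the lemma can be iterated for matrices. -/
theorem foldr_parseStep_encList {τ : Type} {e : τ → List Γ'} {items : τ → List BTree}
    (h : ∀ x cur rest, (e x).foldr parseStep (cur :: rest) = (items x ++ cur) :: rest)
    (l : List τ) (cur : List BTree) (rest : List (List BTree)) :
    (encList e l).foldr parseStep (cur :: rest) =
      ([Code.toTree (l.flatMap items)] ++ cur) :: rest := by
  have key : (l.flatMap e).foldr parseStep ([] :: cur :: rest) =
      l.flatMap items :: cur :: rest := by
    induction l with
    | nil => rfl
    | cons x l ih => rw [List.flatMap_cons, List.foldr_append, ih, h]; rfl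
  rw [encList, List.foldr_cons, List.foldr_append]
  change parseStep .bra ((l.flatMap e).foldr parseStep ([] :: cur :: rest)) = _
  rw [key]
  rfl

theorem sz_bitVal_le (u : List Bool) : sz (bitVal u) ≤ sz u := by
  have h : sz (bitVal u) = sz (encodeNat (bitVal u)) := rfl
  rw [h, encodeNat_bitVal, sz_bits, sz_bits]
  have : (trim u).length ≤ u.length := by
    clear h
    induction u with
    | nil => simp [trim]
    | cons b u ih =>
      simp only [trim, List.foldr_cons] at *
      split
      · simp
      · simpa using ih
  omega

theorem sz_asBits_le (t : BTree) : sz (asBits t) ≤ 6 * sz t := by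
  have := length_lt_sz t.asList
  rw [sz_asList] at this
  rw [sz_bits, asBits, List.length_map]
  omega

/-- Join the items of a list of fractions. -/
def joinItems (l : List BTree) : List (ℕ × ℕ) :=
  (l.foldr (fun t (s : List ℕ × List (ℕ × ℕ)) =>
    lcase s.1 ([asNat t], s.2) fun d _ => ([], (bitVal (asBits t).tail, d) :: s.2)) ([], [])).2

/-- From the right, the denominator of a fraction comes first; the first component of the state
holds it until the numerator arrives. -/
theorem joinItems_flatMap (l : List (ℕ × ℕ)) : joinItems (l.flatMap fracItems) = l := by
  suffices (l.flatMap fracItems).foldr (fun t (s : List ℕ × List (ℕ × ℕ)) =>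
      lcase s.1 ([asNat t], s.2) fun d _ => ([], (bitVal (asBits t).tail, d) :: s.2)) ([], []) =
      ([], l) by rw [joinItems, this]
  induction l with
  | nil => rfl
  | cons q l ih => rw [List.flatMap_cons, List.foldr_append, ih]; simp [fracItems]

@[fun_prop]
theorem PTime.joinItems {f : α → List BTree} (hf : PTime f) : PTime fun x => joinItems (f x) := by
  unfold StackProgram.joinItems
  refine snd' (foldr_add (g := fun _ (t : BTree) (s : List ℕ × List (ℕ × ℕ)) =>
    StackProgram.lcase s.1 ([StackProgram.asNat t], s.2) fun d _ =>
      ([], (StackProgram.bitVal (asBits t).tail, d) :: s.2)) hf (by fun_prop)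
    (lcase (by fun_prop) (by fun_prop) (by unfold asBits; fun_prop)) (20 * .X + 20) fun x s t _ => ?_)
  have h₁ := sz_asBits_le t
  have h₂ := sz_bitVal_le (asBits t)
  have h₃ := sz_bitVal_le (asBits t).tail
  have h₄ : sz (asBits t).tail ≤ sz (asBits t) := by
    rw [sz_bits, sz_bits, List.length_tail]; omega
  obtain ⟨_ | ⟨d, s⟩, l⟩ := s
  · simp [StackProgram.lcase, StackProgram.asNat]; omega
  · simp [StackProgram.lcase]; omega

end StackProgram

/-! ### Instances as lists of fractions -/

namespace CoverEval

open ParetoCover StackProgram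

/-- Numerator and denominator of a nonnegative fraction. -/
def fq (q : Fraction) : ℕ × ℕ := (q.num.natAbs, q.den)

theorem num_nonneg {q : Fraction} (h : 0 ≤ q.val) : 0 ≤ q.num := by
  have hd : (0 : ℝ) < q.den := by exact_mod_cast q.den_pos
  by_contra! hn
  exact h.not_gt (div_neg_of_neg_of_pos (by exact_mod_cast hn) hd)

theorem fv_fq {q : Fraction} (h : 0 ≤ q.val) : fv (fq q) = q.val := by
  have : ((q.num.natAbs : ℤ) : ℝ) = q.num := by rw [Int.natAbs_of_nonneg (num_nonneg h)]
  rw [fv, Fraction.val, fq, ← this]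
  simp

theorem encFraction_eq {q : Fraction} (h : 0 ≤ q.val) : encFraction q = encFrac (fq q) := by
  have : decide (q.num < 0) = false := by simpa using num_nonneg h
  simp [encFraction, encInt, encFrac, fq, this]

theorem encFamily_eq {α τ : Type} {m : ℕ} {e : α → List Γ'} {e' : τ → List Γ'} {v : Fin m → α}
    {v' : Fin m → τ} (h : ∀ i, e (v i) = e' (v' i)) :
    encFamily e v = encList e' (List.ofFn v') := by
  have : (List.ofFn v).map e = (List.ofFn v').map e' := by
    rw [List.map_ofFn, List.map_ofFn]
    exact congrArg _ (funext h)
  rw [encFamily, encList, List.flatMap_def, List.flatMap_def, this]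

/-- The fraction with given numerator and denominator. -/
def toFraction (q : ℕ × ℕ) (h : 0 < q.2) : Fraction := ⟨q.1, q.2, h⟩

@[simp] theorem fq_toFraction (q : ℕ × ℕ) (h : 0 < q.2) : fq (toFraction q h) = q := rfl

@[simp] theorem val_toFraction (q : ℕ × ℕ) (h : 0 < q.2) : (toFraction q h).val = fv q := by
  simp [toFraction, Fraction.val, fv]

/-- The code of a matrix. -/
abbrev encMatrix : List (List (ℕ × ℕ)) → List Γ' := encList (encList encFrac)

theorem encFamily_fraction {m : ℕ} {v : Fin m → Fraction} (h : ∀ i, 0 ≤ (v i).val) :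
    encFamily encFraction v = encList encFrac (List.ofFn fun i => fq (v i)) :=
  encFamily_eq fun i => encFraction_eq (h i)

theorem encFamily_family {m m' : ℕ} {v : Fin m → Fin m' → Fraction} (h : ∀ i j, 0 ≤ (v i j).val) :
    encFamily (encFamily encFraction) v =
      encMatrix (List.ofFn fun i => List.ofFn fun j => fq (v i j)) :=
  encFamily_eq fun i => encFamily_fraction (h i)

section DiscreteInstance

variable (I : DiscreteInstance)

theorem a_nonneg (j : Fin (I.M + 2)) : 0 ≤ (I.a j).val :=
  I.a_zero.symm.le.trans (I.a_strictMono.monotone (Fin.zero_le j))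

theorem p_nonneg (i : Fin I.n) (j : Fin (I.M + 2)) : 0 ≤ (I.p i j).val := (I.p_mem i j).1

theorem encDiscrete_eq : encDiscrete I = encList encFrac (List.ofFn fun j => fq (I.a j)) ++
    encMatrix (List.ofFn fun i => List.ofFn fun j => fq (I.p i j)) ++
    encList encFrac (List.ofFn fun i => fq (I.c i)) := by
  rw [encDiscrete, encFamily_fraction (a_nonneg I), encFamily_family (p_nonneg I),
    encFamily_fraction I.c_nonneg]

theorem fv_a : (fun j => fv (fq (I.a j))) = fun j => (I.a j).val :=
  funext fun j => fv_fq (a_nonneg I j)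

theorem fv_p : (fun i j => fv (fq (I.p i j))) = fun i j => (I.p i j).val :=
  funext fun i => funext fun j => fv_fq (p_nonneg I i j)

theorem fv_c : (fun i => fv (fq (I.c i))) = I.cost := funext fun i => fv_fq (I.c_nonneg i)

theorem measure_eq :
    I.measure = discreteMeasure (fun j => fv (fq (I.a j))) fun i j => fv (fq (I.p i j)) := by
  rw [fv_a, fv_p]; rfl

theorem sum_fv_p (i : Fin I.n) : ∑ j, fv (fq (I.p i j)) = 1 := by
  rw [← I.p_sum i]
  exact Finset.sum_congr rfl fun j _ => fv_fq (p_nonneg I i j)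

end DiscreteInstance

/-! ### Computing the expected cost -/

section CoverInstance

variable {k : ℕ} (I : CoverInstance k)

theorem b_nonneg (l : Fin k) (i : Fin I.n) : 0 ≤ (I.b l i).val := by
  obtain ⟨j, hj⟩ := I.b_grid l i
  rw [hj]
  exact a_nonneg _ j

/-- The result of the evaluation of the cover of an instance. -/
noncomputable def evaluate : ℕ × (ℕ × ℕ) :=
  solveFn (fun j => fq (I.a j)) (fun i j => fq (I.p i j)) (fun i => fq (I.c i))
    fun l i => fq (I.b l i)

theorem cover_eq : I.cover = Set.range fun l i => fv (fq (I.b l i)) := by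
  simp only [CoverInstance.cover, fv_fq (b_nonneg I _ _)]

theorem evaluate_spec : 0 < (evaluate I).2.2 ∧
    expectedCost I.measure I.cost I.cover = ENNReal.ofReal (fv (evaluate I).2) := by
  have h := I.b_cover
  change IsParetoCover _ I.cover at h
  rw [cover_eq, measure_eq, isParetoCover_iff (fun j => (I.a j).den_pos)
    (fun i j => (I.p i j).den_pos) (sum_fv_p I.toDiscreteInstance)
    (fun l i => (I.b l i).den_pos)] at h
  rw [cover_eq, measure_eq, ← fv_c]
  exact expectedCost_eq (fun j => (I.a j).den_pos) (fun i j => (I.p i j).den_pos)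
    (sum_fv_p I.toDiscreteInstance) (fun i => (I.c i).den_pos) (fun l i => (I.b l i).den_pos) h

/-- The list of fractions at the beginning of a list of items. -/
def readFracs (L : List BTree) : List (ℕ × ℕ) := joinItems (L.headD .leaf).asList

/-- The matrix of fractions at the beginning of a list of items. -/
def readMatrix (L : List BTree) : List (List (ℕ × ℕ)) :=
  (L.headD .leaf).asList.map fun t => joinItems t.asList

theorem asList_toTree_self (l : List BTree) : (Code.toTree l).asList = l :=
  (asList_toTree l).trans l.map_id

@[simp] theorem readFracs_cons (l : List (ℕ × ℕ)) (L : List BTree) :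
    readFracs (Code.toTree (l.flatMap fracItems) :: L) = l := by
  rw [readFracs, List.headD_cons, asList_toTree_self, joinItems_flatMap]

@[simp] theorem readMatrix_cons (l : List (List (ℕ × ℕ))) (L : List BTree) :
    readMatrix (Code.toTree (l.flatMap fun r => [Code.toTree (r.flatMap fracItems)]) :: L) = l := by
  rw [readMatrix, List.headD_cons, asList_toTree_self]
  simp [List.map_flatMap, asList_toTree_self, joinItems_flatMap]

/-- The evaluation algorithm for words. -/
noncomputable def evalWord (k : ℕ) (w : List Γ') : List Γ' :=
  encFrac (solve k (readFracs (parse w)) (readMatrix (parse w).tail)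
    (readFracs (parse w).tail.tail) (readMatrix (parse w).tail.tail.tail)).2

theorem pTime_evalWord (k : ℕ) : PTime (evalWord k) := by
  unfold evalWord readFracs readMatrix
  exact (pTime_solve k (by fun_prop) (by fun_prop) (by fun_prop) (by fun_prop)).snd'.encFrac

theorem evalWord_encCover : evalWord k (encCover I) = encFrac (evaluate I).2 := by
  have h : parse (encCover I) =
      [Code.toTree ((List.ofFn fun j => fq (I.a j)).flatMap fracItems),
        Code.toTree ((List.ofFn fun i => List.ofFn fun j => fq (I.p i j)).flatMap
          fun r => [Code.toTree (r.flatMap fracItems)]),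
        Code.toTree ((List.ofFn fun i => fq (I.c i)).flatMap fracItems),
        Code.toTree ((List.ofFn fun l => List.ofFn fun i => fq (I.b l i)).flatMap
          fun r => [Code.toTree (r.flatMap fracItems)])] := by
    rw [encCover, encDiscrete_eq, encFamily_family (b_nonneg I), parse, List.foldr_append,
      List.foldr_append, List.foldr_append]
    have h₁ := foldr_parseStep_encList foldr_parseStep_encFrac
    have h₂ := foldr_parseStep_encList h₁
    rw [h₂, h₁, h₂, h₁]
    rfl
  rw [evalWord, h]
  simp only [List.tail_cons, readFracs_cons, readMatrix_cons]
  rfl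

/-- The expected cost of a cover can be computed in polynomial time. -/
theorem exists_polyTime_expectedCost (k : ℕ) : ∃ f : CoverInstance k → Fraction,
    PolyTime encCover encFraction f ∧ ∀ I : CoverInstance k,
      ((expectedCost I.measure I.cost I.cover : ENNReal) : EReal) = ((f I).val : EReal) := by
  refine ⟨fun I => toFraction (evaluate I).2 (evaluate_spec I).1, ?_, fun I => ?_⟩
  · refine polyTime_of_pTime symEquiv symEquiv (F := fun l =>
      (evalWord k (l.map symEquiv.symm)).map symEquiv) ?_ fun I => ?_
    · have h₁ : PTime symEquiv.symm := PTime.ofFin _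
      have h₂ := (pTime_evalWord k).comp (g := fun l : List (Fin 6) => l.map symEquiv.symm)
        (PTime.map PTime.id (h₁.comp PTime.snd))
      exact PTime.map h₂ (PTime.symEquiv PTime.snd)
    · rw [List.map_map, Equiv.symm_comp_self, List.map_id, evalWord_encCover,
        encFraction_eq (by rw [val_toFraction]; exact fv_nonneg _), fq_toFraction]
  · rw [(evaluate_spec I).2, val_toFraction, EReal.coe_ennreal_ofReal, max_eq_left (fv_nonneg _)]

end CoverInstance

end CoverEval

/-! ### Cheap covers by grid points -/

namespace ParetoCover

open CoverEval

theorem IsParetoCover.mono {n : ℕ} {μ : Measure (Fin n → ℝ)} (hμ : μ Set.univ ≤ 1)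
    {B B' : Set (Fin n → ℝ)} (hB : B ⊆ B') (h : IsParetoCover μ B) : IsParetoCover μ B' :=
  le_antisymm ((measure_mono (Set.subset_univ _)).trans hμ) <|
    h.ge.trans <| measure_mono fun _ ⟨b, hb, hx⟩ => ⟨b, hB hb, hx⟩

theorem expectedCost_anti {n : ℕ} (μ : Measure (Fin n → ℝ)) (c : Fin n → ℝ)
    {B B' : Set (Fin n → ℝ)} (hB : B ⊆ B') : expectedCost μ c B' ≤ expectedCost μ c B :=
  lintegral_mono fun _ => biInf_mono hB

theorem coe_le_coe_iff (x : ℝ≥0∞) (γ : ℝ) :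
    (x : EReal) ≤ (γ : EReal) ↔ 0 ≤ γ ∧ x ≤ ENNReal.ofReal γ := by
  constructor
  · intro h
    have h₀ : 0 ≤ γ := EReal.coe_nonneg.1 ((EReal.coe_ennreal_nonneg x).trans h)
    rw [← max_eq_left h₀, ← EReal.coe_ennreal_ofReal] at h
    exact ⟨h₀, EReal.coe_ennreal_le_coe_ennreal_iff.1 h⟩
  · rintro ⟨h₀, h⟩
    rw [← max_eq_left h₀, ← EReal.coe_ennreal_ofReal]
    exact EReal.coe_ennreal_le_coe_ennreal_iff.2 h

/-- Covers given by a family with repetitions can be completed to covers with `k` points. -/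
theorem hasCheapCover_of_family {n k : ℕ} {μ : Measure (Fin n → ℝ)} (hμ : μ Set.univ ≤ 1)
    {c : Fin n → ℝ} {γ : ℝ} (hγ : 0 ≤ γ) (hk : 1 ≤ k) (hn : n ≠ 0 ∨ k = 1)
    {y : Fin k → Fin n → ℝ} (hy : ∀ l, y l ∈ Set.Icc 0 1) (hcov : IsParetoCover μ (Set.range y))
    (hcost : expectedCost μ c (Set.range y) ≤ ENNReal.ofReal γ) : HasCheapCover k μ c γ := by
  suffices ∃ t : Set (Fin n → ℝ), Set.range y ⊆ t ∧ t ⊆ Set.Icc 0 1 ∧ t.ncard = k by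
    obtain ⟨t, h₁, h₂, h₃⟩ := this
    have hfin : t.Finite := Set.finite_of_ncard_ne_zero (by omega)
    refine ⟨hfin.toFinset, fun b hb => h₂ (by simpa using hb), ?_, ?_, ?_⟩
    · rw [← h₃, Set.ncard_eq_toFinset_card t hfin]
    · rw [hfin.coe_toFinset]
      exact hcov.mono hμ h₁
    · rw [hfin.coe_toFinset, coe_le_coe_iff]
      exact ⟨hγ, (expectedCost_anti μ c h₁).trans hcost⟩
  have hsub : Set.range y ⊆ Set.Icc 0 1 := Set.range_subset_iff.2 hy
  have hcard : (Set.range y).ncard ≤ k := by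
    rw [← Set.image_univ]
    simpa using Set.ncard_image_le (f := y) Set.finite_univ
  -- In positive dimension the cube contains the infinite diagonal, so the range can be enlarged to
  -- exactly `k` points. For `k = 1` the range already is a single point.
  rcases hn with hn | rfl
  · refine Set.Infinite.exists_superset_ncard_eq ?_ hsub (Set.finite_range y) hcard
    have : Nonempty (Fin n) := ⟨⟨0, Nat.pos_of_ne_zero hn⟩⟩
    have hlt : (0 : Fin n → ℝ) < 1 := zero_lt_one
    refine Set.infinite_of_injOn_mapsTo (s := Set.Icc (0 : ℝ) 1) (f := fun t _ => t)
      (fun s _ t _ h => congrFun h ⟨0, Nat.pos_of_ne_zero hn⟩)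
      (fun t ht => ⟨fun _ => ht.1, fun _ => ht.2⟩) (Set.Icc_infinite zero_lt_one)
  · refine ⟨_, subset_rfl, hsub, ?_⟩
    rw [Set.range_unique, Set.ncard_singleton]

/-- Rounding down to grid points turns cheap covers into cheap covers. -/
theorem HasCheapCover.exists_grid {n M k : ℕ} {a : Fin (M + 2) → ℝ} (ha : a 0 = 0)
    {p : Fin n → Fin (M + 2) → ℝ} {c : Fin n → ℝ} (hc : ∀ i, 0 ≤ c i) {γ : ℝ} (hk : 1 ≤ k)
    (h : HasCheapCover k (discreteMeasure a p) c γ) :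
    0 ≤ γ ∧ (n ≠ 0 ∨ k = 1) ∧ ∃ g : Fin k → Fin n → Fin (M + 2),
      IsParetoCover (discreteMeasure a p) (Set.range fun l i => a (g l i)) ∧
      expectedCost (discreteMeasure a p) c (Set.range fun l i => a (g l i)) ≤
        ENNReal.ofReal γ := by
  obtain ⟨B, hB, hcard, hcov, hcost⟩ := h
  rw [coe_le_coe_iff] at hcost
  refine ⟨hcost.1, ?_, ?_⟩
  -- In dimension zero the cube is a single point, so it has no subset with two or more points.
  · by_contra! hn
    obtain ⟨rfl, hn⟩ := hn
    have := Finset.card_le_one_of_subsingleton B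
    omega
  let e : Fin k ≃ B := (B.equivFinOfCardEq hcard).symm
  have hrange : (B : Set (Fin n → ℝ)) = Set.range fun l => (e l : Fin n → ℝ) := by
    rw [Set.range_comp' Subtype.val e, e.range_eq_univ, Set.image_univ, Subtype.range_coe]
  -- Each coordinate is rounded down to the largest grid value not exceeding it; `a 0 = 0`
  -- guarantees that there is one.
  have hround : ∀ l i, ∃ j, a j ≤ (e l : Fin n → ℝ) i ∧
      ∀ j', a j' ≤ (e l : Fin n → ℝ) i → a j' ≤ a j := by
    intro l i
    obtain ⟨j, hj, hmax⟩ := Finset.exists_max_image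
      (Finset.univ.filter fun j => a j ≤ (e l : Fin n → ℝ) i) a
      ⟨0, by simpa [ha] using (hB _ (e l).2).1 i⟩
    exact ⟨j, by simpa using hj, fun j' hj' => hmax j' (by simpa using hj')⟩
  choose g hg hg' using hround
  -- Grid points cannot distinguish a point from its rounding, so coverage is unchanged; since `c`
  -- is nonnegative, the costs can only drop.
  have hle (x : Fin n → Fin (M + 2)) (l : Fin k) :
      ((fun i => a (x i)) ≤ fun i => a (g l i)) ↔ (fun i => a (x i)) ≤ (e l : Fin n → ℝ) :=
    ⟨fun h i => (h i).trans (hg l i), fun h i => hg' l i _ (h i)⟩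
  classical
  refine ⟨g, ?_, ?_⟩
  · rw [IsParetoCover, ← hcov, hrange, discreteMeasure_apply, discreteMeasure_apply]
    simp only [Set.indicator_apply, Set.mem_ofPred_eq, Set.exists_range_iff, hle]
  · refine le_trans ?_ hcost.2
    rw [hrange, expectedCost, expectedCost, lintegral_discreteMeasure, lintegral_discreteMeasure]
    refine Finset.sum_le_sum fun x _ => mul_le_mul_right ?_ _
    rw [coverCost_range, coverCost_range]
    refine iInf_mono fun l => ?_
    simp only [hle]
    exact iInf_mono fun _ => ENNReal.ofReal_le_ofReal <|
      Finset.sum_le_sum fun i _ => mul_le_mul_of_nonneg_left (hg l i) (hc i)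

end ParetoCover

namespace CoverEval

open ParetoCover StackProgram

/-! ### Checking certificates -/

/-- A test for the data of discrete instances. -/
def validDisc (a : List (ℕ × ℕ)) (p : List (List (ℕ × ℕ))) (c : List (ℕ × ℕ)) : Bool :=
  decide (2 ≤ a.length) && a.all (fun q => decide (0 < q.2)) &&
  decide ((a.headD (0, 1)).1 = 0) &&
  decide ((a.reverse.headD (0, 1)).1 = (a.reverse.headD (0, 1)).2) &&
  (a.zip a.tail).all (fun q => !fle q.2 q.1) &&
  decide (p.length = c.length) &&
  p.all (fun r => decide (r.length = a.length) && r.all (fun q => decide (0 < q.2)) &&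
    decide ((clearDen r).1.sum = (clearDen r).2)) &&
  c.all fun q => decide (0 < q.2)

/-- A test for covers of size `k` and cost at most `γ`. -/
noncomputable def check (k : ℕ) (a : List (ℕ × ℕ)) (p : List (List (ℕ × ℕ))) (c : List (ℕ × ℕ))
    (γ : ℕ × ℕ) (b : List (List (ℕ × ℕ))) : Bool :=
  validDisc a p c && decide (0 < γ.2) && decide (b.length = k) &&
  b.all (fun r => decide (r.length = c.length) &&
    r.all fun q => decide (0 < q.2) && decide (q.1 ≤ q.2)) &&
  -- In dimension zero only `k = 1` is possible. Distinctness of the points is not tested, since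
  -- repetitions can be replaced by further points.
  (!decide (c.length = 0) || decide (k = 1)) &&
  decide ((solve k a p c b).1 = 0) && fle (solve k a p c b).2 γ

@[fun_prop]
theorem pTime_validDisc {α : Type} [Code α] {a c : α → List (ℕ × ℕ)} {p : α → List (List (ℕ × ℕ))}
    (ha : PTime a) (hp : PTime p) (hc : PTime c) :
    PTime fun x => validDisc (a x) (p x) (c x) := by
  unfold validDisc; fun_prop

@[fun_prop]
theorem pTime_check (k : ℕ) {α : Type} [Code α] {a c : α → List (ℕ × ℕ)}
    {p b : α → List (List (ℕ × ℕ))} {γ : α → ℕ × ℕ} (ha : PTime a) (hp : PTime p) (hc : PTime c)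
    (hγ : PTime γ) (hb : PTime b) : PTime fun x => check k (a x) (p x) (c x) (γ x) (b x) := by
  have h := pTime_solve k ha hp hc hb
  have h₁ := h.fst'
  have h₂ := pTime_fle h.snd' hγ
  have h₃ := h₁.natEq (.const 0)
  unfold check
  refine PTime.and (PTime.and ?_ h₃) h₂
  fun_prop

/-- The properties of the data of discrete instances. -/
structure Valid {n M : ℕ} (a : Fin (M + 2) → ℕ × ℕ) (p : Fin n → Fin (M + 2) → ℕ × ℕ)
    (c : Fin n → ℕ × ℕ) : Prop where
  a_pos : ∀ j, 0 < (a j).2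
  p_pos : ∀ i j, 0 < (p i j).2
  c_pos : ∀ i, 0 < (c i).2
  a_zero : fv (a 0) = 0
  a_last : fv (a (Fin.last (M + 1))) = 1
  a_strictMono : StrictMono fun j => fv (a j)
  p_sum : ∀ i, ∑ j, fv (p i j) = 1

theorem all_ofFn {τ : Type} {m : ℕ} (v : Fin m → τ) (P : τ → Bool) :
    (List.ofFn v).all P = true ↔ ∀ i, P (v i) = true := by
  simp [List.all_eq_true, List.mem_ofFn]

theorem zip_tail_ofFn {τ : Type} {m : ℕ} (v : Fin (m + 1) → τ) :
    (List.ofFn v).zip (List.ofFn v).tail =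
      List.ofFn fun j : Fin m => (v j.castSucc, v j.succ) := by
  rw [List.ofFn_succ, List.tail_cons]
  apply List.ext_getElem
  · simp
  · intro j h₁ h₂
    rcases j with _ | j
    · simp
    · simp

theorem fv_eq_zero_iff {q : ℕ × ℕ} (h : 0 < q.2) : fv q = 0 ↔ q.1 = 0 := by
  have : (q.2 : ℝ) ≠ 0 := by exact_mod_cast h.ne'
  simp [fv, this]

theorem fv_eq_one_iff {q : ℕ × ℕ} (h : 0 < q.2) : fv q = 1 ↔ q.1 = q.2 := by
  have : (q.2 : ℝ) ≠ 0 := by exact_mod_cast h.ne'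
  rw [fv, div_eq_one_iff_eq this]
  exact_mod_cast Iff.rfl

theorem fv_le_one_iff {q : ℕ × ℕ} (h : 0 < q.2) : fv q ≤ 1 ↔ q.1 ≤ q.2 := by
  rw [fv, div_le_one (by exact_mod_cast h)]
  exact_mod_cast Iff.rfl

theorem clearDen_sum_iff {m : ℕ} {v : Fin m → ℕ × ℕ} (h : ∀ j, 0 < (v j).2) :
    (clearDen (List.ofFn v)).1.sum = (clearDen (List.ofFn v)).2 ↔ ∑ j, fv (v j) = 1 := by
  have h₁ := fv_fsum (l := List.ofFn v) (by simpa [List.forall_mem_ofFn_iff] using h)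
  rw [List.map_ofFn, List.sum_ofFn] at h₁
  rw [show ∑ j, fv (v j) = _ from h₁.symm, fv_eq_one_iff (clearDen_ofFn_pos h)]
  rfl

theorem validDisc_iff {n M : ℕ} {a : Fin (M + 2) → ℕ × ℕ} {p : Fin n → Fin (M + 2) → ℕ × ℕ}
    {c : Fin n → ℕ × ℕ} : validDisc (List.ofFn a) (List.ofFn fun i => List.ofFn (p i))
      (List.ofFn c) = true ↔ Valid a p c := by
  have hlast : (List.ofFn a).reverse.headD (0, 1) = a (Fin.last (M + 1)) := by
    rw [List.ofFn_succ', List.concat_eq_append, List.reverse_append]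
    rfl
  have hhead : (List.ofFn a).headD (0, 1) = a 0 := by rw [List.ofFn_succ]; rfl
  simp only [validDisc, Bool.and_eq_true, all_ofFn, zip_tail_ofFn, hlast, hhead, decide_eq_true_iff,
    List.length_ofFn, Nat.le_add_left, true_and, Bool.not_eq_true', and_assoc]
  constructor
  · rintro ⟨h₁, h₂, h₃, h₄, h₅, h₆⟩
    refine ⟨h₁, fun i => (h₅ i).1, h₆, (fv_eq_zero_iff (h₁ _)).2 h₂, (fv_eq_one_iff (h₁ _)).2 h₃,
      Fin.strictMono_iff_lt_succ.2 fun j => ?_, fun i => (clearDen_sum_iff (h₅ i).1).1 (h₅ i).2⟩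
    rw [← not_le, ← fle_iff (h₁ _) (h₁ _), h₄]
    simp
  · intro h
    refine ⟨h.a_pos, (fv_eq_zero_iff (h.a_pos _)).1 h.a_zero,
      (fv_eq_one_iff (h.a_pos _)).1 h.a_last, fun j => ?_, fun i => ⟨h.p_pos i,
        (clearDen_sum_iff (h.p_pos i)).2 (h.p_sum i)⟩, h.c_pos⟩
    rw [← Bool.not_eq_true, fle_iff (h.a_pos _) (h.a_pos _), not_le]
    exact h.a_strictMono j.castSucc_lt_succ

theorem check_iff {n M k : ℕ} {a : Fin (M + 2) → ℕ × ℕ} {p : Fin n → Fin (M + 2) → ℕ × ℕ}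
    {c : Fin n → ℕ × ℕ} {γ : ℕ × ℕ} {b : Fin k → Fin n → ℕ × ℕ} :
    check k (List.ofFn a) (List.ofFn fun i => List.ofFn (p i)) (List.ofFn c) γ
      (List.ofFn fun l => List.ofFn (b l)) = true ↔
    Valid a p c ∧ 0 < γ.2 ∧ (∀ l i, 0 < (b l i).2 ∧ fv (b l i) ≤ 1) ∧ (n ≠ 0 ∨ k = 1) ∧
      IsParetoCover (discreteMeasure (fun j => fv (a j)) fun i j => fv (p i j))
        (Set.range fun l i => fv (b l i)) ∧
      expectedCost (discreteMeasure (fun j => fv (a j)) fun i j => fv (p i j))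
        (fun i => fv (c i)) (Set.range fun l i => fv (b l i)) ≤ ENNReal.ofReal (fv γ) := by
  simp only [check, Bool.and_eq_true, validDisc_iff, all_ofFn, decide_eq_true_iff, and_assoc,
    List.length_ofFn, true_and, Bool.or_eq_true, Bool.not_eq_true', decide_eq_false_iff_not]
  refine and_congr_right fun h => and_congr_right fun hγ => ?_
  have hb' : (∀ l i, 0 < (b l i).2 ∧ (b l i).1 ≤ (b l i).2) ↔
      ∀ l i, 0 < (b l i).2 ∧ fv (b l i) ≤ 1 :=
    forall₂_congr fun l i => and_congr_right fun hq => (fv_le_one_iff hq).symm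
  rw [hb']
  refine and_congr_right fun hb => and_congr_right fun _ => ?_
  rw [isParetoCover_iff h.a_pos h.p_pos h.p_sum fun l i => (hb l i).1]
  -- The computed value is the expected cost only if there is no uncovered mass, so the cost test is
  -- analysed under `hs`.
  refine and_congr_right fun hs => ?_
  obtain ⟨h₁, h₂⟩ := expectedCost_eq h.a_pos h.p_pos h.p_sum h.c_pos (fun l i => (hb l i).1) hs
  rw [h₂, ENNReal.ofReal_le_ofReal_iff (fv_nonneg _), ← fle_iff h₁ hγ]
  rfl

theorem exists_ofFn {τ : Type} (l : List τ) {m : ℕ} (h : l.length = m) :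
    ∃ v : Fin m → τ, l = List.ofFn v := by
  subst h
  exact ⟨l.get, (List.ofFn_get l).symm⟩

theorem exists_ofFn₂ {τ : Type} (l : List (List τ)) {m m' : ℕ} (h : l.length = m)
    (h' : ∀ r ∈ l, r.length = m') :
    ∃ v : Fin m → Fin m' → τ, l = List.ofFn fun i => List.ofFn (v i) := by
  obtain ⟨v, rfl⟩ := exists_ofFn l h
  choose w hw using fun i => exists_ofFn (v i) (h' _ (List.mem_ofFn.2 ⟨i, rfl⟩))
  exact ⟨w, congrArg _ (funext hw)⟩

/-- The length tests turn accepted lists into families over `Fin`, to which `check_iff` applies. -/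
theorem exists_of_check {k : ℕ} {a : List (ℕ × ℕ)} {p : List (List (ℕ × ℕ))} {c : List (ℕ × ℕ)}
    {γ : ℕ × ℕ} {b : List (List (ℕ × ℕ))} (h : check k a p c γ b = true) :
    ∃ (n M : ℕ) (a' : Fin (M + 2) → ℕ × ℕ) (p' : Fin n → Fin (M + 2) → ℕ × ℕ)
      (c' : Fin n → ℕ × ℕ) (b' : Fin k → Fin n → ℕ × ℕ), a = List.ofFn a' ∧
      (p = List.ofFn fun i => List.ofFn (p' i)) ∧ c = List.ofFn c' ∧
      b = List.ofFn fun l => List.ofFn (b' l) := by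
  simp only [check, validDisc, Bool.and_eq_true, decide_eq_true_iff, and_assoc,
    List.all_eq_true] at h
  obtain ⟨h₁, -, -, -, -, h₂, h₃, -, -, h₄, h₅, -⟩ := h
  obtain ⟨M, hM⟩ := Nat.exists_eq_add_of_le' h₁
  obtain ⟨a', ha⟩ := exists_ofFn a hM
  obtain ⟨p', hp⟩ := exists_ofFn₂ p h₂ fun r hr => ((h₃ r hr).1).trans hM
  obtain ⟨c', hc⟩ := exists_ofFn c rfl
  obtain ⟨b', hb⟩ := exists_ofFn₂ b h₄ fun r hr => (h₅ r hr).1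
  exact ⟨_, M, a', p', c', b', ha, hp, hc, hb⟩

end CoverEval

/-! ### Membership in NP -/

namespace StackProgram

open ParetoCover

/-- A numbering of the disjoint union of the alphabets of words and certificates. -/
noncomputable def sumEquiv : Γ' ⊕ Bool ≃ Fin 8 := Fintype.equivFinOfCardEq rfl

/-- A problem is in NP if its yes-instances are the words that have a short certificate `z` with
accepting check, where the word is determined by the certificate. -/
theorem inNP_of_certificate {τ : Type} [Code τ] {D : BTree → τ} (hD : PTime D)
    (hD' : ∀ z, D (Code.toTree z) = z) {W : τ → List Γ'} (hW : PTime W) {C : τ → Bool}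
    (hC : PTime C) (q : Polynomial ℕ) {S : Language Γ'}
    (hS : ∀ z, C z = true → W z ∈ S)
    (hS' : ∀ w ∈ S, ∃ z, W z = w ∧ C z = true ∧ sz z ≤ q.eval w.length) : InNP S := by
  -- The input word is not parsed: it is compared with the word encoded from the certificate, so an
  -- accepted word is automatically well formed.
  let V (x : List Γ' × List Bool) : Bool :=
    decide (W (D (decodeTree x.2)) = x.1) && C (D (decodeTree x.2))
  have hdec (z : τ) : D (decodeTree (Code.toTree z).enc) = z := by rw [decodeTree_enc, hD']
  refine ⟨q, V, ?_, fun w => ⟨fun hw => ?_, ?_⟩⟩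
  · have hV : PTime V := by
      have h : PTime fun x : List Γ' × List Bool => D (decodeTree x.2) := hD.comp (by fun_prop)
      exact (PTime.wordEq (hW.comp h) .fst).and (hC.comp h)
    -- The pair is encoded as one word over the disjoint union of the alphabets. Keeping only the
    -- letters of one summand recovers a component.
    let left (j : Fin 8) : List Γ' := Sum.elim (fun g => [g]) (fun _ => []) (sumEquiv.symm j)
    let right (j : Fin 8) : List Bool := Sum.elim (fun _ => []) (fun b => [b]) (sumEquiv.symm j)
    have hleft : PTime left := PTime.ofFin _
    have hright : PTime right := PTime.ofFin _
    have hout : PTime fun b : Bool => [finTwoEquiv.symm b] :=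
      (PTime.ite PTime.id (.const [1]) (.const [0])).of_eq fun b => by cases b <;> rfl
    refine polyTime_of_pTime sumEquiv finTwoEquiv.symm
      (F := fun l => [finTwoEquiv.symm (V (l.flatMap left, l.flatMap right))])
      (hout.comp (hV.comp (PTime.pair (PTime.flatMap PTime.id (hleft.comp .snd))
        (PTime.flatMap PTime.id (hright.comp .snd))))) fun x => ?_
    obtain ⟨w, u⟩ := x
    have h₁ : ((w.map Sum.inl ++ u.map Sum.inr : List (Γ' ⊕ Bool)).map sumEquiv).flatMap left =
        w := by
      simp [left, List.flatMap_map, List.flatMap_append]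
    have h₂ : ((w.map Sum.inl ++ u.map Sum.inr : List (Γ' ⊕ Bool)).map sumEquiv).flatMap right =
        u := by
      simp [right, List.flatMap_map, List.flatMap_append]
    have h₀ : (encodingProd (encodingList Γ') (encodingList Bool)).encode (w, u) =
        w.map Sum.inl ++ u.map Sum.inr := rfl
    rw [h₀, h₁, h₂]
    rfl
  · obtain ⟨z, rfl, h₁, h₂⟩ := hS' w hw
    refine ⟨(Code.toTree z).enc, (BTree.length_enc _).trans_le h₂, ?_⟩
    simp [V, hdec, h₁]
  · rintro ⟨u, -, hu⟩
    simp only [V, Bool.and_eq_true, decide_eq_true_iff] at hu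
    rw [← hu.1]
    exact hS _ hu.2

end StackProgram

/-! ### Certificates for the discrete and the binary problem -/

namespace CoverEval

open ParetoCover StackProgram

section Valid

variable {n M : ℕ} {a : Fin (M + 2) → ℕ × ℕ} {p : Fin n → Fin (M + 2) → ℕ × ℕ}
  {c : Fin n → ℕ × ℕ}

/-- Nonnegative numbers with sum one are at most one, so `Valid` and the test need no upper bound
for probabilities. -/
theorem Valid.fv_p_le_one (h : Valid a p c) (i : Fin n) (j : Fin (M + 2)) : fv (p i j) ≤ 1 :=
  (Finset.single_le_sum (fun j _ => fv_nonneg (p i j)) (Finset.mem_univ j)).trans_eq (h.p_sum i)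

theorem Valid.measure_univ_le (h : Valid a p c) :
    discreteMeasure (fun j => fv (a j)) (fun i j => fv (p i j)) Set.univ ≤ 1 := by
  rw [discreteMeasure_apply]
  simp [sum_prod_ofReal h.p_pos h.p_sum]

/-- The instance given by valid data. -/
def Valid.toInstance (h : Valid a p c) : DiscreteInstance where
  n := n
  M := M
  a j := toFraction (a j) (h.a_pos j)
  p i j := toFraction (p i j) (h.p_pos i j)
  c i := toFraction (c i) (h.c_pos i)
  a_zero := (val_toFraction _ _).trans h.a_zero
  a_last := (val_toFraction _ _).trans h.a_last
  a_strictMono := by simpa only [val_toFraction] using h.a_strictMono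
  p_mem i j := by simpa only [val_toFraction] using ⟨fv_nonneg _, h.fv_p_le_one i j⟩
  p_sum i := by simpa only [val_toFraction] using h.p_sum i
  c_nonneg i := by simpa only [val_toFraction] using fv_nonneg _

theorem valid_of_instance (I : DiscreteInstance) :
    Valid (fun j => fq (I.a j)) (fun i j => fq (I.p i j)) fun i => fq (I.c i) where
  a_pos j := (I.a j).den_pos
  p_pos i j := (I.p i j).den_pos
  c_pos i := (I.c i).den_pos
  a_zero := (fv_fq (a_nonneg I _)).trans I.a_zero
  a_last := (fv_fq (a_nonneg I _)).trans I.a_last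
  a_strictMono := by rw [fv_a]; exact I.a_strictMono
  p_sum := sum_fv_p I

/-- Accepted data yield cheap covers. -/
theorem hasCheapCover_of_check {k : ℕ} (hk : 1 ≤ k) {γ : ℕ × ℕ} {b : Fin k → Fin n → ℕ × ℕ}
    (h : check k (List.ofFn a) (List.ofFn fun i => List.ofFn (p i)) (List.ofFn c) γ
      (List.ofFn fun l => List.ofFn (b l)) = true) :
    Valid a p c ∧ 0 < γ.2 ∧
      HasCheapCover k (discreteMeasure (fun j => fv (a j)) fun i j => fv (p i j))
        (fun i => fv (c i)) (fv γ) := by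
  obtain ⟨h₁, h₂, h₃, h₄, h₅, h₆⟩ := check_iff.1 h
  exact ⟨h₁, h₂, hasCheapCover_of_family h₁.measure_univ_le (fv_nonneg _) hk h₄
    (fun l => ⟨fun i => fv_nonneg _, fun i => (h₃ l i).2⟩) h₅ h₆⟩

/-- Cheap covers yield accepted data. -/
theorem exists_check_of_hasCheapCover (hv : Valid a p c) {k : ℕ} (hk : 1 ≤ k) {γ : Fraction}
    (h : HasCheapCover k (discreteMeasure (fun j => fv (a j)) fun i j => fv (p i j))
        (fun i => fv (c i)) γ.val) :
    0 ≤ γ.val ∧ ∃ g : Fin k → Fin n → Fin (M + 2),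
      check k (List.ofFn a) (List.ofFn fun i => List.ofFn (p i)) (List.ofFn c) (fq γ)
        (List.ofFn fun l => List.ofFn fun i => a (g l i)) = true := by
  obtain ⟨h₁, h₂, g, h₃, h₄⟩ := h.exists_grid hv.a_zero (fun i => fv_nonneg _) hk
  rw [← fv_fq h₁] at h₄
  refine ⟨h₁, g, check_iff.2 ⟨hv, γ.den_pos, fun l i => ⟨hv.a_pos _, ?_⟩, h₂, h₃, h₄⟩⟩
  rw [← hv.a_last]
  exact hv.a_strictMono.monotone (Fin.le_last _)

/-- Each coordinate of a grid point is an entry of `a` and thus no larger than the list `a`, which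
keeps the certificate short. -/
theorem sz_grid_le {k : ℕ} (g : Fin k → Fin n → Fin (M + 2)) :
    sz (List.ofFn fun l => List.ofFn fun i => a (g l i)) ≤
      k * (n * (sz (List.ofFn a) + 1) + 2) + 1 := by
  refine (sz_le_length_mul (n := n * (sz (List.ofFn a) + 1) + 1) fun r hr => ?_).trans_eq
    (by rw [List.length_ofFn])
  obtain ⟨l, rfl⟩ := List.mem_ofFn.1 hr
  refine (sz_le_length_mul (n := sz (List.ofFn a)) fun q hq => ?_).trans_eq
    (by rw [List.length_ofFn])
  obtain ⟨i, rfl⟩ := List.mem_ofFn.1 hq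
  exact (sz_le_of_mem (List.mem_ofFn.2 ⟨_, rfl⟩)).le

end Valid

/-- Certificates for binary instances: probabilities, costs, bound, and cover. -/
abbrev Cert : Type := List (List (ℕ × ℕ)) × (List (ℕ × ℕ) × ((ℕ × ℕ) × List (List (ℕ × ℕ))))

/-- Read a certificate. -/
def asCert (t : BTree) : Cert :=
  (asMatrix t.asFst, asFracs (asSnd t).asFst, asFrac (asSnd (asSnd t)).asFst,
    asMatrix (asSnd (asSnd (asSnd t))))

theorem asCert_toTree (z : Cert) : asCert (Code.toTree z) = z := by simp [asCert]

@[fun_prop]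
theorem pTime_asCert {α : Type} [Code α] {f : α → BTree} (hf : PTime f) :
    PTime fun x => asCert (f x) := by unfold asCert; fun_prop

/-- The discrete Pareto cover problem is in NP. -/
theorem inNP_discreteParetoCoverProblem {k : ℕ} (hk : 1 ≤ k) :
    InNP (discreteParetoCoverProblem k) := by
  refine inNP_of_certificate (τ := List (ℕ × ℕ) × Cert)
    (D := fun t => (asFracs t.asFst, asCert (asSnd t))) (by fun_prop)
    (fun z => by simp [asCert_toTree])
    (W := fun z => encList encFrac z.1 ++ encMatrix z.2.1 ++ encList encFrac z.2.2.1 ++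
      encFrac z.2.2.2.1) (by fun_prop)
    (C := fun z => check k z.1 z.2.1 z.2.2.1 z.2.2.2.1 z.2.2.2.2) (by fun_prop)
    -- For a word of length N, each of the four parts of the input has size at most 6N, and four
    -- pair nodes join the five components. The remaining term is `sz_grid_le`, where the dimension
    -- and the size of the grid are at most 6N.
    (24 * .X + 4 + ((k : ℕ) * (6 * .X * (6 * .X + 1) + 2) + 1)) ?_ ?_
  · rintro ⟨a, p, c, γ, b⟩ h
    dsimp only at h ⊢
    obtain ⟨n, M, a, p, c, b, rfl, rfl, rfl, rfl⟩ := exists_of_check h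
    obtain ⟨hv, hγ, hcov⟩ := hasCheapCover_of_check hk h
    refine ⟨hv.toInstance, toFraction γ hγ, ?_, ?_⟩
    · rw [encDiscrete_eq, encFraction_eq (by rw [val_toFraction]; exact fv_nonneg _)]
      rfl
    · rw [measure_eq, ← fv_c, val_toFraction]
      exact hcov
  · rintro w ⟨I, γ, rfl, h⟩
    rw [measure_eq, ← fv_c] at h
    obtain ⟨hγ, g, hg⟩ := exists_check_of_hasCheapCover (valid_of_instance I) hk h
    refine ⟨(List.ofFn fun j => fq (I.a j), List.ofFn fun i => List.ofFn fun j => fq (I.p i j),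
      List.ofFn fun i => fq (I.c i), fq γ, List.ofFn fun l => List.ofFn fun i => fq (I.a (g l i))),
      ?_, hg, ?_⟩
    · rw [encDiscrete_eq, encFraction_eq hγ]
    · rw [encDiscrete_eq, encFraction_eq hγ]
      have h₁ := sz_list_lt sz_frac_lt (List.ofFn fun j => fq (I.a j))
      have h₂ : _ < 6 * (encMatrix _).length := sz_list_lt (sz_list_lt sz_frac_lt)
        (List.ofFn fun i => List.ofFn fun j => fq (I.p i j))
      have h₃ := sz_list_lt sz_frac_lt (List.ofFn fun i => fq (I.c i))
      have h₄ := sz_frac_lt (fq γ)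
      rw [sz_prod] at h₄
      have h₅ := sz_grid_le (a := fun j => fq (I.a j)) g
      have h₆ := length_lt_sz (List.ofFn fun i => fq (I.c i))
      rw [List.length_ofFn] at h₆
      generalize hN : (_ ++ _ : List Γ').length = N
      simp only [List.length_append] at hN
      have h₇ : k * (I.n * (sz (List.ofFn fun j => fq (I.a j)) + 1) + 2) + 1 ≤
          k * (6 * N * (6 * N + 1) + 2) + 1 := by gcongr <;> omega
      simp [-List.ofFn_succ]
      omega

/-- Identifying `Bool` with `Fin 2` matches the atoms and their weights, so the binary problem
inherits the discrete verifier. -/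
theorem binaryMeasure_eq {n : ℕ} {q : Fin n → ℝ} {a : Fin 2 → ℝ} {p : Fin n → Fin 2 → ℝ}
    (h₀ : a 0 = 0) (h₁ : a 1 = 1) (hp₀ : ∀ i, p i 0 = 1 - q i) (hp₁ : ∀ i, p i 1 = q i) :
    binaryMeasure q = discreteMeasure (M := 0) a p := by
  refine Fintype.sum_equiv (Equiv.arrowCongr (Equiv.refl _) finTwoEquiv.symm) _ _ fun x => ?_
  have (i : Fin n) : p i (finTwoEquiv.symm (x i)) = if x i then q i else 1 - q i := by
    cases h : x i
    · exact hp₀ i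
    · exact hp₁ i
  have (i : Fin n) : a (finTwoEquiv.symm (x i)) = if x i then 1 else 0 := by
    cases h : x i
    · exact h₀
    · exact h₁
  simp [*]

theorem sz_map_le {α β : Type} [Code α] [Code β] {f : α → β} {C : ℕ} (hC : 1 ≤ C)
    (h : ∀ x, sz (f x) ≤ C * sz x) (l : List α) : sz (l.map f) ≤ C * sz l := by
  induction l with
  | nil => simpa using hC
  | cons x l ih =>
    have := h x
    simp [mul_add]
    omega

/-- The distribution of a coordinate that equals one with probability `q`. -/
def bernoulliRow (q : ℕ × ℕ) : List (ℕ × ℕ) := [(q.2 - q.1, q.2), q]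

theorem sz_bernoulliRow_le (q : ℕ × ℕ) : sz (bernoulliRow q) ≤ 9 * sz q := by
  have h₁ := sz_nat_mono (Nat.sub_le q.2 q.1)
  have h₂ := sz_pos q.1
  simp [bernoulliRow]
  omega

/-- The truncated subtraction is exact because the numerator is at most the denominator. -/
theorem fv_compl {q : Fraction} (h : q.val ∈ Set.Icc (0 : ℝ) 1) :
    fv ((fq q).2 - (fq q).1, (fq q).2) = 1 - q.val := by
  have h₁ : fv (fq q) ≤ 1 := (fv_fq h.1).trans_le h.2
  have h₂ : ((fq q).2 : ℝ) ≠ 0 := by exact_mod_cast q.den_pos.ne'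
  rw [fv_le_one_iff q.den_pos] at h₁
  rw [← fv_fq h.1, fv, fv, Nat.cast_sub h₁, sub_div, div_self h₂]

theorem encBinary_eq (I : BinaryInstance) :
    encBinary I = encList encFrac (List.ofFn fun i => fq (I.p i)) ++
      encList encFrac (List.ofFn fun i => fq (I.c i)) := by
  rw [encBinary, encFamily_fraction fun i => (I.p_mem i).1, encFamily_fraction I.c_nonneg]

/-- The binary Pareto cover problem is in NP. -/
theorem inNP_binaryParetoCoverProblem {k : ℕ} (hk : 1 ≤ k) :
    InNP (binaryParetoCoverProblem k) := by
  refine inNP_of_certificate (D := asCert) (by fun_prop) asCert_toTree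
    -- The certificate contains full rows for the two values. Only the second entry, the probability
    -- of one, appears in the word; the first is determined up to its representation by the row sum.
    (W := fun z => encList encFrac (z.1.map fun r => r.tail.headD (0, 1)) ++
      encList encFrac z.2.1 ++ encFrac z.2.2.1) (by fun_prop)
    (C := fun z => check k [(0, 1), (1, 1)] z.1 z.2.1 z.2.2.1 z.2.2.2) (by fun_prop)
    -- For a word of length N, the rows have size at most 9 * 6N by `sz_bernoulliRow_le`, costs and
    -- bound at most 6N each, and three pair nodes join the four components. The grid has constant
    -- size.
    (66 * .X + 3 + ((k : ℕ) * (6 * .X * (sz [((0 : ℕ), (1 : ℕ)), (1, 1)] + 1 : ℕ) + 2) + 1)) ?_ ?_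
  · rintro ⟨p, c, γ, b⟩ h
    dsimp only at h ⊢
    obtain ⟨n, M, a, p, c, b, ha, rfl, rfl, rfl⟩ := exists_of_check h
    rw [ha] at h
    obtain ⟨hv, hγ, hcov⟩ := hasCheapCover_of_check hk h
    obtain rfl : M = 0 := by simpa using (congrArg List.length ha).symm
    have hp₁ (i : Fin n) := val_toFraction (p i 1) (hv.p_pos i 1)
    have hp₀ (i : Fin n) : fv (p i 0) = 1 - (toFraction (p i 1) (hv.p_pos i 1)).val := by
      rw [hp₁, ← hv.p_sum i, Fin.sum_univ_two, add_sub_cancel_right]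
    refine ⟨⟨n, fun i => toFraction (p i 1) (hv.p_pos i 1), fun i => toFraction (c i) (hv.c_pos i),
      fun i => by rw [hp₁]; exact ⟨fv_nonneg _, hv.fv_p_le_one i 1⟩,
      fun i => by rw [val_toFraction]; exact fv_nonneg _⟩, toFraction γ hγ, ?_, ?_⟩
    · rw [encBinary_eq, encFraction_eq (by rw [val_toFraction]; exact fv_nonneg _), List.map_ofFn]
      rfl
    · rw [BinaryInstance.measure, binaryMeasure_eq (a := fun j => fv (a j))
        (p := fun i j => fv (p i j)) hv.a_zero hv.a_last hp₀ fun i => (hp₁ i).symm]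
      have hc : (fun i => (toFraction (c i) (hv.c_pos i)).val) = fun i => fv (c i) :=
        funext fun i => val_toFraction _ _
      rw [val_toFraction]
      rw [← hc] at hcov
      exact hcov
  · rintro w ⟨I, γ, rfl, h⟩
    let a : Fin 2 → ℕ × ℕ := ![(0, 1), (1, 1)]
    let p (i : Fin I.n) : Fin 2 → ℕ × ℕ :=
      ![((fq (I.p i)).2 - (fq (I.p i)).1, (fq (I.p i)).2), fq (I.p i)]
    have hp₀ (i : Fin I.n) : fv (p i 0) = 1 - (I.p i).val := fv_compl (I.p_mem i)
    have hp₁ (i : Fin I.n) : fv (p i 1) = (I.p i).val := fv_fq (I.p_mem i).1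
    have hv : Valid (M := 0) a p fun i => fq (I.c i) :=
      { a_pos := by simp [a, Fin.forall_fin_two]
        p_pos := fun i => Fin.forall_fin_two.2 ⟨(I.p i).den_pos, (I.p i).den_pos⟩
        c_pos := fun i => (I.c i).den_pos
        a_zero := by simp [a, fv]
        a_last := by simp [a, fv]
        a_strictMono := Fin.strictMono_iff_lt_succ.2 fun j => by
          obtain rfl := Subsingleton.elim j 0
          simp [a, fv]
        p_sum := fun i => by rw [Fin.sum_univ_two, hp₀, hp₁, sub_add_cancel] }
    rw [BinaryInstance.measure, binaryMeasure_eq (a := fun j => fv (a j))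
        (p := fun i j => fv (p i j)) hv.a_zero hv.a_last hp₀ hp₁,
      show I.cost = fun i => fv (fq (I.c i)) from funext fun i => (fv_fq (I.c_nonneg i)).symm] at h
    obtain ⟨hγ, g, hg⟩ := exists_check_of_hasCheapCover hv hk h
    refine ⟨(List.ofFn fun i => List.ofFn (p i), List.ofFn fun i => fq (I.c i), fq γ,
      List.ofFn fun l => List.ofFn fun i => a (g l i)), ?_, hg, ?_⟩
    · rw [encBinary_eq, encFraction_eq hγ, List.map_ofFn]
      rfl
    · rw [encBinary_eq, encFraction_eq hγ]
      have h₁ := sz_list_lt sz_frac_lt (List.ofFn fun i => fq (I.p i))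
      have h₂ := sz_map_le (by norm_num) sz_bernoulliRow_le (List.ofFn fun i => fq (I.p i))
      rw [List.map_ofFn, show bernoulliRow ∘ (fun i => fq (I.p i)) = fun i => List.ofFn (p i)
        from rfl] at h₂
      have h₃ := sz_list_lt sz_frac_lt (List.ofFn fun i => fq (I.c i))
      have h₄ := sz_frac_lt (fq γ)
      rw [sz_prod] at h₄
      have h₅ := sz_grid_le (M := 0) (a := a) g
      have h₆ := length_lt_sz (List.ofFn fun i => fq (I.c i))
      rw [List.length_ofFn] at h₆
      generalize hN : (_ ++ _ : List Γ').length = N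
      simp only [List.length_append] at hN
      have h₇ : k * (I.n * (sz (List.ofFn a) + 1) + 2) + 1 ≤
          k * (6 * N * (sz (List.ofFn a) + 1) + 2) + 1 := by gcongr; omega
      have h₈ : sz (List.ofFn a) = sz [((0 : ℕ), (1 : ℕ)), (1, 1)] := rfl
      rw [← h₈]
      simp [-List.ofFn_succ]
      omega

end CoverEval

theorem mainTheorem6 (k : ℕ) (hk : 1 ≤ k) :
    (∃ f : ParetoCover.CoverInstance k → ParetoCover.Fraction,
      ParetoCover.PolyTime ParetoCover.encCover ParetoCover.encFraction f ∧
      ∀ I : ParetoCover.CoverInstance k,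
        ((ParetoCover.expectedCost I.measure I.cost I.cover : ENNReal) : EReal) =
          ((f I).val : EReal)) ∧
    ParetoCover.InNP (ParetoCover.discreteParetoCoverProblem k) ∧
    ParetoCover.InNP (ParetoCover.binaryParetoCoverProblem k) :=
  ⟨CoverEval.exists_polyTime_expectedCost k, CoverEval.inNP_discreteParetoCoverProblem hk,
    CoverEval.inNP_binaryParetoCoverProblem hk⟩
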